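/- A \emph{game} consists of a finite set $\Sigma$ of players, a finite set $S$ of states, for each player $p$ a finite set $A_p$ of actions and for each state $s$ a nonempty set $\mathsf{Av}_p(s)\subseteq A_p$ of available actions, a transition function $\delta$ that maps each state $s$ and each tuple $(a_p)_{p\in\Sigma}\in\prod_{p\in\Sigma}\mathsf{Av}_p(s)$ to a probability distribution over $S$, a team $\Pi\subseteq\Sigma$ whose complement is a single player $\mathsf O$ (the opponent), a set $T\subseteq S$ of target states that is absorbing ($\delta(t,\bar a)(t)=1$ for all $t\in T$ and all available $\bar a$), and an initial state $s_0\in S$. A strategy of player $p$ maps each finite nonempty word $hs$ over $S$ with last letter $s$ to a probability distribution over $\mathsf{Av}_p(s)$. A strategy for each player induces a probability measure on the infinite words over $S$ that start at $s_0$: after $hs$, the players draw their actions independently from their distributions at $hs$, and the next state is drawn from $\delta(s,\bar a)$. A collective strategy is a tuple of strategies, one for each player of $\Pi$. The \emph{almost-sure problem} is the following decision problem: given a game with rational transition probabilities, is there a collective strategy such that for every strategy of $\mathsf O$ the set $T$ is reached with probability $1$? The input is a word over a finite alphabet that lists explicitly the states (with a mark on target states and on the initial state), the sets $\mathsf{Av}_p(s)$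 as subsets of $A_p$, and, for each state $s$ and each tuple in $\prod_{p}\mathsf{Av}_p(s)$, the transition distribution, given by the numerators, in binary, of the probabilities over a common denominator (so that the probability of $t$ is the numerator of $t$ divided by the sum of the numerators). The number of players is part of the input. \textbf{Theorem.} The almost-sure problem is in $\mathsf{NP}$: the language of the words that encode positive instances has a verifier that runs in polynomial time on a Turing machine, with certificates of polynomial length. -/

import Mathlib

open scoped ENNReal

noncomputable section

namespace TeamGames

/-! ### Team concurrent stochastic reachability games -/

/-- A game structure with players `P`, states `S` and actions `A p` of player `p`. The transition
function is given exactly on the tuples of available actions. -/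
structure GameStructure (P S : Type) (A : P → Type) where
  /-- the actions of player `p` available at state `s` -/
  Av : (p : P) → S → Finset (A p)
  Av_nonempty : ∀ p s, (Av p s).Nonempty
  /-- the transition function -/
  δ : (s : S) → ((p : P) → Av p s) → PMF S

/-- A game: a game structure with a team, an absorbing set of target states, and an initial
state. -/
structure Game (P S : Type) (A : P → Type) extends GameStructure P S A where
  /-- the team -/
  team : Set P
  /-- the target states -/
  target : Set S
  /-- the initial state -/
  init : S
  absorbing : ∀ t ∈ target, ∀ a : (p : P) → Av p t, δ t a t = 1

namespace GameStructure

variable {P S : Type} {A : P → Type} (G : GameStructure P S A)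

/-- A strategy of player `p` maps each history `h s` (a word `h` over the states followed by a
last state `s`) to a probability distribution over the actions available at `s`. -/
abbrev Strategy (p : P) : Type := List S → (s : S) → PMF (G.Av p s)

/-- Strategy profiles for a set `Q` of players. -/
abbrev Profile (Q : Set P) : Type := (p : Q) → G.Strategy p

open Classical in
/-- The complete strategy profile made of a profile for `Q` and a profile for the other players. -/
def combine {Q : Set P} (σ : G.Profile Q) (τ : G.Profile Qᶜ) (p : P) : G.Strategy p :=
  if h : p ∈ Q then σ ⟨p, h⟩ else τ ⟨p, h⟩

variable [Fintype P] [DecidableEq P] [Fintype S]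

theorem sum_step_eq_one (σ : (p : P) → G.Strategy p) (h : List S) (s : S) :
    ∑ t, ∑ a : (p : P) → G.Av p s, (∏ p, σ p h s (a p)) * G.δ s a t = 1 := by
  have h1 : ∀ {α : Type} [Fintype α] (q : PMF α), ∑ x, q x = 1 := fun q => by
    rw [← tsum_fintype (L := SummationFilter.unconditional _), q.tsum_coe]
  rw [Finset.sum_comm]
  simp_rw [← Finset.mul_sum, h1, mul_one]
  rw [← Fintype.piFinset_univ, ← Finset.prod_univ_sum]
  exact Finset.prod_eq_one fun p _ => h1 _

/-- The distribution of the next state after the history `h s`, when every player randomises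
independently according to the complete strategy profile `σ`. -/
def step (σ : (p : P) → G.Strategy p) (h : List S) (s : S) : PMF S :=
  PMF.ofFintype
    (fun t => ∑ a : (p : P) → G.Av p s, (∏ p, σ p h s (a p)) * G.δ s a t)
    (G.sum_step_eq_one σ h s)

variable [MeasurableSpace S] [MeasurableSingletonClass S]

/-- The transition kernel from the first `n + 1` states of a play to the next state. -/
def stepKernel (σ : (p : P) → G.Strategy p) (n : ℕ) :
    ProbabilityTheory.Kernel (Finset.Iic n → S) S :=
  ProbabilityTheory.Kernel.ofFunOfCountable fun x =>
    (G.step σ (List.ofFn fun i : Fin n => x ⟨i, Finset.mem_Iic.2 i.2.le⟩)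
      (x ⟨n, Finset.mem_Iic.2 le_rfl⟩)).toMeasure

instance (σ : (p : P) → G.Strategy p) (n : ℕ) :
    ProbabilityTheory.IsMarkovKernel (G.stepKernel σ n) :=
  ⟨fun _ => PMF.toMeasure.isProbabilityMeasure _⟩

/-- The probability distribution over plays that start at `s₀` and follow `σ`. -/
def playMeasure (σ : (p : P) → G.Strategy p) (s₀ : S) : MeasureTheory.Measure (ℕ → S) :=
  ProbabilityTheory.Kernel.traj (X := fun _ => S) (G.stepKernel σ) 0 fun _ => s₀

end GameStructure

/-- A positive instance of the almost-sure problem: there is a collective strategy of the team such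
that, whatever the other players do, the target is reached with probability `1`. -/
def Game.AlmostSure {P S : Type} {A : P → Type} [Fintype P] [DecidableEq P] [Fintype S]
    [MeasurableSpace S] [MeasurableSingletonClass S] (G : Game P S A) : Prop :=
  ∃ σ : G.Profile G.team, ∀ τ : G.Profile G.teamᶜ,
    G.playMeasure (G.combine σ τ) G.init {π | ∃ i, π i ∈ G.target} = 1

/-! ### Finite games as inputs of algorithms -/

/-- A finite game with rational transition probabilities, as finite data. The states are
`0, …, numStates - 1`; player `0` is the opponent and players `1, …, numTeam` form the team; the
probability of moving to `t` is `weight s a t / ∑ t', weight s a t'`, so that the weights are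
numerators over a common denominator. -/
structure Instance where
  numStates : ℕ
  numTeam : ℕ
  numActions : Fin (numTeam + 1) → ℕ
  Av : (p : Fin (numTeam + 1)) → Fin numStates → Finset (Fin (numActions p))
  Av_nonempty : ∀ p s, (Av p s).Nonempty
  weight : (s : Fin numStates) → ((p : Fin (numTeam + 1)) → Av p s) → Fin numStates → ℕ
  weight_ne_zero : ∀ s a, ∃ t, weight s a t ≠ 0
  target : Finset (Fin numStates)
  init : Fin numStates
  absorbing : ∀ t ∈ target, ∀ a t', t' ≠ t → weight t a t' = 0

namespace Instance

variable (I : Instance)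

theorem sum_weight_div_eq_one (s : Fin I.numStates) (a : (p : Fin (I.numTeam + 1)) → I.Av p s) :
    ∑ t, (I.weight s a t : ℝ≥0∞) / ((∑ t', I.weight s a t' : ℕ) : ℝ≥0∞) = 1 := by
  simp_rw [div_eq_mul_inv, ← Finset.sum_mul, ← Nat.cast_sum]
  refine ENNReal.mul_inv_cancel ?_ (ENNReal.natCast_ne_top _)
  obtain ⟨t, ht⟩ := I.weight_ne_zero s a
  rw [Nat.cast_ne_zero]
  exact fun h => ht (Finset.sum_eq_zero_iff.1 h t (Finset.mem_univ t))

/-- The game described by an instance. -/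
def toGame : Game (Fin (I.numTeam + 1)) (Fin I.numStates) (fun p => Fin (I.numActions p)) where
  Av := I.Av
  Av_nonempty := I.Av_nonempty
  δ s a := PMF.ofFintype
    (fun t => (I.weight s a t : ℝ≥0∞) / ((∑ t', I.weight s a t' : ℕ) : ℝ≥0∞))
    (I.sum_weight_div_eq_one s a)
  team := {p | p ≠ 0}
  target := {s | s ∈ I.target}
  init := I.init
  absorbing t ht a := by
    have h := I.sum_weight_div_eq_one t a
    rw [Finset.sum_eq_single t (fun t' _ hne => by simp [I.absorbing t ht a t' hne])
      (fun h => absurd (Finset.mem_univ t) h)] at h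
    simpa using h

end Instance

/-! ### Encoding instances as words -/

open Computability

/-- All tuples with `i`-th entry in the list `L i`, in lexicographic order (the entry with index `0`
is the most significant one). -/
def tuples : {k : ℕ} → {α : Fin k → Type} → ((i : Fin k) → List (α i)) → List ((i : Fin k) → α i)
  | 0, _, _ => [fun i => i.elim0]
  | _ + 1, _, L => (L 0).flatMap fun a => (tuples fun i => L i.succ).map fun b => Fin.cons a b

/-- A truth value, as one bit. -/
def encBit (b : Bool) : List Γ' := [Γ'.bit b]

/-- A natural number in binary, least significant bit first, ended by a comma. -/
def encNat (n : ℕ) : List Γ' := (encodeNat n).map Γ'.bit ++ [Γ'.comma]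

/-- A list, as a bracketed sequence. -/
def encList {α : Type} (enc : α → List Γ') (l : List α) : List Γ' :=
  Γ'.bra :: (l.flatMap enc ++ [Γ'.ket])

namespace Instance

variable (I : Instance)

/-- The available actions, in increasing order. -/
def avList (p : Fin (I.numTeam + 1)) (s : Fin I.numStates) : List (I.Av p s) :=
  (List.finRange (I.numActions p)).filterMap fun a =>
    if h : a ∈ I.Av p s then some ⟨a, h⟩ else none

/-- The record of a state: whether it is a target, whether it is the initial state, for every player
the characteristic word of the set of available actions, and for every tuple of available actions
(in lexicographic order) the weights of all successor states in binary. -/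
def encState (s : Fin I.numStates) : List Γ' :=
  Γ'.bra ::
    (encBit (decide (s ∈ I.target)) ++ encBit (decide (s = I.init)) ++
      encList (fun p => encList (fun a => encBit (decide (a ∈ I.Av p s)))
        (List.finRange (I.numActions p))) (List.finRange (I.numTeam + 1)) ++
      encList (fun a => encList (fun t => encNat (I.weight s a t)) (List.finRange I.numStates))
        (tuples fun p => I.avList p s) ++
      [Γ'.ket])

/-- The word that encodes an instance: the list of the records of its states. -/
def encode : List Γ' := encList I.encState (List.finRange I.numStates)

end Instance

/-- The almost-sure problem, as a formal language: the encodings of the games that are positive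
instances. -/
def almostSureProblem : Language Γ' :=
  {x | ∃ I : Instance, I.encode = x ∧ I.toGame.AlmostSure}

/-! ### The class NP -/

/-- A language is in NP if it has a polynomial-time verifier: a predicate `V` on pairs of words that
some Turing machine (with finitely many stacks) computes in polynomial time, such that the words
`x` of the language are those that have a certificate `w` of length polynomial in that of `x`
with `V (x, w) = true`. -/
def InNP {Γ : Type} [Fintype Γ] (L : Language Γ) : Prop :=
  ∃ (V : List Γ × List Bool → Bool) (q : Polynomial ℕ),
    Nonempty (Turing.TM2ComputableInPolyTime
      (encodingProd (encodingList Γ) (encodingList Bool)).encode encodeBool V) ∧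
    ∀ x : List Γ, x ∈ L ↔ ∃ w : List Bool, w.length ≤ q.eval x.length ∧ V (x, w) = true

end TeamGames

end

/-! Almost-sure reachability depends only on supports. `Game.Chain` describes the sets that arise
inside a region `W` by adding states one after the other, where an added state is a target or
carries a set of actions for each team player (its supports) such that all transitions under tuples
from the supports stay in `W`, whatever the opponent does, and against each single action of the
opponent some tuple from the supports moves with positive probability to a state added earlier. By
`Game.almostSure_iff_chain`, the team wins iff some `W` that contains the initial state can be
exhausted in this way.

Sufficiency (`Game.Chain.winsAt`): the team plays uniformly on the supports, without memory. The
play stays in `W` until it hits the target, and from each non-target state of `W` the rank drops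
with probability at least some fixed ε > 0. Let `m` be the infimum of the probability of reaching
the target, over all histories and all states of `W`. Descending through the ranks gives `m ≥ m + ε
^ (K + 1) * (1 - m)` with a bound `K` on the ranks, so `m = 1`. Necessity (`Game.exists_addable`):
let `W` consist of the states at which some collective strategy wins after some history. If a proper
subset `D` of `W` admitted no further state, then against a winning strategy the opponent, who knows
its supports, could always pick an action that avoids `D`; the play would stay in `W` outside `D`,
where there is no target, and the target would be reached with probability 0.

The certificate thus amounts to `W`, an order on it, and supports. It can be checked in polynomial
time although the number of action tuples may be exponential in the number of players, because the
input lists one row of weights for each tuple, and only the vanishing of a weight matters.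

To obtain an actual Turing machine, the certificate is taken to be the word of stack operations that
a nondeterministic verifier performs. The permitted words form a regular language, so one generic
machine suffices: it decodes the operations, executes them and runs a finite automaton on them
(`inNP_of_isRegular`). The verifier is therefore a regular expression over stack operations, built
with concatenation, finite union and star. `Rel` describes every successful run and serves
soundness; `Exec` gives a run of bounded length and serves completeness.

The verifier guesses the region and the numbers of actions and then reads the whole input several
times, once per round, with supports guessed afresh; a round may rank further states. It also has to
check that the input is the encoding of a game: a successful first round allows an instance to be
rebuilt (`exists_instance_of_roundOK`), and unique decoding identifies what is read in each round
with that instance. One round without ranking and one round per state of `W` are enough, which gives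
the polynomial bound. -/

namespace Language

open scoped Computability

variable {α : Type*}

/-! ### Closure properties of regular languages, by counting left quotients -/

/-- A left quotient consists of suffixes of words of `L`; there are finitely many such suffixes,
hence finitely many sets of them, and the Myhill–Nerode criterion applies. -/
theorem isRegular_of_finite {L : Language α} (h : Set.Finite {x | x ∈ L}) : L.IsRegular := by
  refine .of_finite_range_leftQuotient ?_
  have hS : Set.Finite (⋃ x ∈ {x | x ∈ L}, {y | y <:+ x}) := by
    refine h.biUnion fun x _ => ?_
    refine (List.finite_toSet x.tails).subset fun y hy => ?_
    simpa using hy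
  refine (hS.finite_subsets).subset ?_
  rintro _ ⟨x, rfl⟩ y hy
  exact Set.mem_biUnion (show x ++ y ∈ {x | x ∈ L} from hy) (List.suffix_append _ _)

theorem isRegular_zero : (0 : Language α).IsRegular :=
  isRegular_of_finite (by simp)

theorem isRegular_one : (1 : Language α).IsRegular :=
  isRegular_of_finite (by simp)

theorem isRegular_singleton (x : List α) : ({x} : Language α).IsRegular :=
  isRegular_of_finite (Set.finite_singleton x)

/-- Quotients commute with unions, so a quotient of the union is determined by a family of quotients
of its members. -/
theorem IsRegular.iSup {ι : Type*} [Finite ι] {L : ι → Language α} (h : ∀ i, (L i).IsRegular) :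
    (⨆ i, L i).IsRegular := by
  refine .of_finite_range_leftQuotient ?_
  have hfin : Set.Finite (Set.pi Set.univ fun i => Set.range (L i).leftQuotient) :=
    Set.Finite.pi fun i => (h i).finite_range_leftQuotient
  refine (hfin.image fun f => ⨆ i, f i).subset ?_
  rintro _ ⟨x, rfl⟩
  refine ⟨fun i => (L i).leftQuotient x, fun i _ => ⟨x, rfl⟩, ?_⟩
  ext y
  simp [mem_iSup]

/-- When `x` is removed from a word of `L * M`, either `x` ends inside the first factor, or `x = u
++ v` with `u` in `L` and `v` the beginning of the second factor. The quotient is thus determined by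
one quotient of `L` and a set of quotients of `M`, for which there are finitely many choices. -/
theorem IsRegular.mul {L M : Language α} (hL : L.IsRegular) (hM : M.IsRegular) :
    (L * M).IsRegular := by
  refine .of_finite_range_leftQuotient ?_
  refine ((hL.finite_range_leftQuotient.prod hM.finite_range_leftQuotient.finite_subsets).image
    fun p : Language α × Set (Language α) => p.1 * M + sSup p.2).subset ?_
  rintro _ ⟨x, rfl⟩
  refine ⟨(L.leftQuotient x, {N | ∃ u v, u ++ v = x ∧ u ∈ L ∧ N = M.leftQuotient v}),
    ⟨⟨x, rfl⟩, ?_⟩, ?_⟩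
  · rintro _ ⟨u, v, -, -, rfl⟩
    exact ⟨v, rfl⟩
  · ext y
    simp only [mem_add, mem_mul, mem_leftQuotient]
    constructor
    · rintro (⟨a, ha, b, hb, rfl⟩ | ⟨N, ⟨u, v, rfl, hu, rfl⟩, hy⟩)
      · exact ⟨x ++ a, ha, b, hb, by simp⟩
      · exact ⟨u, hu, v ++ y, hy, by simp⟩
    · rintro ⟨a, ha, b, hb, h⟩
      rcases List.append_eq_append_iff.1 h with ⟨c, rfl, rfl⟩ | ⟨c, rfl, rfl⟩
      · exact Or.inr ⟨_, ⟨a, c, rfl, ha, rfl⟩, hb⟩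
      · exact Or.inl ⟨c, ha, b, hb, rfl⟩

theorem append_mem_kstar {L : Language α} {x y : List α} (hx : x ∈ L∗) (hy : y ∈ L∗) :
    x ++ y ∈ L∗ := by
  obtain ⟨l, rfl, hl⟩ := hx
  obtain ⟨m, rfl, hm⟩ := hy
  refine mem_kstar.2 ⟨l ++ m, by simp, fun z hz => ?_⟩
  exact (List.mem_append.1 hz).elim (hl z) (hm z)

/-- The factor `v ++ y₁` is the one in which `x` ends; if `x` ends at a boundary, it is the factor
before the boundary and `y₁` is empty. Nonemptiness of `x` guarantees that such a factor exists. -/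
theorem exists_split_of_append_mem_kstar {L : Language α} (l : List (List α))
    (hl : ∀ z ∈ l, z ∈ L) (x y : List α) (hx : x ≠ []) (h : l.flatten = x ++ y) :
    ∃ u v y₁ y₂, x = u ++ v ∧ y = y₁ ++ y₂ ∧ u ∈ L∗ ∧ v ++ y₁ ∈ L ∧ y₂ ∈ L∗ := by
  induction l generalizing x with
  | nil => simp_all
  | cons z l ih =>
    have hz := hl z (by simp)
    have hl' := fun z h => hl z (List.mem_cons_of_mem _ h)
    rw [List.flatten_cons] at h
    rcases List.append_eq_append_iff.1 h with ⟨c, rfl, hc⟩ | ⟨c, rfl, rfl⟩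
    · by_cases hc0 : c = []
      · subst hc0
        exact ⟨[], z, [], y, by simp, by simp, nil_mem_kstar _, by simpa using hz,
          ⟨l, by simpa using hc.symm, hl'⟩⟩
      · obtain ⟨u, v, y₁, y₂, rfl, rfl, hu, hv, hy⟩ := ih hl' c hc0 hc
        refine ⟨z ++ u, v, y₁, y₂, by simp, rfl, ?_, hv, hy⟩
        exact append_mem_kstar ⟨[z], by simp, by simpa using hz⟩ hu
    · exact ⟨[], x, c, l.flatten, by simp, rfl, nil_mem_kstar _, hz, ⟨l, rfl, hl'⟩⟩

/-- For nonempty `x` the quotient is a union of quotients of `L`, followed by `L∗`: the factor in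
which `x` ends is completed and further factors follow. The empty word contributes the one
additional quotient `L∗`. -/
theorem IsRegular.kstar {L : Language α} (hL : L.IsRegular) : (L∗).IsRegular := by
  refine .of_finite_range_leftQuotient ?_
  refine (((hL.finite_range_leftQuotient.finite_subsets).image
    fun S : Set (Language α) => sSup S * L∗).insert L∗).subset ?_
  rintro _ ⟨x, rfl⟩
  by_cases hx : x = []
  · subst hx
    exact Set.mem_insert _ _
  refine Set.mem_insert_of_mem _
    ⟨{N | ∃ u v, u ++ v = x ∧ u ∈ L∗ ∧ N = L.leftQuotient v}, ?_, ?_⟩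
  · rintro _ ⟨u, v, -, -, rfl⟩
    exact ⟨v, rfl⟩
  · ext y
    simp only [mem_mul, mem_leftQuotient]
    constructor
    · rintro ⟨a, ⟨N, ⟨u, v, rfl, hu, rfl⟩, ha⟩, b, hb, rfl⟩
      have hva : v ++ a ∈ L∗ :=
        ⟨[v ++ a], by simp, fun z hz => by rw [List.mem_singleton.1 hz]; exact ha⟩
      simpa using append_mem_kstar hu (append_mem_kstar hva hb)
    · rintro ⟨l, h, hl⟩
      obtain ⟨u, v, y₁, y₂, rfl, rfl, hu, hv, hy⟩ :=
        exists_split_of_append_mem_kstar l hl x y hx h.symm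
      exact ⟨y₁, ⟨_, ⟨u, v, rfl, hu, rfl⟩, hv⟩, y₂, hy, rfl⟩

end Language

open scoped ENNReal

noncomputable section

namespace TeamGames

open Function Computability

/-! ### Words of stack operations -/

/-- An operation on a family of stacks: push a symbol, pop a prescribed symbol, or test that a stack
is empty. The last two fail when the stack is not of the required form. -/
inductive StackOp {K : Type} (A : K → Type) : Type
  | push (k : K) (a : A k)
  | pop (k : K) (a : A k)
  | isEmpty (k : K)

namespace StackOp

variable {K : Type} {A : K → Type}

instance [Finite K] [∀ k, Finite (A k)] : Finite (StackOp A) := by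
  let f : StackOp A → (Σ k, A k) ⊕ (Σ k, A k) ⊕ K := fun o => match o with
    | push k a => .inl ⟨k, a⟩
    | pop k a => .inr (.inl ⟨k, a⟩)
    | isEmpty k => .inr (.inr k)
  refine Finite.of_injective f ?_
  rintro (⟨k, a⟩ | ⟨k, a⟩ | k) (⟨k', a'⟩ | ⟨k', a'⟩ | k') h <;> simp_all [f]

variable [DecidableEq K] [∀ k, DecidableEq (A k)]

/-- The effect of an operation on the stacks. -/
def apply : StackOp A → (∀ k, List (A k)) → Option (∀ k, List (A k))
  | push k a, s => some (update s k (a :: s k))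
  | pop k a, s => if (s k).head? = some a then some (update s k (s k).tail) else none
  | isEmpty k, s => if (s k).head? = none then some s else none

/-- The effect of a word of operations. -/
def run : List (StackOp A) → (∀ k, List (A k)) → Option (∀ k, List (A k))
  | [], s => some s
  | o :: w, s => (o.apply s).bind (run w)

theorem run_append (w w' : List (StackOp A)) (s : ∀ k, List (A k)) :
    run (w ++ w') s = (run w s).bind (run w') := by
  induction w generalizing s with
  | nil => rfl
  | cons o w ih =>
    simp only [List.cons_append, run]
    cases o.apply s <;> simp [ih]

end StackOp

/-! ### A Turing machine that executes words of stack operations -/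

namespace OpMachine

variable {K : Type} {A : K → Type} {Γ Q : Type} {N : ℕ}

/-- The alphabets of the machine: an input stack, an output stack, and the stacks operated on. -/
abbrev Alphabet (Γ : Type) (A : K → Type) : Bool ⊕ K → Type
  | .inl false => Γ ⊕ Bool
  | .inl true => Bool
  | .inr k => A k

/-- The finite memory of the machine: the state of an automaton, a counter, the last symbol read, and
two flags. -/
structure Memory (Γ Q : Type) (N : ℕ) : Type where
  q : Q
  c : Fin (N + 1)
  last : Option (Γ ⊕ Bool)
  ok : Bool
  busy : Bool

instance [Finite Γ] [Finite Q] : Finite (Memory Γ Q N) :=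
  Finite.of_injective (fun v => (v.q, v.c, v.last, v.ok, v.busy)) <| by
    rintro ⟨⟩ ⟨⟩ h
    simp_all

/-- The labels of the machine. -/
inductive Label (A : K → Type) : Type
  | load
  | main
  | inc
  | exec (o : Option (StackOp A))
  | finish
  | fail
  | clear

instance [Finite K] [∀ k, Finite (A k)] : Finite (Label A) := by
  let f : Label A → Fin 6 ⊕ Option (StackOp A) := fun l => match l with
    | .load => .inl 0
    | .main => .inl 1
    | .inc => .inl 2
    | .exec o => .inr o
    | .finish => .inl 3
    | .fail => .inl 4
    | .clear => .inl 5
  refine Finite.of_injective f ?_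
  rintro (_ | _) (_ | _) h <;> simp_all [f]

/-- The next value of the counter. -/
def incr (c : Fin (N + 1)) : Fin (N + 1) := if h : c.1 + 1 < N + 1 then ⟨c.1 + 1, h⟩ else c

/-- The operation that the counter stands for. -/
def decodeOp (e : StackOp A ≃ Fin N) (c : Fin (N + 1)) : Option (StackOp A) :=
  if h : c.1 < N then some (e.symm ⟨c.1, h⟩) else none

/-- An operation as a binary word: its number in unary. -/
def codeOp (e : StackOp A ≃ Fin N) (o : StackOp A) : List Bool :=
  List.replicate (e o).1 true ++ [false]

open Classical in
/-- The answer of the machine on a binary word, started in a given state of the automaton, of the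
counter and of the stacks. -/
def answer [DecidableEq K] [∀ k, DecidableEq (A k)] (e : StackOp A ≃ Fin N)
    (M : DFA (StackOp A) Q) : Q → Fin (N + 1) → (∀ k, List (A k)) → List Bool → Bool
  | q, _, _, [] => decide (q ∈ M.accept)
  | q, c, s, true :: w => answer e M q (incr c) s w
  | q, c, s, false :: w => match decodeOp e c with
    | none => false
    | some o => match o.apply s with
      | none => false
      | some s' => answer e M (M.step q o) 0 s' w

section Answer

variable [DecidableEq K] [∀ k, DecidableEq (A k)] (e : StackOp A ≃ Fin N) (M : DFA (StackOp A) Q)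

/-- Each `false` completes the code of one operation. Bits after the last `false` decode to nothing,
and the answer on the empty word ignores the counter, so they do no harm. -/
theorem exists_run_of_answer {w : List Bool} {q : Q} {c : Fin (N + 1)} {s : ∀ k, List (A k)}
    (h : answer e M q c s w = true) :
    ∃ l, (StackOp.run l s).isSome ∧ M.evalFrom q l ∈ M.accept := by
  induction w generalizing q c s with
  | nil => exact ⟨[], rfl, by simpa [answer] using h⟩
  | cons b w ih =>
    cases b
    · rw [answer] at h
      cases hd : decodeOp e c with
      | none => simp [hd] at h
      | some o =>
        cases hs : o.apply s with
        | none => simp [hd, hs] at h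
        | some s' =>
          simp only [hd, hs] at h
          obtain ⟨l, h1, h2⟩ := ih h
          exact ⟨o :: l, by simpa [StackOp.run, hs] using h1, by simpa using h2⟩
    · exact ih h

theorem answer_replicate (n : ℕ) (q : Q) (c : Fin (N + 1)) (s : ∀ k, List (A k)) (w : List Bool)
    (h : c.1 + n < N + 1) :
    answer e M q c s (List.replicate n true ++ w) = answer e M q ⟨c.1 + n, h⟩ s w := by
  induction n generalizing c with
  | zero => rfl
  | succ n ih =>
    have h1 : c.1 + 1 < N + 1 := by omega
    rw [List.replicate_succ, List.cons_append, answer, incr, dif_pos h1, ih _ (by simp; omega)]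
    congr 2
    simp; omega

theorem answer_of_run {l : List (StackOp A)} {q : Q} {s : ∀ k, List (A k)}
    (h : (StackOp.run l s).isSome) (hq : M.evalFrom q l ∈ M.accept) :
    answer e M q 0 s (l.flatMap (codeOp e)) = true := by
  induction l generalizing q s with
  | nil => simpa [answer] using hq
  | cons o l ih =>
    have h0 : (0 : Fin (N + 1)).1 + (e o).1 < N + 1 := by simp
    rw [List.flatMap_cons, codeOp, List.append_assoc, answer_replicate e M _ _ _ _ _ h0,
      List.singleton_append, answer]
    have hd : decodeOp e ⟨(0 : Fin (N + 1)).1 + (e o).1, h0⟩ = some o := by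
      simp [decodeOp]
    simp only [hd]
    cases hs : o.apply s with
    | none => simp [StackOp.run, hs] at h
    | some s' => exact ih (by simpa [StackOp.run, hs] using h) hq

end Answer

open Turing

section Machine

variable [DecidableEq K]

/-- The configuration of the machine with given contents of the input stack and of the stacks
operated on, and empty output stack. -/
def layout (u : List (Γ ⊕ Bool)) (s : ∀ k, List (A k)) : ∀ k, List (Alphabet Γ A k)
  | .inl false => u
  | .inl true => []
  | .inr k => s k

theorem update_layout_input (u u' : List (Γ ⊕ Bool)) (s : ∀ k, List (A k)) :
    update (layout u s) (.inl false) u' = layout u' s := by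
  funext k
  rcases k with (_ | _) | k <;> simp [layout, update]

theorem update_layout (u : List (Γ ⊕ Bool)) (s : ∀ k, List (A k)) (k : K) (l : List (A k)) :
    update (layout u s) (.inr k) l = layout u (update s k l) := by
  funext k'
  rcases k' with (_ | _) | k'
  · simp [layout, update]
  · simp [layout, update]
  · by_cases h : k' = k
    · subst h
      simp [layout]
    · simp [layout, update, h]

variable [Fintype K] [∀ k, DecidableEq (A k)]

open Classical in
/-- The program of the machine that moves the first part of the input to the stack `k₀` and then
executes the operations listed in the second part. -/
def program (e : StackOp A ≃ Fin N) (M : DFA (StackOp A) Q) (k₀ : K) (f : Γ → A k₀) (a₀ : A k₀)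
    (v₀ : Memory Γ Q N) : Label A → TM2.Stmt (Alphabet Γ A) (Label A) (Memory Γ Q N)
  | .load => .peek (.inl false) (fun v o => { v with last := o }) <|
      .branch (fun v => (v.last.elim false Sum.isLeft))
        (.pop (.inl false) (fun v _ => v) <|
          .push (.inr k₀) (fun v => (v.last.bind Sum.getLeft?).elim a₀ f) <| .goto fun _ => .load)
        (.goto fun _ => .main)
  | .main => .pop (.inl false) (fun v o => { v with last := o }) <|
      .goto fun v => match v.last with
        | some (.inr true) => .inc
        | some (.inr false) => .exec (decodeOp e v.c)
        | _ => .finish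
  | .inc => .load (fun v => { v with c := incr v.c }) <| .goto fun _ => .main
  | .exec none => .goto fun _ => .fail
  | .exec (some (.push k a)) => .push (.inr k) (fun _ => a) <|
      .load (fun v => { v with q := M.step v.q (.push k a), c := 0 }) <| .goto fun _ => .main
  | .exec (some (.pop k a)) => .pop (.inr k) (fun v (o : Option (A k)) =>
        { v with ok := decide (o = some a) }) <|
      .branch (fun v => v.ok)
        (.load (fun v => { v with q := M.step v.q (.pop k a), c := 0 }) <| .goto fun _ => .main)
        (.goto fun _ => .fail)
  | .exec (some (.isEmpty k)) => .peek (.inr k) (fun v (o : Option (A k)) =>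
        { v with ok := decide (o = none) }) <|
      .branch (fun v => v.ok)
        (.load (fun v => { v with q := M.step v.q (.isEmpty k), c := 0 }) <| .goto fun _ => .main)
        (.goto fun _ => .fail)
  | .finish => .load (fun v => { v with ok := decide (v.q ∈ M.accept) }) <| .goto fun _ => .clear
  | .fail => .load (fun v => { v with ok := false }) <| .goto fun _ => .clear
  | .clear => .load (fun v => { v with busy := false }) <|
      (Finset.univ : Finset (Bool ⊕ K)).toList.foldr
        (fun k r => .pop k (fun v o => { v with busy := v.busy || o.isSome }) r)
        (.branch (fun v => v.busy) (.goto fun _ => .clear)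
          (.push (.inl true) (fun v => v.ok) <| .load (fun _ => v₀) .halt))

variable (e : StackOp A ≃ Fin N) (M : DFA (StackOp A) Q) (k₀ : K) (f : Γ → A k₀) (a₀ : A k₀)
    (v₀ : Memory Γ Q N)

/-- The machine reaches a configuration in a bounded number of steps. -/
def Leads (t : ℕ) (c c' : TM2.Cfg (Alphabet Γ A) (Label A) (Memory Γ Q N)) : Prop :=
  ∃ n ≤ t, (flip bind (TM2.step (program e M k₀ f a₀ v₀)))^[n] (some c) = some c'

variable {e M k₀ f a₀ v₀}

theorem Leads.refl (c : TM2.Cfg (Alphabet Γ A) (Label A) (Memory Γ Q N)) :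
    Leads e M k₀ f a₀ v₀ 0 c c := ⟨0, le_rfl, rfl⟩

theorem Leads.trans {t t' : ℕ} {c c' c'' : TM2.Cfg (Alphabet Γ A) (Label A) (Memory Γ Q N)}
    (h : Leads e M k₀ f a₀ v₀ t c c') (h' : Leads e M k₀ f a₀ v₀ t' c' c'') :
    Leads e M k₀ f a₀ v₀ (t + t') c c'' := by
  obtain ⟨n, hn, h⟩ := h
  obtain ⟨n', hn', h'⟩ := h'
  exact ⟨n' + n, by omega, by rw [iterate_add_apply, h, h']⟩

theorem Leads.mono {t t' : ℕ} {c c' : TM2.Cfg (Alphabet Γ A) (Label A) (Memory Γ Q N)}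
    (h : Leads e M k₀ f a₀ v₀ t c c') (ht : t ≤ t') : Leads e M k₀ f a₀ v₀ t' c c' := by
  obtain ⟨n, hn, h⟩ := h
  exact ⟨n, hn.trans ht, h⟩

theorem Leads.step {t : ℕ} {l : Label A} {v : Memory Γ Q N} {S : ∀ k, List (Alphabet Γ A k)}
    {c' : TM2.Cfg (Alphabet Γ A) (Label A) (Memory Γ Q N)}
    (h : Leads e M k₀ f a₀ v₀ t (TM2.stepAux (program e M k₀ f a₀ v₀ l) v S) c') :
    Leads e M k₀ f a₀ v₀ (t + 1) ⟨some l, v, S⟩ c' := by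
  obtain ⟨n, hn, h⟩ := h
  exact ⟨n + 1, by omega, by rw [iterate_succ_apply]; exact h⟩

/-- The condition on the head of `w` makes the loading loop stop exactly behind `x`. Symbols are
pushed in reading order, so `x` arrives reversed. -/
theorem leads_load (x : List Γ) (w : List (Γ ⊕ Bool)) (hw : ∀ b ∈ w.head?, b.isLeft = false)
    (v : Memory Γ Q N) (s : ∀ k, List (A k)) :
    ∃ v', v'.q = v.q ∧ v'.c = v.c ∧ Leads e M k₀ f a₀ v₀ (x.length + 1)
      ⟨some .load, v, layout (x.map .inl ++ w) s⟩
      ⟨some .main, v', layout w (update s k₀ ((x.map f).reverse ++ s k₀))⟩ := by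
  induction x generalizing v s with
  | nil =>
    refine ⟨{ v with last := w.head? }, rfl, rfl, ?_⟩
    refine Leads.step ?_
    have hb : (w.head?.elim false Sum.isLeft) = false := by
      cases h : w.head? with
      | none => rfl
      | some b => exact hw b h
    have : layout w (update s k₀ ((([] : List Γ).map f).reverse ++ s k₀)) = layout w s := by simp
    rw [this]
    simp only [program, TM2.stepAux]
    simp only [layout, List.map_nil, List.nil_append]
    rw [hb]
    exact Leads.refl _
  | cons g x ih =>
    obtain ⟨v', h1, h2, h⟩ := ih { v with last := some (.inl g) } (update s k₀ (f g :: s k₀))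
    refine ⟨v', h1, h2, ?_⟩
    refine Leads.step ?_
    simp only [program, TM2.stepAux]
    simp only [List.map_cons, List.cons_append, layout, List.head?_cons, Option.elim,
      Sum.isLeft, cond_true, List.tail_cons, update_layout_input, update_layout]
    simpa using h

/-- A failing pop may already have removed a symbol, so in that case only the lengths of the
resulting stacks are controlled. They are all that matters for the time needed to clear the stacks.
-/
theorem leads_exec (o : StackOp A) (w : List (Γ ⊕ Bool)) (v : Memory Γ Q N)
    (s : ∀ k, List (A k)) :
    ∃ v' s', (∀ k, (s' k).length ≤ (s k).length + 1) ∧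
      match o.apply s with
      | none => Leads e M k₀ f a₀ v₀ 1 ⟨some (.exec (some o)), v, layout w s⟩
          ⟨some .fail, v', layout w s'⟩
      | some s'' => s' = s'' ∧ v'.q = M.step v.q o ∧ v'.c = 0 ∧
          Leads e M k₀ f a₀ v₀ 1 ⟨some (.exec (some o)), v, layout w s⟩
            ⟨some .main, v', layout w s'⟩ := by
  have hup : ∀ (k : K) (l : List (A k)), l.length ≤ (s k).length + 1 →
      ∀ k', (update s k l k').length ≤ (s k').length + 1 := fun k l hl k' => by
    by_cases h : k' = k
    · subst h
      simpa using hl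
    · simp [h]
  rcases o with ⟨k, a⟩ | ⟨k, a⟩ | k
  · refine ⟨{ v with q := M.step v.q (.push k a), c := 0 }, update s k (a :: s k),
      hup _ _ (by simp), rfl, rfl, rfl, Leads.step ?_⟩
    simp only [program, TM2.stepAux, update_layout]
    exact Leads.refl _
  · by_cases h : (s k).head? = some a
    · simp only [StackOp.apply, h, if_true]
      refine ⟨{ v with q := M.step v.q (.pop k a), c := 0, ok := true }, _,
        hup _ _ (by simp; omega), rfl, rfl, rfl, Leads.step ?_⟩
      simp only [program, TM2.stepAux, update_layout, layout, h, decide_true, cond_true]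
      exact Leads.refl _
    · simp only [StackOp.apply, h, if_false]
      refine ⟨{ v with ok := false }, update s k (s k).tail,
        hup _ _ (by simp; omega), Leads.step ?_⟩
      simp only [program, TM2.stepAux, update_layout, layout, h, decide_false, cond_false]
      exact Leads.refl _
  · by_cases h : (s k).head? = none
    · simp only [StackOp.apply, h, if_true]
      refine ⟨{ v with q := M.step v.q (.isEmpty k), c := 0, ok := true }, s,
        fun _ => Nat.le_succ _, rfl, rfl, rfl, Leads.step ?_⟩
      simp only [program, TM2.stepAux, layout, h, decide_true, cond_true]
      exact Leads.refl _
    · simp only [StackOp.apply, h, if_false]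
      refine ⟨{ v with ok := false }, s, fun _ => Nat.le_succ _, Leads.step ?_⟩
      simp only [program, TM2.stepAux, layout, h, decide_false, cond_false]
      exact Leads.refl _

/-- Each bit costs two steps, `main` followed by `inc` or `exec`; the last phase costs at most
three, namely `main`, `exec` and `fail`. An early failure leaves part of the input unread, hence the
remainder `u`. -/
theorem leads_main (w : List Bool) (v : Memory Γ Q N) (s : ∀ k, List (A k)) (n : ℕ)
    (hs : ∀ k, (s k).length ≤ n) :
    ∃ v' u s', v'.ok = answer e M v.q v.c s w ∧ u.length ≤ w.length ∧
      (∀ k, (s' k).length ≤ n + w.length) ∧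
      Leads e M k₀ f a₀ v₀ (2 * w.length + 3)
        ⟨some .main, v, layout (w.map .inr) s⟩ ⟨some .clear, v', layout u s'⟩ := by
  induction w generalizing v s n with
  | nil =>
    refine ⟨{ v with last := none, ok := answer e M v.q v.c s [] }, [], s, rfl, le_rfl, hs,
      Leads.mono (t := 2) (Leads.step ?_) (by simp)⟩
    simp only [program, TM2.stepAux, update_layout_input]
    exact Leads.step (Leads.refl _)
  | cons b w ih =>
    cases b
    · have hfail : ∀ (v : Memory Γ Q N) (s : ∀ k, List (A k)), ∃ v', v'.ok = false ∧
        Leads e M k₀ f a₀ v₀ 1 ⟨some .fail, v, layout (w.map .inr) s⟩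
          ⟨some .clear, v', layout (w.map .inr) s⟩ := fun v s =>
          ⟨_, rfl, Leads.step (Leads.refl _)⟩
      have hfirst : ∀ t c', Leads e M k₀ f a₀ v₀ t ⟨some (.exec (decodeOp e v.c)),
            { v with last := some (.inr false) }, layout (w.map .inr) s⟩ c' →
          Leads e M k₀ f a₀ v₀ (t + 1)
            ⟨some .main, v, layout ((false :: w).map .inr) s⟩ c' := fun t c' h => by
        refine Leads.step ?_
        simp only [program, TM2.stepAux, update_layout_input]
        exact h
      have hlen : ∀ s' : ∀ k, List (A k), (∀ k, (s' k).length ≤ (s k).length + 1) →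
          ∀ k, (s' k).length ≤ n + (false :: w).length := fun s' h k => by
        have := h k
        have := hs k
        simp only [List.length_cons]
        omega
      cases hd : decodeOp e v.c with
      | none =>
        rw [hd] at hfirst
        obtain ⟨v', hv, h⟩ := hfail { v with last := some (.inr false) } s
        refine ⟨v', _, s, by simpa [answer, hd] using hv, by simp, hlen s fun _ => Nat.le_succ _,
          (hfirst _ _ (Leads.step (t := 1) h)).mono (by omega)⟩
      | some o =>
        rw [hd] at hfirst
        obtain ⟨v₁, s₁, hl, h⟩ := leads_exec (e := e) (M := M) (f := f) (a₀ := a₀) (v₀ := v₀) o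
          (w.map .inr) { v with last := some (.inr false) } s
        cases ho : o.apply s with
        | none =>
          rw [ho] at h
          obtain ⟨v', hv, h'⟩ := hfail v₁ s₁
          exact ⟨v', _, s₁, by simpa [answer, hd, ho] using hv, by simp, hlen _ hl,
            (hfirst _ _ (h.trans h')).mono (by omega)⟩
        | some s'' =>
          rw [ho] at h
          obtain ⟨rfl, hq, hc, h⟩ := h
          obtain ⟨v', u, s', h1, h2, h3, h4⟩ := ih v₁ s₁ (n + 1) fun k => (hl k).trans (by
            have := hs k; omega)
          refine ⟨v', u, s', ?_, h2.trans (by simp), fun k => (h3 k).trans ?_,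
            (hfirst _ _ (h.trans h4)).mono ?_⟩
          · rw [h1, hq, hc]
            simp [answer, hd, ho]
          · simp only [List.length_cons]; omega
          · simp only [List.length_cons]; omega
    · obtain ⟨v', u, s', h1, h2, h3, h4⟩ :=
        ih { v with last := some (.inr true), c := incr v.c } s n hs
      refine ⟨v', u, s', h1, h2.trans (by simp), fun k => (h3 k).trans (by simp),
        Leads.mono (t := 2 * w.length + 3 + 1 + 1) (Leads.step ?_)
          (by simp only [List.length_cons]; omega)⟩
      simp only [program, TM2.stepAux, update_layout_input]
      refine Leads.step (l := .inc) ?_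
      simp only [program, TM2.stepAux]
      exact h4

open Classical in
-- A single machine step may contain many pops, so one pass of `clear` removes a symbol from every
-- stack at once. As no stack is listed twice, each pop sees the original content of its stack.
theorem stepAux_foldr_pop (l : List (Bool ⊕ K)) (hl : l.Nodup)
    (r : TM2.Stmt (Alphabet Γ A) (Label A) (Memory Γ Q N)) (v : Memory Γ Q N)
    (S : ∀ k, List (Alphabet Γ A k)) :
    TM2.stepAux (l.foldr (fun k r => .pop k (fun v o => { v with busy := v.busy || o.isSome }) r) r)
      v S = TM2.stepAux r { v with busy := v.busy || l.any fun k => (S k).head?.isSome }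
        (fun k => if k ∈ l then (S k).tail else S k) := by
  induction l generalizing v S with
  | nil => simp
  | cons k l ih =>
    obtain ⟨hk, hl⟩ := List.nodup_cons.1 hl
    rw [List.foldr_cons, TM2.stepAux, ih hl]
    congr 1
    · congr 1
      rw [List.any_cons, Bool.or_assoc]
      congr 2
      rw [Bool.eq_iff_iff, List.any_eq_true, List.any_eq_true]
      refine exists_congr fun k' => and_congr_right fun hk' => ?_
      rw [update_of_ne (fun h : k' = k => hk (h ▸ hk'))]
    · funext k'
      by_cases h : k' = k
      · subst h
        simp [hk]
      · simp [h]

/-- Every pass shortens all nonempty stacks, and a last pass finds all of them empty. The clearing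
is needed because a halting configuration must have the initial memory and nothing on the stacks
except the output. -/
theorem leads_clear (n : ℕ) (v : Memory Γ Q N) (S : ∀ k, List (Alphabet Γ A k))
    (hS : ∀ k, (S k).length ≤ n) :
    Leads e M k₀ f a₀ v₀ (n + 1) ⟨some .clear, v, S⟩
      ⟨none, v₀, update (fun _ => []) (.inl true) [v.ok]⟩ := by
  have hempty : ∀ (v : Memory Γ Q N) (S : ∀ k, List (Alphabet Γ A k)), (∀ k, S k = []) →
      Leads e M k₀ f a₀ v₀ 1 ⟨some .clear, v, S⟩
        ⟨none, v₀, update (fun _ => []) (.inl true) [v.ok]⟩ := fun v S h => by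
    obtain rfl : S = fun _ => [] := funext h
    refine Leads.step ?_
    simp only [program, TM2.stepAux]
    rw [stepAux_foldr_pop _ (Finset.nodup_toList _)]
    have hany : ((Finset.univ : Finset (Bool ⊕ K)).toList.any fun k =>
        ((fun _ => [] : ∀ k, List (Alphabet Γ A k)) k).head?.isSome) = false := by simp
    simp only [TM2.stepAux, hany, Bool.or_false, cond_false, List.tail_nil, ite_self]
    exact Leads.refl _
  induction n generalizing v S with
  | zero => exact hempty v S fun k => List.length_eq_zero_iff.1 (Nat.le_zero.1 (hS k))
  | succ n ih =>
    by_cases h0 : ∀ k, S k = []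
    · exact (hempty v S h0).mono (by omega)
    · refine Leads.step ?_
      simp only [program, TM2.stepAux]
      rw [stepAux_foldr_pop _ (Finset.nodup_toList _)]
      push Not at h0
      obtain ⟨k, hk⟩ := h0
      have hb : ((Finset.univ : Finset (Bool ⊕ K)).toList.any fun k => (S k).head?.isSome) = true := by
        rw [List.any_eq_true]
        exact ⟨k, by simp, by simpa using hk⟩
      simp only [TM2.stepAux, hb, Bool.or_true, cond_true]
      refine ih _ _ fun k => ?_
      have := hS k
      simp
      omega

variable [Finite Γ] [Finite Q] [∀ k, Finite (A k)] [Finite (Alphabet Γ A (.inl false))]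

variable (e M k₀ f a₀ v₀) in
/-- The machine as a bundled Turing machine. -/
def machine : FinTM2 where
  K := Bool ⊕ K
  k₀ := .inl false
  k₁ := .inl true
  Γ := Alphabet Γ A
  Λ := Label A
  main := .load
  ΛFin := Fintype.ofFinite _
  σ := Memory Γ Q N
  initialState := v₀
  σFin := Fintype.ofFinite _
  Γk₀Fin := Fintype.ofFinite _
  m := program e M k₀ f a₀ v₀

theorem initList_machine (u : List (Γ ⊕ Bool)) :
    initList (machine e M k₀ f a₀ v₀) u =
      (⟨some .load, v₀, layout u fun _ => []⟩ : TM2.Cfg (Alphabet Γ A) (Label A) _) := by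
  refine congrArg (TM2.Cfg.mk (Γ := Alphabet Γ A) (some Label.load) v₀) ?_
  funext k
  rcases k with (_ | _) | k <;> rfl

theorem haltList_machine (b : Bool) :
    haltList (machine e M k₀ f a₀ v₀) [b] =
      (⟨none, v₀, update (fun _ => []) (.inl true) [b]⟩ :
        TM2.Cfg (Alphabet Γ A) (Label A) _) := by
  refine congrArg (TM2.Cfg.mk (Γ := Alphabet Γ A) none v₀) ?_
  funext k
  rcases k with (_ | _) | k <;> rfl

/-- Loading takes `x.length + 1` steps, execution `2 * w.length + 3`, and clearing `x.length +
w.length + 1`, since no stack can have grown beyond `x.length + w.length`. -/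
theorem leads_machine (x : List Γ) (w : List Bool) :
    Leads e M k₀ f a₀ v₀ (4 * (x.length + w.length) + 5)
      ⟨some .load, v₀, layout (x.map .inl ++ w.map .inr) fun _ => []⟩
      ⟨none, v₀, update (fun _ => []) (.inl true)
        [answer e M v₀.q v₀.c (update (fun _ => []) k₀ (x.map f).reverse) w]⟩ := by
  obtain ⟨v₁, hq, hc, h₁⟩ := leads_load (e := e) (M := M) (f := f) (a₀ := a₀) (v₀ := v₀) x
    (w.map .inr) (by cases w <;> simp) v₀ (fun _ => [])
  rw [List.append_nil] at h₁
  obtain ⟨v₂, u, s, hok, hu, hs, h₂⟩ := leads_main (e := e) (M := M) (f := f) (a₀ := a₀) (v₀ := v₀)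
    w v₁ (update (fun _ => []) k₀ (x.map f).reverse) x.length fun k => by
      by_cases h : k = k₀
      · subst h
        simp
      · simp [h]
  have h₃ := leads_clear (e := e) (M := M) (f := f) (a₀ := a₀) (v₀ := v₀) (x.length + w.length) v₂
    (layout u s) (by
      rintro ((_ | _) | k)
      · exact hu.trans (Nat.le_add_left _ _)
      · exact Nat.zero_le _
      · exact hs k)
  rw [hok, hq, hc] at h₃
  exact ((h₁.trans h₂).trans h₃).mono (by omega)

end Machine

end OpMachine

open OpMachine Computability in
/-- A language is in NP if its words are those for which some word of stack operations from a fixed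
regular language, of polynomial length, can be executed on the word given on a stack. -/
theorem inNP_of_isRegular {Γ K : Type} [Fintype Γ] [DecidableEq K] [Fintype K] {A : K → Type}
    [∀ k, DecidableEq (A k)] [∀ k, Finite (A k)] (k₀ : K) (a₀ : A k₀) (f : Γ → A k₀)
    {R : Language (StackOp A)} (hR : R.IsRegular) (L : Language Γ) (p : Polynomial ℕ)
    (hsound : ∀ x, ∀ l ∈ R,
      (StackOp.run l (update (fun _ => []) k₀ (x.map f).reverse)).isSome → x ∈ L)
    (hcomplete : ∀ x ∈ L, ∃ l ∈ R, l.length ≤ p.eval x.length ∧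
      (StackOp.run l (update (fun _ => []) k₀ (x.map f).reverse)).isSome) : InNP L := by
  obtain ⟨Q, _, M, rfl⟩ := hR
  let N := Nat.card (StackOp A)
  let e : StackOp A ≃ Fin N := Finite.equivFin _
  let v₀ : Memory Γ Q N := ⟨M.start, 0, none, false, false⟩
  -- An operation is coded by its number in unary and a terminating bit, hence by at most `N + 1`
  -- bits, where `N` is a constant.
  refine ⟨fun y => answer e M M.start 0 (update (fun _ => []) k₀ (y.1.map f).reverse) y.2,
    Polynomial.C (N + 1) * p, ⟨?_⟩, fun x => ⟨fun hx => ?_, ?_⟩⟩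
  · refine ⟨⟨machine e M k₀ f a₀ v₀, Equiv.refl _, Equiv.refl _⟩,
      4 * Polynomial.X + 5, fun y => Classical.choice ?_⟩
    obtain ⟨n, hn, h⟩ := leads_machine (e := e) (M := M) (f := f) (a₀ := a₀) (v₀ := v₀) y.1 y.2
    refine ⟨⟨⟨n, ?_⟩, hn.trans ?_⟩⟩
    · rw [← haltList_machine (e := e) (M := M) (k₀ := k₀) (f := f) (a₀ := a₀),
        ← initList_machine (e := e) (M := M) (k₀ := k₀) (f := f) (a₀ := a₀)] at h
      exact (congrArg (fun l => (flip bind (machine e M k₀ f a₀ v₀).step)^[n]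
        (some (Turing.initList (machine e M k₀ f a₀ v₀) l))) (List.map_id _)).trans h
    · simp [encodingProd, encodingList]
  · obtain ⟨l, hl, hlen, hrun⟩ := hcomplete x hx
    refine ⟨l.flatMap (codeOp e), ?_, answer_of_run e M hrun hl⟩
    rw [Polynomial.eval_mul, Polynomial.eval_C, List.length_flatMap]
    refine (List.sum_le_card_nsmul _ (N + 1) ?_).trans ?_
    · intro n hn
      obtain ⟨o, -, rfl⟩ := List.mem_map.1 hn
      simp [codeOp]
    · rw [List.length_map, smul_eq_mul, mul_comm]
      exact Nat.mul_le_mul_left _ hlen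
  · rintro ⟨w, -, hw⟩
    obtain ⟨l, h1, h2⟩ := exists_run_of_answer e M hw
    exact hsound x l h2 h1

/-! ### Stack programs of the verifier -/

/-- What the verifier records about a state: whether it is the initial state, whether it belongs to
the guessed winning region, and whether it has already been ranked. -/
structure Core : Type where
  ini : Bool
  win : Bool
  done : Bool
  deriving DecidableEq, Fintype

/-- The record of a state together with its position relative to the state that is being parsed. -/
inductive Info : Type
  | pre (c : Core)
  | cur (c : Core)
  | post (c : Core)
  deriving DecidableEq, Fintype

/-- The record without the position. -/
def Info.core : Info → Core
  | pre c => c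
  | cur c => c
  | post c => c

/-- Whether the record is that of the current state. -/
def Info.isCur : Info → Bool
  | cur _ => true
  | _ => false

/-- The stacks of the verifier: the input, a copy in transit, the copy that is parsed; the records of
the states and a scratch stack for them; the numbers of actions and a scratch stack for them; the
available actions of the team, those of the opponent; and three stacks for truth values attached to
the action tuples of the team. -/
inductive Stk : Type
  | x0 | xt | x | i | j | sh | st | dg | o | m | mt | mp
  deriving DecidableEq

instance : Fintype Stk :=
  ⟨{.x0, .xt, .x, .i, .j, .sh, .st, .dg, .o, .m, .mt, .mp}, by rintro ⟨⟩ <;> decide⟩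

/-- The alphabets of the stacks. -/
abbrev Sym : Stk → Type
  | .x0 | .xt | .x => Γ'
  | .i | .j => Info
  | .sh | .st => Bool
  | .dg => Option (Option Bool)
  | .o => Unit
  | .m | .mt | .mp => Bool

instance (k : Stk) : DecidableEq (Sym k) := by cases k <;> infer_instance

instance (k : Stk) : Finite (Sym k) := by cases k <;> infer_instance

/-- The contents of the stacks. -/
@[ext]
structure Store : Type where
  x0 : List Γ' := []
  xt : List Γ' := []
  x : List Γ' := []
  i : List Info := []
  j : List Info := []
  sh : List Bool := []
  st : List Bool := []
  dg : List (Option (Option Bool)) := []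
  o : List Unit := []
  m : List Bool := []
  mt : List Bool := []
  mp : List Bool := []

namespace Store

/-- The content of a stack. -/
def get (s : Store) : (k : Stk) → List (Sym k)
  | .x0 => s.x0
  | .xt => s.xt
  | .x => s.x
  | .i => s.i
  | .j => s.j
  | .sh => s.sh
  | .st => s.st
  | .dg => s.dg
  | .o => s.o
  | .m => s.m
  | .mt => s.mt
  | .mp => s.mp

/-- Replace the content of a stack. -/
def set (s : Store) : (k : Stk) → List (Sym k) → Store
  | .x0, l => { s with x0 := l }
  | .xt, l => { s with xt := l }
  | .x, l => { s with x := l }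
  | .i, l => { s with i := l }
  | .j, l => { s with j := l }
  | .sh, l => { s with sh := l }
  | .st, l => { s with st := l }
  | .dg, l => { s with dg := l }
  | .o, l => { s with o := l }
  | .m, l => { s with m := l }
  | .mt, l => { s with mt := l }
  | .mp, l => { s with mp := l }

@[simp] theorem get_x0 (s : Store) : s.get .x0 = s.x0 := rfl
@[simp] theorem get_xt (s : Store) : s.get .xt = s.xt := rfl
@[simp] theorem get_x (s : Store) : s.get .x = s.x := rfl
@[simp] theorem get_i (s : Store) : s.get .i = s.i := rfl
@[simp] theorem get_j (s : Store) : s.get .j = s.j := rfl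
@[simp] theorem get_sh (s : Store) : s.get .sh = s.sh := rfl
@[simp] theorem get_st (s : Store) : s.get .st = s.st := rfl
@[simp] theorem get_dg (s : Store) : s.get .dg = s.dg := rfl
@[simp] theorem get_o (s : Store) : s.get .o = s.o := rfl
@[simp] theorem get_m (s : Store) : s.get .m = s.m := rfl
@[simp] theorem get_mt (s : Store) : s.get .mt = s.mt := rfl
@[simp] theorem get_mp (s : Store) : s.get .mp = s.mp := rfl
@[simp] theorem set_x0 (s : Store) (l) : s.set .x0 l = { s with x0 := l } := rfl
@[simp] theorem set_xt (s : Store) (l) : s.set .xt l = { s with xt := l } := rfl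
@[simp] theorem set_x (s : Store) (l) : s.set .x l = { s with x := l } := rfl
@[simp] theorem set_i (s : Store) (l) : s.set .i l = { s with i := l } := rfl
@[simp] theorem set_j (s : Store) (l) : s.set .j l = { s with j := l } := rfl
@[simp] theorem set_sh (s : Store) (l) : s.set .sh l = { s with sh := l } := rfl
@[simp] theorem set_st (s : Store) (l) : s.set .st l = { s with st := l } := rfl
@[simp] theorem set_dg (s : Store) (l) : s.set .dg l = { s with dg := l } := rfl
@[simp] theorem set_o (s : Store) (l) : s.set .o l = { s with o := l } := rfl
@[simp] theorem set_m (s : Store) (l) : s.set .m l = { s with m := l } := rfl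
@[simp] theorem set_mt (s : Store) (l) : s.set .mt l = { s with mt := l } := rfl
@[simp] theorem set_mp (s : Store) (l) : s.set .mp l = { s with mp := l } := rfl

/-- Together with surjectivity this identifies `Store`, with its named fields, with the families of
lists on which `StackOp.run` acts, so that programs can be analysed field by field. -/
theorem get_injective : Injective get := fun s s' h => by
  ext1
  exacts [congrFun h .x0, congrFun h .xt, congrFun h .x, congrFun h .i, congrFun h .j,
    congrFun h .sh, congrFun h .st, congrFun h .dg, congrFun h .o, congrFun h .m,
    congrFun h .mt, congrFun h .mp]

theorem get_surjective : Surjective get := fun f =>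
  ⟨⟨f .x0, f .xt, f .x, f .i, f .j, f .sh, f .st, f .dg, f .o, f .m, f .mt, f .mp⟩,
    funext fun k => by cases k <;> rfl⟩

theorem get_set (s : Store) (k : Stk) (l : List (Sym k)) : (s.set k l).get = update s.get k l := by
  funext k'
  by_cases h : k' = k
  · subst h
    rw [update_self]
    cases k' <;> rfl
  · rw [update_of_ne h]
    cases k <;> cases k' <;> first | rfl | exact absurd rfl h

theorem get_set_self (s : Store) (k : Stk) (l : List (Sym k)) : (s.set k l).get k = l := by
  rw [get_set, update_self]

theorem get_set_of_ne (s : Store) {k k' : Stk} (h : k' ≠ k) (l : List (Sym k)) :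
    (s.set k l).get k' = s.get k' := by
  rw [get_set, update_of_ne h]

theorem set_set (s : Store) (k : Stk) (l l' : List (Sym k)) :
    (s.set k l).set k l' = s.set k l' :=
  get_injective (by simp [get_set])

theorem set_comm (s : Store) {k k' : Stk} (h : k' ≠ k) (l : List (Sym k)) (l' : List (Sym k')) :
    (s.set k l).set k' l' = (s.set k' l').set k l :=
  get_injective (by simp only [get_set]; exact update_comm h.symm _ _ _)

theorem set_get (s : Store) (k : Stk) : s.set k (s.get k) = s :=
  get_injective (by rw [get_set, update_eq_self])

end Store

/-- Stack programs: languages of words of stack operations. -/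
abbrev Prog : Type := Language (StackOp Sym)

/-- The program `L` can lead from `s` to `s'` in at most `n` operations. -/
def Exec (n : ℕ) (L : Prog) (s s' : Store) : Prop :=
  ∃ l ∈ L, l.length ≤ n ∧ StackOp.run l s.get = some s'.get

/-- The program `L` can lead from `s` to `s'`. -/
def Rel (L : Prog) (s s' : Store) : Prop := ∃ l ∈ L, StackOp.run l s.get = some s'.get

/-- Sequential composition of programs. -/
def seqP (L M : Prog) : Prog := L * M

infixr:70 " ⨾ " => seqP

/-- Push a symbol. -/
def pushP (k : Stk) (a : Sym k) : Prog := {[.push k a]}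

/-- Pop a given symbol. -/
def popP (k : Stk) (a : Sym k) : Prog := {[.pop k a]}

/-- Check that a stack is empty. -/
def emptyP (k : Stk) : Prog := {[.isEmpty k]}

/-- Check a condition that does not depend on the stacks. -/
def guardP (b : Bool) : Prog := if b then 1 else 0

theorem Exec.mono {n n' : ℕ} {L : Prog} {s s' : Store} (h : Exec n L s s') (hn : n ≤ n') :
    Exec n' L s s' :=
  h.imp fun _ h => ⟨h.1, h.2.1.trans hn, h.2.2⟩

theorem rel_seq {L M : Prog} {s u : Store} : Rel (L ⨾ M) s u ↔ ∃ t, Rel L s t ∧ Rel M t u := by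
  constructor
  · rintro ⟨_, ⟨l, hl, l', hl', rfl⟩, h⟩
    rw [StackOp.run_append, Option.bind_eq_some_iff] at h
    obtain ⟨t, h1, h2⟩ := h
    obtain ⟨t, rfl⟩ := Store.get_surjective t
    exact ⟨t, ⟨l, hl, h1⟩, ⟨l', hl', h2⟩⟩
  · rintro ⟨t, ⟨l, hl, h1⟩, ⟨l', hl', h2⟩⟩
    exact ⟨l ++ l', Language.append_mem_mul hl hl', by
      rw [StackOp.run_append, h1, Option.bind_some, h2]⟩

theorem Exec.seq {n n' : ℕ} {L M : Prog} {s t u : Store} (h : Exec n L s t) (h' : Exec n' M t u) :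
    Exec (n + n') (L ⨾ M) s u := by
  obtain ⟨l, hl, hn, h1⟩ := h
  obtain ⟨l', hl', hn', h2⟩ := h'
  exact ⟨l ++ l', Language.append_mem_mul hl hl', by simp; omega, by
    rw [StackOp.run_append, h1, Option.bind_some, h2]⟩

theorem rel_add {L M : Prog} {s u : Store} : Rel (L + M) s u ↔ Rel L s u ∨ Rel M s u := by
  simp only [Rel, Language.mem_add, or_and_right, exists_or]

theorem Exec.inl {n : ℕ} {L M : Prog} {s t : Store} (h : Exec n L s t) : Exec n (L + M) s t :=
  h.imp fun _ h => ⟨Or.inl h.1, h.2⟩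

theorem Exec.inr {n : ℕ} {L M : Prog} {s t : Store} (h : Exec n M s t) : Exec n (L + M) s t :=
  h.imp fun _ h => ⟨Or.inr h.1, h.2⟩

theorem rel_iSup {ι : Type} {L : ι → Prog} {s u : Store} :
    Rel (⨆ a, L a) s u ↔ ∃ a, Rel (L a) s u := by
  simp only [Rel, Language.mem_iSup]
  constructor
  · rintro ⟨l, ⟨a, h⟩, h'⟩
    exact ⟨a, l, h, h'⟩
  · rintro ⟨a, l, h, h'⟩
    exact ⟨l, ⟨a, h⟩, h'⟩

theorem Exec.iSup {ι : Type} {L : ι → Prog} (a : ι) {n : ℕ} {s t : Store} (h : Exec n (L a) s t) :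
    Exec n (⨆ a, L a) s t :=
  h.imp fun _ h => ⟨Language.mem_iSup.2 ⟨a, h.1⟩, h.2⟩

theorem rel_one {s u : Store} : Rel 1 s u ↔ u = s := by
  constructor
  · rintro ⟨l, rfl, h⟩
    exact (Store.get_injective (Option.some.inj h)).symm
  · rintro rfl
    exact ⟨[], rfl, rfl⟩

theorem Exec.one (s : Store) : Exec 0 1 s s := ⟨[], rfl, le_rfl, rfl⟩

theorem rel_guard {b : Bool} {s u : Store} : Rel (guardP b) s u ↔ b = true ∧ u = s := by
  cases b
  · simp [guardP, Rel]
  · simp [guardP, rel_one]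

theorem Exec.guard {b : Bool} (h : b = true) (s : Store) : Exec 0 (guardP b) s s := by
  subst h
  exact Exec.one s

theorem rel_push {k : Stk} {a : Sym k} {s u : Store} :
    Rel (pushP k a) s u ↔ u = s.set k (a :: s.get k) := by
  constructor
  · rintro ⟨l, rfl, h⟩
    simp only [StackOp.run, StackOp.apply, Option.bind_some, Option.some.injEq] at h
    exact Store.get_injective (by rw [← h, Store.get_set])
  · rintro rfl
    exact ⟨_, rfl, by simp [StackOp.run, StackOp.apply, Store.get_set]⟩

theorem Exec.push (k : Stk) (a : Sym k) (s : Store) :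
    Exec 1 (pushP k a) s (s.set k (a :: s.get k)) :=
  ⟨_, rfl, le_rfl, by simp [StackOp.run, StackOp.apply, Store.get_set]⟩

theorem rel_pop {k : Stk} {a : Sym k} {s u : Store} :
    Rel (popP k a) s u ↔ ∃ l, s.get k = a :: l ∧ u = s.set k l := by
  constructor
  · rintro ⟨l, rfl, h⟩
    simp only [StackOp.run, StackOp.apply] at h
    split_ifs at h with h'
    · obtain ⟨l, hl⟩ := List.head?_eq_some_iff.1 h'
      refine ⟨l, hl, Store.get_injective ?_⟩
      rw [Store.get_set]
      simpa [hl] using h.symm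
    · simp at h
  · rintro ⟨l, hl, rfl⟩
    exact ⟨_, rfl, by simp [StackOp.run, StackOp.apply, Store.get_set, hl]⟩

theorem Exec.pop {k : Stk} {a : Sym k} {s : Store} {l : List (Sym k)} (h : s.get k = a :: l) :
    Exec 1 (popP k a) s (s.set k l) :=
  ⟨_, rfl, le_rfl, by simp [StackOp.run, StackOp.apply, Store.get_set, h]⟩

theorem rel_empty {k : Stk} {s u : Store} : Rel (emptyP k) s u ↔ s.get k = [] ∧ u = s := by
  constructor
  · rintro ⟨l, rfl, h⟩
    simp only [StackOp.run, StackOp.apply] at h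
    split_ifs at h with h'
    · exact ⟨by simpa using h', (Store.get_injective (Option.some.inj h)).symm⟩
    · simp at h
  · rintro ⟨h, rfl⟩
    exact ⟨_, rfl, by simp [StackOp.run, StackOp.apply, h]⟩

theorem Exec.empty {k : Stk} {s : Store} (h : s.get k = []) : Exec 1 (emptyP k) s s :=
  ⟨_, rfl, le_rfl, by simp [StackOp.run, StackOp.apply, h]⟩

-- The induction principle behind soundness of loops: a run of `L∗` is a sequence of runs of `L`, so
-- a reflexive relation that absorbs one run of `L` on the left contains it.
@[elab_as_elim]
theorem rel_kstar_induction {L : Prog} {P : Store → Store → Prop} (hrefl : ∀ s, P s s)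
    (hstep : ∀ s t u, Rel L s t → P t u → P s u) {s u : Store} (h : Rel (L∗) s u) : P s u := by
  obtain ⟨_, ⟨l, rfl, hl⟩, h⟩ := h
  induction l generalizing s with
  | nil =>
    obtain rfl := Store.get_injective (Option.some.inj h)
    exact hrefl _
  | cons w l ih =>
    rw [List.flatten_cons, StackOp.run_append, Option.bind_eq_some_iff] at h
    obtain ⟨t, h1, h2⟩ := h
    obtain ⟨t, rfl⟩ := Store.get_surjective t
    exact hstep _ _ _ ⟨w, hl w (by simp), h1⟩ (ih (fun y hy => hl y (by simp [hy])) h2)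

theorem Exec.kstar_nil (L : Prog) (s : Store) : Exec 0 (L∗) s s :=
  ⟨[], Language.nil_mem_kstar _, le_rfl, rfl⟩

theorem Exec.kstar_cons {n n' : ℕ} {L : Prog} {s t u : Store} (h : Exec n L s t)
    (h' : Exec n' (L∗) t u) : Exec (n + n') (L∗) s u := by
  obtain ⟨l, hl, hn, h1⟩ := h.seq h'
  refine ⟨l, ?_, hn, h1⟩
  rw [← Language.one_add_self_mul_kstar_eq_kstar]
  exact Or.inr hl

theorem Exec.kstar_snoc {n n' : ℕ} {L : Prog} {s t u : Store} (h : Exec n (L∗) s t)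
    (h' : Exec n' L t u) : Exec (n + n') (L∗) s u := by
  obtain ⟨l, hl, hn, h1⟩ := h.seq h'
  refine ⟨l, ?_, hn, h1⟩
  rw [← Language.one_add_kstar_mul_self_eq_kstar]
  exact Or.inr hl

/-! ### Moving symbols between stacks -/

section Moves

variable {ι : Type} {k k₁ k₂ : Stk}

/-- Pop some symbols. -/
def popsP (a : ι → Sym k) : Prog := (⨆ c, popP k (a c))∗

/-- Move some symbols to another stack. -/
def moveP (a : ι → Sym k) (b : ι → Sym k₁) : Prog := (⨆ c, popP k (a c) ⨾ pushP k₁ (b c))∗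

/-- Move some symbols to two other stacks. -/
def move₂P (a : ι → Sym k) (b₁ : ι → Sym k₁) (b₂ : ι → Sym k₂) : Prog :=
  (⨆ c, popP k (a c) ⨾ pushP k₁ (b₁ c) ⨾ pushP k₂ (b₂ c))∗

/-- The star may stop at any point, so only some prefix of the stack is known to be gone. Programs
that must remove everything continue with `emptyP`. -/
theorem rel_pops {a : ι → Sym k} {s u : Store} (h : Rel (popsP a) s u) :
    ∃ (cs : List ι) (l : List (Sym k)), s.get k = cs.map a ++ l ∧ u = s.set k l := by
  unfold popsP at h
  refine rel_kstar_induction (fun s => ⟨[], s.get k, rfl, (s.set_get k).symm⟩) ?_ h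
  clear h s u
  rintro s t u h ⟨cs, l, h1, rfl⟩
  simp only [rel_iSup, rel_pop] at h
  obtain ⟨c, l', hl, rfl⟩ := h
  refine ⟨c :: cs, l, ?_, by rw [Store.set_set]⟩
  rw [Store.get_set_self] at h1
  rw [hl, h1, List.map_cons, List.cons_append]

theorem exec_pops {a : ι → Sym k} (cs : List ι) {s : Store} {l : List (Sym k)}
    (h : s.get k = cs.map a ++ l) : Exec cs.length (popsP a) s (s.set k l) := by
  induction cs generalizing s with
  | nil =>
    obtain rfl : s.get k = l := h
    rw [Store.set_get]
    exact Exec.kstar_nil _ _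
  | cons c cs ih =>
    have := ih (s := s.set k (cs.map a ++ l)) (Store.get_set_self _ _ _)
    rw [Store.set_set] at this
    refine (Exec.kstar_cons (Exec.iSup c (Exec.pop h)) this).mono (by simp; omega)

/-- The moved symbols arrive in reverse order; moving them back restores the order. As above, how
many symbols are moved is left open until a later `emptyP` or `popP` forces it. -/
theorem rel_move {a : ι → Sym k} {b : ι → Sym k₁} (hk : k₁ ≠ k) {s u : Store}
    (h : Rel (moveP a b) s u) :
    ∃ (cs : List ι) (l : List (Sym k)), s.get k = cs.map a ++ l ∧
      u = (s.set k l).set k₁ ((cs.map b).reverse ++ s.get k₁) := by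
  unfold moveP at h
  refine rel_kstar_induction (fun s => ⟨[], s.get k, rfl, ?_⟩) ?_ h
  · simp [s.set_get]
  clear h s u
  rintro s t u h ⟨cs, l, h1, rfl⟩
  simp only [rel_iSup, rel_seq, rel_pop, rel_push] at h
  obtain ⟨c, _, ⟨l', hl, rfl⟩, rfl⟩ := h
  refine ⟨c :: cs, l, ?_, ?_⟩
  · rw [Store.get_set_of_ne _ hk.symm, Store.get_set_self] at h1
    rw [hl, h1, List.map_cons, List.cons_append]
  · rw [Store.set_comm _ hk.symm, Store.set_set, Store.set_set, Store.get_set_self,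
      Store.get_set_of_ne _ hk]
    simp

theorem exec_move {a : ι → Sym k} {b : ι → Sym k₁} (hk : k₁ ≠ k) (cs : List ι) {s : Store}
    {l : List (Sym k)} (h : s.get k = cs.map a ++ l) :
    Exec (2 * cs.length) (moveP a b) s ((s.set k l).set k₁ ((cs.map b).reverse ++ s.get k₁)) := by
  induction cs generalizing s with
  | nil =>
    obtain rfl : s.get k = l := h
    simp only [List.map_nil, List.reverse_nil, List.nil_append, s.set_get]
    exact Exec.kstar_nil _ _
  | cons c cs ih =>
    have h1 := (Exec.pop (l := cs.map a ++ l) h).seq (Exec.push k₁ (b c) _)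
    have h2 := ih (s := (s.set k (cs.map a ++ l)).set k₁
      (b c :: (s.set k (cs.map a ++ l)).get k₁))
      (by rw [Store.get_set_of_ne _ hk.symm, Store.get_set_self])
    have h3 := Exec.kstar_cons (L := ⨆ c, popP k (a c) ⨾ pushP k₁ (b c)) (Exec.iSup c h1) h2
    rw [Store.set_comm _ hk.symm, Store.set_set, Store.set_set, Store.get_set_self,
      Store.get_set_of_ne _ hk] at h3
    refine Exec.mono (n := 1 + 1 + 2 * cs.length) ?_ (by simp; omega)
    simpa [moveP] using h3

theorem rel_move₂ {a : ι → Sym k} {b₁ : ι → Sym k₁} {b₂ : ι → Sym k₂} (h₁ : k₁ ≠ k) (h₂ : k₂ ≠ k)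
    (h₁₂ : k₁ ≠ k₂) {s u : Store} (h : Rel (move₂P a b₁ b₂) s u) :
    ∃ (cs : List ι) (l : List (Sym k)), s.get k = cs.map a ++ l ∧
      u = ((s.set k l).set k₁ ((cs.map b₁).reverse ++ s.get k₁)).set k₂
        ((cs.map b₂).reverse ++ s.get k₂) := by
  unfold move₂P at h
  refine rel_kstar_induction (fun s => ⟨[], s.get k, rfl, ?_⟩) ?_ h
  · simp [s.set_get]
  clear h s u
  rintro s t u h ⟨cs, l, h1, rfl⟩
  simp only [rel_iSup, rel_seq, rel_pop, rel_push] at h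
  obtain ⟨c, _, ⟨l', hl, rfl⟩, _, rfl, rfl⟩ := h
  refine ⟨c :: cs, l, ?_, ?_⟩
  · rw [Store.get_set_of_ne _ h₂.symm, Store.get_set_of_ne _ h₁.symm, Store.get_set_self] at h1
    rw [hl, h1, List.map_cons, List.cons_append]
  · refine Store.get_injective ?_
    simp only [Store.get_set]
    funext k'
    by_cases e2 : k' = k₂
    · subst e2; simp [h₁₂.symm, h₂]
    by_cases e1 : k' = k₁
    · subst e1; simp [h₁₂, h₁]
    by_cases e : k' = k
    · subst e; simp [e1, e2]
    simp [e, e1, e2]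

theorem exec_move₂ {a : ι → Sym k} {b₁ : ι → Sym k₁} {b₂ : ι → Sym k₂} (h₁ : k₁ ≠ k) (h₂ : k₂ ≠ k)
    (h₁₂ : k₁ ≠ k₂) (cs : List ι) {s : Store} {l : List (Sym k)} (h : s.get k = cs.map a ++ l) :
    Exec (3 * cs.length) (move₂P a b₁ b₂) s
      (((s.set k l).set k₁ ((cs.map b₁).reverse ++ s.get k₁)).set k₂
        ((cs.map b₂).reverse ++ s.get k₂)) := by
  induction cs generalizing s with
  | nil =>
    obtain rfl : s.get k = l := h
    simp only [List.map_nil, List.reverse_nil, List.nil_append, s.set_get]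
    exact Exec.kstar_nil _ _
  | cons c cs ih =>
    have q1 := (Exec.pop (l := cs.map a ++ l) h).seq
      ((Exec.push k₁ (b₁ c) _).seq (Exec.push k₂ (b₂ c) _))
    have q3 := Exec.kstar_cons (L := ⨆ c, popP k (a c) ⨾ pushP k₁ (b₁ c) ⨾ pushP k₂ (b₂ c))
      (Exec.iSup c q1) (ih (by
        rw [Store.get_set_of_ne _ h₂.symm, Store.get_set_of_ne _ h₁.symm, Store.get_set_self]))
    refine Exec.mono (n := 1 + (1 + 1) + 3 * cs.length) ?_ (by simp; omega)
    unfold move₂P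
    convert q3 using 1
    refine Store.get_injective ?_
    simp only [Store.get_set]
    funext k'
    by_cases e2 : k' = k₂
    · subst e2; simp [h₁₂.symm, h₂]
    by_cases e1 : k' = k₁
    · subst e1; simp [h₁₂, h₁]
    by_cases e : k' = k
    · subst e; simp [e1, e2]
    simp [e, e1, e2]

end Moves

/-! ### The verifier -/

/-- What the verifier assumes about the state that it is parsing: whether it is a target, whether it
is the initial state, whether it is in the guessed winning region, whether it is already ranked, and
whether it is to be ranked now. -/
structure Mode : Type where
  tgt : Bool
  ini : Bool
  win : Bool
  done : Bool
  add : Bool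
  deriving Fintype

namespace Mode

variable (md : Mode)

/-- The record of the state before it is parsed. -/
def before : Core := ⟨md.ini, md.win, md.done⟩

/-- The record of the state after it is parsed. -/
def after : Core := ⟨md.ini, md.win, md.done || md.add⟩

/-- Whether it has to be checked that the supports make progress. -/
def check : Bool := md.add && !md.tgt

/-- Whether a transition to a state is permitted, for an action tuple in the supports (`b = true`) or
not. -/
def permits (b : Bool) (a : Info) : Bool :=
  if md.tgt then a.isCur else !(md.add && b) || a.core.win

end Mode

/-- Read a nonzero weight. -/
def nonzeroP : Prog := (⨆ b, popP .x (.bit b))∗ ⨾ popP .x (.bit true) ⨾ popP .x .comma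

/-- Read a weight that is zero or permitted. -/
def entryP (c : Info → Bool) : Prog :=
  ⨆ a : Info, popP .i a ⨾ pushP .j a ⨾ (popP .x .comma + guardP (c a) ⨾ nonzeroP)

/-- Read a nonzero weight that satisfies a condition. -/
def hitP (c : Info → Bool) : Prog :=
  ⨆ a : Info, popP .i a ⨾ pushP .j a ⨾ guardP (c a) ⨾ nonzeroP

/-- Read a row of permitted weights, with at least one nonzero weight of a given kind. -/
def rowP (c w : Info → Bool) : Prog :=
  popP .x .bra ⨾ (entryP c)∗ ⨾ hitP (fun a => c a && w a) ⨾ (entryP c)∗ ⨾ popP .x .ket ⨾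
    emptyP .i ⨾ moveP (k := .j) (k₁ := .i) id id ⨾ emptyP .j

/-- Read a row of permitted weights. -/
def anyRowP (md : Mode) : Prog :=
  ⨆ b : Bool, popP .m b ⨾ pushP .mt b ⨾ rowP (md.permits b) fun _ => true

/-- Read a row that belongs to the supports and has a transition to a ranked state. -/
def goodRowP (md : Mode) : Prog :=
  popP .m true ⨾ pushP .mt true ⨾ rowP (md.permits true) fun a => a.core.done

/-- Read the rows for one action of the opponent. -/
def blockP (md : Mode) : Prog :=
  moveP (k := .mt) (k₁ := .m) id id ⨾ emptyP .mt ⨾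
    (if md.check then (anyRowP md)∗ ⨾ goodRowP md ⨾ (anyRowP md)∗ else (anyRowP md)∗) ⨾ emptyP .m

/-- Read the rows of a state. -/
def rowsP (md : Mode) : Prog :=
  popP .x .bra ⨾ (popP .o () ⨾ blockP md)∗ ⨾ emptyP .o ⨾ popP .x .ket ⨾
    popsP (k := .mt) id ⨾ emptyP .mt

/-- Read whether an action of the opponent is available. -/
def oppBitP (b : Bool) : Prog :=
  popP .x (.bit b) ⨾ popP .sh true ⨾ pushP .st true ⨾ (if b then pushP .o () else 1)

/-- Read the available actions of the opponent. -/
def oppP : Prog :=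
  popP .x .bra ⨾ (⨆ b, oppBitP b)∗ ⨾ oppBitP true ⨾ (⨆ b, oppBitP b)∗ ⨾ popP .x .ket ⨾
    popP .sh false ⨾ pushP .st false

/-- Read whether an action of a team player is available and guess whether it is in the support. -/
def digitP (d : Option Bool) : Prog :=
  popP .x (.bit d.isSome) ⨾ popP .sh true ⨾ pushP .st true ⨾ pushP .dg (some d)

/-- Read the available actions of a team player. -/
def playerP : Prog :=
  pushP .dg none ⨾ popP .x .bra ⨾ (⨆ d, digitP d)∗ ⨾ (⨆ b, digitP (some b)) ⨾ (⨆ d, digitP d)∗ ⨾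
    popP .x .ket ⨾ popP .sh false ⨾ pushP .st false

/-- Read the available actions of all players. -/
def availP : Prog :=
  popP .x .bra ⨾ oppP ⨾ playerP∗ ⨾ popP .x .ket ⨾ emptyP .sh ⨾
    moveP (k := .st) (k₁ := .sh) id id ⨾ emptyP .st

/-- Process one symbol of the stack of available actions of the team. -/
def maskStepP : Option (Option Bool) → Prog
  | none => popsP (k := .mt) id ⨾ emptyP .mt ⨾ moveP (k := .mp) (k₁ := .mt) id id ⨾ emptyP .mp
  | some none => 1
  | some (some b) => move₂P (k := .mt) (k₁ := .m) (k₂ := .mp) id id (fun a => b && a) ⨾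
      emptyP .mt ⨾ moveP (k := .m) (k₁ := .mt) id id ⨾ emptyP .m

/-- Compute for all action tuples of the team whether they belong to the supports. -/
def maskP : Prog := pushP .mt true ⨾ (⨆ d, popP .dg d ⨾ maskStepP d)∗ ⨾ emptyP .dg

/-- Update the record of the current state and move on to the next one. -/
def advanceP (md : Mode) : Prog :=
  moveP (k := .i) (k₁ := .j) Info.pre Info.pre ⨾ popP .i (.cur md.before) ⨾
    pushP .j (.pre md.after) ⨾
    (1 + (⨆ c, popP .i (.post c) ⨾ pushP .j (.cur c)) ⨾
      moveP (k := .i) (k₁ := .j) Info.post Info.post) ⨾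
    emptyP .i ⨾ moveP (k := .j) (k₁ := .i) id id ⨾ emptyP .j

/-- Read the description of a state. -/
def stateP (md : Mode) : Prog :=
  guardP (!md.add || md.win) ⨾ popP .x .bra ⨾ popP .x (.bit md.tgt) ⨾ popP .x (.bit md.ini) ⨾
    availP ⨾ maskP ⨾ rowsP md ⨾ popP .x .ket ⨾ advanceP md

/-- Make the first state the current one. -/
def resetP : Prog :=
  moveP (k := .i) (k₁ := .j) Info.pre Info.post ⨾ emptyP .i ⨾
    moveP (k := .j) (k₁ := .i) id id ⨾ emptyP .j ⨾ ⨆ c, popP .i (.post c) ⨾ pushP .i (.cur c)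

/-- Read the whole input once. -/
def roundP : Prog :=
  move₂P (k := .x0) (k₁ := .xt) (k₂ := .x) id id id ⨾ emptyP .x0 ⨾
    moveP (k := .xt) (k₁ := .x0) id id ⨾ emptyP .xt ⨾ resetP ⨾ popP .x .bra ⨾
    (⨆ md, stateP md)∗ ⨾ popP .x .ket ⨾ emptyP .x

/-- Guess the records of some states. -/
def guessP : Prog := (⨆ w, pushP .i (.pre ⟨false, w, false⟩))∗

/-- Check that all states of the guessed winning region are ranked. -/
def finalP : Prog := (⨆ c : Core, guardP (!c.win || c.done) ⨾ popP .i (.pre c))∗ ⨾ emptyP .i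

/-- The verifier. -/
def verifierP : Prog :=
  guessP ⨾ pushP .i (.pre ⟨true, true, false⟩) ⨾ guessP ⨾ (⨆ b, pushP .sh b)∗ ⨾ roundP ⨾
    roundP∗ ⨾ finalP

/-! ### Regularity of the verifier -/

section Regular

open Language

theorem seqP_isRegular {L M : Prog} (hL : L.IsRegular) (hM : M.IsRegular) : (L ⨾ M).IsRegular :=
  hL.mul hM

theorem pushP_isRegular (k : Stk) (a : Sym k) : (pushP k a).IsRegular := isRegular_singleton _

theorem popP_isRegular (k : Stk) (a : Sym k) : (popP k a).IsRegular := isRegular_singleton _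

theorem emptyP_isRegular (k : Stk) : (emptyP k).IsRegular := isRegular_singleton _

theorem guardP_isRegular (b : Bool) : (guardP b).IsRegular := by
  cases b
  · exact isRegular_zero
  · exact isRegular_one

theorem popsP_isRegular {ι : Type} [Finite ι] {k : Stk} (a : ι → Sym k) : (popsP a).IsRegular :=
  (IsRegular.iSup fun _ => popP_isRegular _ _).kstar

theorem moveP_isRegular {ι : Type} [Finite ι] {k k₁ : Stk} (a : ι → Sym k) (b : ι → Sym k₁) :
    (moveP a b).IsRegular :=
  (IsRegular.iSup fun _ => seqP_isRegular (popP_isRegular _ _) (pushP_isRegular _ _)).kstar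

theorem move₂P_isRegular {ι : Type} [Finite ι] {k k₁ k₂ : Stk} (a : ι → Sym k) (b₁ : ι → Sym k₁)
    (b₂ : ι → Sym k₂) : (move₂P a b₁ b₂).IsRegular :=
  (IsRegular.iSup fun _ => seqP_isRegular (popP_isRegular _ _)
    (seqP_isRegular (pushP_isRegular _ _) (pushP_isRegular _ _))).kstar

theorem nonzeroP_isRegular : nonzeroP.IsRegular :=
  seqP_isRegular (IsRegular.iSup fun _ => popP_isRegular _ _).kstar
    (seqP_isRegular (popP_isRegular _ _) (popP_isRegular _ _))

theorem entryP_isRegular (c : Info → Bool) : (entryP c).IsRegular :=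
  IsRegular.iSup fun _ => seqP_isRegular (popP_isRegular _ _) (seqP_isRegular (pushP_isRegular _ _)
    ((popP_isRegular _ _).add (seqP_isRegular (guardP_isRegular _) nonzeroP_isRegular)))

theorem hitP_isRegular (c : Info → Bool) : (hitP c).IsRegular :=
  IsRegular.iSup fun _ => seqP_isRegular (popP_isRegular _ _) (seqP_isRegular (pushP_isRegular _ _)
    (seqP_isRegular (guardP_isRegular _) nonzeroP_isRegular))

theorem rowP_isRegular (c w : Info → Bool) : (rowP c w).IsRegular :=
  seqP_isRegular (popP_isRegular _ _) <| seqP_isRegular (entryP_isRegular _).kstar <|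
    seqP_isRegular (hitP_isRegular _) <| seqP_isRegular (entryP_isRegular _).kstar <|
    seqP_isRegular (popP_isRegular _ _) <| seqP_isRegular (emptyP_isRegular _) <|
    seqP_isRegular (moveP_isRegular _ _) (emptyP_isRegular _)

theorem anyRowP_isRegular (md : Mode) : (anyRowP md).IsRegular :=
  IsRegular.iSup fun _ => seqP_isRegular (popP_isRegular _ _)
    (seqP_isRegular (pushP_isRegular _ _) (rowP_isRegular _ _))

theorem goodRowP_isRegular (md : Mode) : (goodRowP md).IsRegular :=
  seqP_isRegular (popP_isRegular _ _) (seqP_isRegular (pushP_isRegular _ _) (rowP_isRegular _ _))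

theorem blockP_isRegular (md : Mode) : (blockP md).IsRegular := by
  refine seqP_isRegular (moveP_isRegular _ _) <| seqP_isRegular (emptyP_isRegular _) <|
    seqP_isRegular ?_ (emptyP_isRegular _)
  split
  · exact seqP_isRegular (anyRowP_isRegular md).kstar
      (seqP_isRegular (goodRowP_isRegular md) (anyRowP_isRegular md).kstar)
  · exact (anyRowP_isRegular md).kstar

theorem rowsP_isRegular (md : Mode) : (rowsP md).IsRegular :=
  seqP_isRegular (popP_isRegular _ _) <|
    seqP_isRegular (seqP_isRegular (popP_isRegular _ _) (blockP_isRegular md)).kstar <|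
    seqP_isRegular (emptyP_isRegular _) <| seqP_isRegular (popP_isRegular _ _) <|
    seqP_isRegular (popsP_isRegular _) (emptyP_isRegular _)

theorem oppBitP_isRegular (b : Bool) : (oppBitP b).IsRegular := by
  refine seqP_isRegular (popP_isRegular _ _) <| seqP_isRegular (popP_isRegular _ _) <|
    seqP_isRegular (pushP_isRegular _ _) ?_
  split
  · exact pushP_isRegular _ _
  · exact isRegular_one

theorem oppP_isRegular : oppP.IsRegular :=
  have h := (IsRegular.iSup oppBitP_isRegular).kstar
  seqP_isRegular (popP_isRegular _ _) <| seqP_isRegular h <|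
    seqP_isRegular (oppBitP_isRegular _) <| seqP_isRegular h <|
    seqP_isRegular (popP_isRegular _ _) <| seqP_isRegular (popP_isRegular _ _)
    (pushP_isRegular _ _)

theorem digitP_isRegular (d : Option Bool) : (digitP d).IsRegular :=
  seqP_isRegular (popP_isRegular _ _) <| seqP_isRegular (popP_isRegular _ _) <|
    seqP_isRegular (pushP_isRegular _ _) (pushP_isRegular _ _)

theorem playerP_isRegular : playerP.IsRegular :=
  have h := (IsRegular.iSup digitP_isRegular).kstar
  seqP_isRegular (pushP_isRegular _ _) <| seqP_isRegular (popP_isRegular _ _) <|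
    seqP_isRegular h <| seqP_isRegular (IsRegular.iSup fun _ => digitP_isRegular _) <|
    seqP_isRegular h <| seqP_isRegular (popP_isRegular _ _) <|
    seqP_isRegular (popP_isRegular _ _) (pushP_isRegular _ _)

theorem availP_isRegular : availP.IsRegular :=
  seqP_isRegular (popP_isRegular _ _) <| seqP_isRegular oppP_isRegular <|
    seqP_isRegular playerP_isRegular.kstar <| seqP_isRegular (popP_isRegular _ _) <|
    seqP_isRegular (emptyP_isRegular _) <| seqP_isRegular (moveP_isRegular _ _)
    (emptyP_isRegular _)

theorem maskStepP_isRegular : ∀ d, (maskStepP d).IsRegular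
  | none => seqP_isRegular (popsP_isRegular _) <| seqP_isRegular (emptyP_isRegular _) <|
      seqP_isRegular (moveP_isRegular _ _) (emptyP_isRegular _)
  | some none => isRegular_one
  | some (some _) => seqP_isRegular (move₂P_isRegular _ _ _) <|
      seqP_isRegular (emptyP_isRegular _) <|
      seqP_isRegular (moveP_isRegular _ _) (emptyP_isRegular _)

theorem maskP_isRegular : maskP.IsRegular :=
  seqP_isRegular (pushP_isRegular _ _) <| seqP_isRegular (IsRegular.iSup fun d =>
    seqP_isRegular (popP_isRegular _ _) (maskStepP_isRegular d)).kstar (emptyP_isRegular _)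

theorem advanceP_isRegular (md : Mode) : (advanceP md).IsRegular :=
  seqP_isRegular (moveP_isRegular _ _) <| seqP_isRegular (popP_isRegular _ _) <|
    seqP_isRegular (pushP_isRegular _ _) <|
    seqP_isRegular (isRegular_one.add (seqP_isRegular (IsRegular.iSup fun _ =>
      seqP_isRegular (popP_isRegular _ _) (pushP_isRegular _ _)) (moveP_isRegular _ _))) <|
    seqP_isRegular (emptyP_isRegular _) <| seqP_isRegular (moveP_isRegular _ _)
    (emptyP_isRegular _)

theorem stateP_isRegular (md : Mode) : (stateP md).IsRegular :=
  seqP_isRegular (guardP_isRegular _) <| seqP_isRegular (popP_isRegular _ _) <|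
    seqP_isRegular (popP_isRegular _ _) <| seqP_isRegular (popP_isRegular _ _) <|
    seqP_isRegular availP_isRegular <| seqP_isRegular maskP_isRegular <|
    seqP_isRegular (rowsP_isRegular md) <| seqP_isRegular (popP_isRegular _ _)
    (advanceP_isRegular md)

theorem resetP_isRegular : resetP.IsRegular :=
  seqP_isRegular (moveP_isRegular _ _) <| seqP_isRegular (emptyP_isRegular _) <|
    seqP_isRegular (moveP_isRegular _ _) <| seqP_isRegular (emptyP_isRegular _)
    (IsRegular.iSup fun _ => seqP_isRegular (popP_isRegular _ _) (pushP_isRegular _ _))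

theorem roundP_isRegular : roundP.IsRegular :=
  seqP_isRegular (move₂P_isRegular _ _ _) <| seqP_isRegular (emptyP_isRegular _) <|
    seqP_isRegular (moveP_isRegular _ _) <| seqP_isRegular (emptyP_isRegular _) <|
    seqP_isRegular resetP_isRegular <| seqP_isRegular (popP_isRegular _ _) <|
    seqP_isRegular (IsRegular.iSup stateP_isRegular).kstar <|
    seqP_isRegular (popP_isRegular _ _) (emptyP_isRegular _)

/-- All guesses range over finite types (modes, records, bits), so the program is a finite
expression in single operations, sequencing, finite unions and stars. -/
theorem verifierP_isRegular : verifierP.IsRegular :=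
  have hguess : guessP.IsRegular := (IsRegular.iSup fun _ => pushP_isRegular _ _).kstar
  seqP_isRegular hguess <| seqP_isRegular (pushP_isRegular _ _) <| seqP_isRegular hguess <|
    seqP_isRegular (IsRegular.iSup fun _ => pushP_isRegular _ _).kstar <|
    seqP_isRegular roundP_isRegular <| seqP_isRegular roundP_isRegular.kstar <|
    seqP_isRegular (IsRegular.iSup fun _ =>
      seqP_isRegular (guardP_isRegular _) (popP_isRegular _ _)).kstar (emptyP_isRegular _)

end Regular

/-! ### Reading weights and rows -/

/-- Least significant bit first, the codes of positive numbers are exactly the words with last bit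
`true`, while zero has the empty code. Being a nonzero weight is therefore a regular condition, and
this is the only arithmetic that the verifier needs. -/
theorem exists_encodePosNum (l : List Bool) : ∃ p, encodePosNum p = l ++ [true] := by
  induction l with
  | nil => exact ⟨.one, rfl⟩
  | cons b l ih =>
    obtain ⟨p, hp⟩ := ih
    cases b
    · exact ⟨.bit0 p, by rw [encodePosNum, hp, List.cons_append]⟩
    · exact ⟨.bit1 p, by rw [encodePosNum, hp, List.cons_append]⟩

theorem exists_eq_encodePosNum (p : PosNum) : ∃ l, encodePosNum p = l ++ [true] := by
  induction p with
  | one => exact ⟨[], rfl⟩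
  | bit0 p ih => exact ih.elim fun l h => ⟨false :: l, by rw [encodePosNum, h, List.cons_append]⟩
  | bit1 p ih => exact ih.elim fun l h => ⟨true :: l, by rw [encodePosNum, h, List.cons_append]⟩

theorem exists_encodeNat (l : List Bool) : ∃ n ≠ 0, encodeNat n = l ++ [true] := by
  obtain ⟨p, hp⟩ := exists_encodePosNum l
  have h : encodeNat (p : ℕ) = l ++ [true] := by
    rw [encodeNat, PosNum.of_to_nat, encodeNum, hp]
  exact ⟨p, (PosNum.to_nat_pos p).ne', h⟩

theorem exists_eq_encodeNat {n : ℕ} (hn : n ≠ 0) : ∃ l, encodeNat n = l ++ [true] := by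
  rw [encodeNat]
  cases h : (n : Num) with
  | zero =>
    exact absurd (by rw [← Num.to_of_nat n, h]; rfl) hn
  | pos p => exact exists_eq_encodePosNum p

theorem rel_nonzero {s u : Store} (h : Rel nonzeroP s u) :
    ∃ n ≠ 0, ∃ x, s.x = encNat n ++ x ∧ u = { s with x := x } := by
  rw [nonzeroP, rel_seq] at h
  obtain ⟨t, h, h'⟩ := h
  obtain ⟨bs, l, hl, rfl⟩ := rel_pops (k := .x) (a := fun b : Bool => Γ'.bit b) h
  simp only [rel_seq, rel_pop, Store.get_x, Store.set_x] at h' hl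
  obtain ⟨_, ⟨l', rfl, rfl⟩, x, hx, rfl⟩ := h'
  obtain ⟨n, hn, hb⟩ := exists_encodeNat bs
  dsimp only at hx
  subst hx
  exact ⟨n, hn, x, by simp [encNat, hb, hl], rfl⟩

theorem exec_nonzero {n : ℕ} (hn : n ≠ 0) {s : Store} {x : List Γ'} (hx : s.x = encNat n ++ x) :
    Exec (encNat n).length nonzeroP s { s with x := x } := by
  obtain ⟨l, hl⟩ := exists_eq_encodeNat hn
  have h1 := exec_pops (k := .x) (a := fun b : Bool => Γ'.bit b) l (s := s)
    (l := .bit true :: .comma :: x) (by simp [hx, encNat, hl])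
  exact (h1.seq ((Exec.pop (k := .x) (l := .comma :: x) rfl).seq
    (Exec.pop (k := .x) (l := x) rfl))).mono (by simp [encNat, hl])

theorem rel_entry {c : Info → Bool} {s u : Store} (h : Rel (entryP c) s u) :
    ∃ n a x i, s.x = encNat n ++ x ∧ s.i = a :: i ∧ (n ≠ 0 → c a = true) ∧
      u = { s with x := x, i := i, j := a :: s.j } := by
  simp only [entryP, rel_iSup, rel_seq, rel_pop, rel_push, rel_add, rel_guard, Store.get_i,
    Store.set_i, Store.get_j, Store.set_j, Store.get_x, Store.set_x] at h
  obtain ⟨a, _, ⟨i, hi, rfl⟩, _, rfl, ⟨x, hx, rfl⟩ | ⟨_, ⟨hc, rfl⟩, h⟩⟩ := h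
  · exact ⟨0, a, x, i, hx, hi, fun h => absurd rfl h, rfl⟩
  · obtain ⟨n, hn, x, hx, rfl⟩ := rel_nonzero h
    exact ⟨n, a, x, i, hx, hi, fun _ => hc, rfl⟩

theorem exec_entry {c : Info → Bool} {n : ℕ} {a : Info} {x : List Γ'} {i : List Info} {s : Store}
    (hx : s.x = encNat n ++ x) (hi : s.i = a :: i) (hc : n ≠ 0 → c a = true) :
    Exec (2 + (encNat n).length) (entryP c) s { s with x := x, i := i, j := a :: s.j } := by
  refine Exec.iSup a ((Exec.pop (k := .i) hi).seq ((Exec.push .j a _).seq ?_) |>.mono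
    (n := 1 + (1 + (encNat n).length)) (by omega))
  by_cases hn : n = 0
  · subst hn
    exact Exec.inl (Exec.pop (k := .x) hx)
  · exact Exec.inr (((Exec.guard (hc hn) _).seq (exec_nonzero hn (s := Store.set (s.set .i i) .j (a :: s.j))
      hx)).mono (n' := (encNat n).length) (by omega))

theorem rel_entries {c : Info → Bool} {s u : Store} (h : Rel ((entryP c)∗) s u) :
    ∃ (es : List (ℕ × Info)) (x : List Γ') (i : List Info),
      s.x = es.flatMap (fun e => encNat e.1) ++ x ∧ s.i = es.map Prod.snd ++ i ∧
      (∀ e ∈ es, e.1 ≠ 0 → c e.2 = true) ∧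
      u = { s with x := x, i := i, j := (es.map Prod.snd).reverse ++ s.j } := by
  refine rel_kstar_induction (fun s => ⟨[], s.x, s.i, rfl, rfl, by simp, rfl⟩) ?_ h
  clear h s u
  rintro s t u h ⟨es, x, i, hx, hi, hc, rfl⟩
  obtain ⟨n, a, x', i', hx', hi', hc', rfl⟩ := rel_entry h
  dsimp only at hx hi
  subst hx hi
  exact ⟨(n, a) :: es, x, i, by simp [hx'], by simp [hi'], by simpa using ⟨hc', by simpa using hc⟩,
    by simp⟩

theorem exec_entries {c : Info → Bool} (es : List (ℕ × Info)) {x : List Γ'} {i : List Info}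
    {s : Store} (hx : s.x = es.flatMap (fun e => encNat e.1) ++ x)
    (hi : s.i = es.map Prod.snd ++ i) (hc : ∀ e ∈ es, e.1 ≠ 0 → c e.2 = true) :
    Exec (2 * es.length + (es.flatMap fun e => encNat e.1).length) ((entryP c)∗) s
      { s with x := x, i := i, j := (es.map Prod.snd).reverse ++ s.j } := by
  induction es generalizing s with
  | nil =>
    obtain rfl : s.x = x := hx
    obtain rfl : s.i = i := hi
    exact Exec.kstar_nil _ _
  | cons e es ih =>
    simp only [List.flatMap_cons, List.append_assoc, List.map_cons, List.cons_append] at hx hi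
    have h1 := exec_entry (c := c) hx hi (hc e (by simp))
    have h2 := ih (s := { s with x := _, i := _, j := e.2 :: s.j }) rfl rfl
      fun e he => hc e (by simp [he])
    refine Exec.mono (n := 2 + (encNat e.1).length +
      (2 * es.length + (es.flatMap fun e => encNat e.1).length)) ?_ (by simp; omega)
    simpa using h1.kstar_cons h2

theorem rel_hit {c : Info → Bool} {s u : Store} (h : Rel (hitP c) s u) :
    ∃ n a x i, s.x = encNat n ++ x ∧ s.i = a :: i ∧ n ≠ 0 ∧ c a = true ∧
      u = { s with x := x, i := i, j := a :: s.j } := by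
  simp only [hitP, rel_iSup, rel_seq, rel_pop, rel_push, rel_guard, Store.get_i,
    Store.set_i, Store.get_j, Store.set_j] at h
  obtain ⟨a, _, ⟨i, hi, rfl⟩, _, rfl, _, ⟨hc, rfl⟩, h⟩ := h
  obtain ⟨n, hn, x, hx, rfl⟩ := rel_nonzero h
  exact ⟨n, a, x, i, hx, hi, hn, hc, rfl⟩

theorem exec_hit {c : Info → Bool} {n : ℕ} {a : Info} {x : List Γ'} {i : List Info} {s : Store}
    (hx : s.x = encNat n ++ x) (hi : s.i = a :: i) (hn : n ≠ 0) (hc : c a = true) :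
    Exec (2 + (encNat n).length) (hitP c) s { s with x := x, i := i, j := a :: s.j } :=
  Exec.iSup a (((Exec.pop (k := .i) hi).seq ((Exec.push .j a _).seq
    ((Exec.guard hc _).seq (exec_nonzero hn hx)))).mono (by omega))

/-- A row of weights is permitted and has a nonzero weight of a given kind. -/
def RowOK (c w : Info → Bool) (is : List Info) (ns : List ℕ) : Prop :=
  ns.length = is.length ∧ (∀ e ∈ ns.zip is, e.1 ≠ 0 → c e.2 = true) ∧
    ∃ e ∈ ns.zip is, e.1 ≠ 0 ∧ w e.2 = true

theorem RowOK.weaken {c w : Info → Bool} {is : List Info} {ns : List ℕ} (h : RowOK c w is ns) :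
    RowOK c (fun _ => true) is ns :=
  ⟨h.1, h.2.1, h.2.2.imp fun _ h => ⟨h.1, h.2.1, rfl⟩⟩

/-- Weights are read in step with the records of the states, so `emptyP .i` forces one weight per
state. The records pass to `j` and are moved back afterwards, which restores `i` because `j` was
empty. -/
theorem rel_row {c w : Info → Bool} {s u : Store} (hj : s.j = []) (h : Rel (rowP c w) s u) :
    ∃ ns x, s.x = encList encNat ns ++ x ∧ RowOK c w s.i ns ∧ u = { s with x := x } := by
  simp only [rowP, rel_seq, rel_pop, rel_empty, Store.get_x, Store.set_x, Store.get_i,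
    Store.get_j] at h
  obtain ⟨_, ⟨x₁, hx₁, rfl⟩, _, h₁, _, h₂, _, h₃, _, ⟨x₅, hx₅, rfl⟩, _, ⟨hi₅, rfl⟩, t, h₄, hj₆, rfl⟩ :=
    h
  obtain ⟨es, x₂, i₂, hx₂, hi₂, hc₂, rfl⟩ := rel_entries h₁
  obtain ⟨n, a, x₃, i₃, hx₃, hi₃, hn, hc₃, rfl⟩ := rel_hit h₂
  obtain ⟨es', x₄, i₄, hx₄, hi₄, hc₄, rfl⟩ := rel_entries h₃
  obtain ⟨cs, l, hcs, rfl⟩ := rel_move (k := .j) (k₁ := .i) (by decide) h₄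
  dsimp only [Store.get_j, Store.set_j, Store.set_i, Store.get_i] at *
  subst hj₆ hx₅ hi₅ hx₄ hi₄ hx₃ hi₃ hx₂
  have hcs' : cs = (es'.map Prod.snd).reverse ++ (a :: (es.map Prod.snd).reverse) := by
    simpa [hj] using hcs.symm
  have hz : ∀ l : List (ℕ × Info), (l.map Prod.fst).zip (l.map Prod.snd) = l := fun l => by
    induction l <;> simp_all
  rw [Bool.and_eq_true] at hc₃
  refine ⟨(es ++ (n, a) :: es').map Prod.fst, x₅, ?_, ⟨?_, ?_, ?_⟩, ?_⟩
  · rw [hx₁]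
    simp [encList, List.flatMap_map]
  · simp [hi₂]
  · rw [hi₂, show es.map Prod.snd ++ a :: (es'.map Prod.snd ++ []) =
      (es ++ (n, a) :: es').map Prod.snd by simp, hz]
    intro e he
    simp only [List.mem_append, List.mem_cons] at he
    rcases he with he | rfl | he
    · exact hc₂ e he
    · exact fun _ => hc₃.1
    · exact hc₄ e he
  · rw [hi₂, show es.map Prod.snd ++ a :: (es'.map Prod.snd ++ []) =
      (es ++ (n, a) :: es').map Prod.snd by simp, hz]
    exact ⟨(n, a), by simp, hn, hc₃.2⟩
  · rw [hcs']
    ext1 <;> simp [hi₂, hj]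

/-- Each entry costs its own symbols, two operations to transfer the record and two to move it back.
Its code has at least one symbol, which gives the factor 5; the brackets pay for the constant part.
-/
theorem exec_row {c w : Info → Bool} {s : Store} (hj : s.j = []) {ns : List ℕ} {x : List Γ'}
    (hx : s.x = encList encNat ns ++ x) (h : RowOK c w s.i ns) :
    Exec (5 * (encList encNat ns).length) (rowP c w) s { s with x := x } := by
  obtain ⟨hlen, hc, ⟨n, a⟩, he, hn, hw⟩ := h
  obtain ⟨es, es', hes⟩ := List.append_of_mem he
  have hns : ns = (es ++ (n, a) :: es').map Prod.fst := by
    rw [← hes, List.map_fst_zip hlen.le]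
  have hi : s.i = (es ++ (n, a) :: es').map Prod.snd := by
    rw [← hes, List.map_snd_zip hlen.ge]
  rw [hes] at hc
  have h0 := Exec.pop (k := .x) (s := s) (a := .bra) (l := es.flatMap (fun e => encNat e.1) ++
    (encNat n ++ (es'.flatMap (fun e => encNat e.1) ++ (.ket :: x)))) (by
      simp [hx, hns, encList, List.flatMap_map])
  have h1 := exec_entries (c := c) es (s := { s with x := _ }) (x := (encNat n ++
    (es'.flatMap (fun e => encNat e.1) ++ (.ket :: x)))) (i := a :: es'.map Prod.snd) rfl
    (by simp [hi]) (fun e he => hc e (by simp [he]))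
  have h2 := exec_hit (c := fun a => c a && w a) (s := { s with
      x := encNat n ++ (es'.flatMap (fun e => encNat e.1) ++ (.ket :: x))
      i := a :: es'.map Prod.snd, j := (es.map Prod.snd).reverse ++ s.j }) rfl rfl hn
      (by simpa using ⟨hc (n, a) (by simp) hn, hw⟩)
  have h3 := exec_entries (c := c) es' (s := { s with
      x := es'.flatMap (fun e => encNat e.1) ++ (.ket :: x)
      i := es'.map Prod.snd, j := a :: ((es.map Prod.snd).reverse ++ s.j) })
      (x := .ket :: x) (i := []) rfl (by simp) (fun e he => hc e (by simp [he]))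
  have h4 := exec_move (k := .j) (k₁ := .i) (a := id) (b := id) (by decide)
    ((es'.map Prod.snd).reverse ++ a :: ((es.map Prod.snd).reverse))
    (s := { s with x := x, i := [], j := (es'.map Prod.snd).reverse ++
      a :: ((es.map Prod.snd).reverse ++ s.j) }) (l := []) (by simp [hj])
  have h5 := h0.seq (h1.seq (h2.seq (h3.seq ((Exec.pop (k := .x) (l := x) rfl).seq ((Exec.empty (k := .i) rfl).seq
    (h4.seq (Exec.empty (k := .j) rfl)))))))
  have hlen' : ∀ es : List (ℕ × Info), es.length ≤ (es.flatMap fun e => encNat e.1).length :=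
    fun es => by
      induction es with
      | nil => simp
      | cons e es ih => simp [encNat] at ih ⊢; omega
  have l1 := hlen' es
  have l2 := hlen' es'
  have h6 : Exec _ (rowP c w) s ({ s with x := x, i := (((es'.map Prod.snd).reverse ++
    a :: ((es.map Prod.snd).reverse)).map id).reverse ++ [], j := [] } : Store) := h5
  rw [show ({ s with x := x, i := (((es'.map Prod.snd).reverse ++
    a :: ((es.map Prod.snd).reverse)).map id).reverse ++ [], j := [] } : Store) = { s with x := x }
    by ext1 <;> first | rfl | exact hj.symm | simp [hi]] at h6
  refine h6.mono ?_
  have l3 : 1 ≤ (encNat n).length := by simp [encNat]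
  simp only [hns, encList, List.length_cons, List.length_append, List.flatMap_map,
    List.flatMap_append, List.flatMap_cons, List.length_nil, List.length_reverse, List.length_map]
  omega

/-- The rows for one action of the opponent, each with the information whether its action tuple
belongs to the supports, pass the check of the verifier. -/
def BlockOK (md : Mode) (mask : List Bool) (is : List Info) (rs : List (Bool × List ℕ)) : Prop :=
  rs.map Prod.fst = mask ∧ (∀ r ∈ rs, RowOK (md.permits r.1) (fun _ => true) is r.2) ∧
    (md.check = true → ∃ r ∈ rs, r.1 = true ∧
      RowOK (md.permits true) (fun a => a.core.done) is r.2)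

theorem rel_anyRow {md : Mode} {s u : Store} (hj : s.j = []) (h : Rel (anyRowP md) s u) :
    ∃ b ns m x, s.m = b :: m ∧ s.x = encList encNat ns ++ x ∧
      RowOK (md.permits b) (fun _ => true) s.i ns ∧
      u = { s with m := m, x := x, mt := b :: s.mt } := by
  simp only [anyRowP, rel_iSup, rel_seq, rel_pop, rel_push, Store.get_m, Store.set_m, Store.get_mt,
    Store.set_mt] at h
  obtain ⟨b, _, ⟨m, hm, rfl⟩, _, rfl, h⟩ := h
  obtain ⟨ns, x, hx, hr, rfl⟩ := rel_row (by exact hj) h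
  exact ⟨b, ns, m, x, hm, hx, hr, rfl⟩

theorem rel_goodRow {md : Mode} {s u : Store} (hj : s.j = []) (h : Rel (goodRowP md) s u) :
    ∃ ns m x, s.m = true :: m ∧ s.x = encList encNat ns ++ x ∧
      RowOK (md.permits true) (fun a => a.core.done) s.i ns ∧
      u = { s with m := m, x := x, mt := true :: s.mt } := by
  simp only [goodRowP, rel_seq, rel_pop, rel_push, Store.get_m, Store.set_m, Store.get_mt,
    Store.set_mt] at h
  obtain ⟨_, ⟨m, hm, rfl⟩, _, rfl, h⟩ := h
  obtain ⟨ns, x, hx, hr, rfl⟩ := rel_row (by exact hj) h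
  exact ⟨ns, m, x, hm, hx, hr, rfl⟩

theorem two_le_length_encList {α : Type} (enc : α → List Γ') (l : List α) :
    2 ≤ (encList enc l).length := by
  simp [encList]

theorem exec_anyRow {md : Mode} {s : Store} (hj : s.j = []) {b : Bool} {ns : List ℕ}
    {m : List Bool} {x : List Γ'} (hm : s.m = b :: m) (hx : s.x = encList encNat ns ++ x)
    (h : RowOK (md.permits b) (fun _ => true) s.i ns) :
    Exec (6 * (encList encNat ns).length) (anyRowP md) s
      { s with m := m, x := x, mt := b :: s.mt } := by
  have h1 := exec_row (c := md.permits b) (w := fun _ => true)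
    (s := { s with m := m, mt := b :: s.mt }) hj hx h
  have := two_le_length_encList encNat ns
  exact Exec.iSup b (((Exec.pop (k := .m) hm).seq ((Exec.push .mt b _).seq h1)).mono (by omega))

theorem exec_goodRow {md : Mode} {s : Store} (hj : s.j = []) {ns : List ℕ}
    {m : List Bool} {x : List Γ'} (hm : s.m = true :: m) (hx : s.x = encList encNat ns ++ x)
    (h : RowOK (md.permits true) (fun a => a.core.done) s.i ns) :
    Exec (6 * (encList encNat ns).length) (goodRowP md) s
      { s with m := m, x := x, mt := true :: s.mt } := by
  have h1 := exec_row (s := { s with m := m, mt := true :: s.mt }) hj hx h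
  have := two_le_length_encList encNat ns
  exact ((Exec.pop (k := .m) hm).seq ((Exec.push .mt true _).seq h1)).mono (by omega)

theorem rel_anyRows {md : Mode} {s u : Store} (hj : s.j = []) (h : Rel ((anyRowP md)∗) s u) :
    ∃ (rs : List (Bool × List ℕ)) (m : List Bool) (x : List Γ'), s.m = rs.map Prod.fst ++ m ∧
      s.x = rs.flatMap (fun r => encList encNat r.2) ++ x ∧
      (∀ r ∈ rs, RowOK (md.permits r.1) (fun _ => true) s.i r.2) ∧
      u = { s with m := m, x := x, mt := (rs.map Prod.fst).reverse ++ s.mt } := by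
  revert hj
  refine rel_kstar_induction (fun s _ => ⟨[], s.m, s.x, rfl, rfl, by simp, rfl⟩) ?_ h
  clear h s u
  intro s t u h ih hj
  obtain ⟨b, ns, m', x', hm', hx', hr', rfl⟩ := rel_anyRow hj h
  obtain ⟨rs, m, x, hm, hx, hr, rfl⟩ := ih hj
  dsimp only at hm hx
  subst hm hx
  refine ⟨(b, ns) :: rs, m, x, by simp [hm'], by simp [hx'], ?_, by simp⟩
  intro r hr''
  rcases List.mem_cons.1 hr'' with rfl | h
  · exact hr'
  · exact hr r h

theorem exec_anyRows {md : Mode} {s : Store} (hj : s.j = []) (rs : List (Bool × List ℕ))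
    {m : List Bool} {x : List Γ'} (hm : s.m = rs.map Prod.fst ++ m)
    (hx : s.x = rs.flatMap (fun r => encList encNat r.2) ++ x)
    (hr : ∀ r ∈ rs, RowOK (md.permits r.1) (fun _ => true) s.i r.2) :
    Exec (6 * (rs.flatMap fun r => encList encNat r.2).length) ((anyRowP md)∗) s
      { s with m := m, x := x, mt := (rs.map Prod.fst).reverse ++ s.mt } := by
  induction rs generalizing s with
  | nil =>
    obtain rfl : s.m = m := hm
    obtain rfl : s.x = x := hx
    exact Exec.kstar_nil _ _
  | cons r rs ih =>
    simp only [List.flatMap_cons, List.append_assoc, List.map_cons, List.cons_append] at hx hm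
    have h1 := exec_anyRow hj hm hx (hr r (by simp))
    have h2 := ih (s := { s with m := _, x := _, mt := r.1 :: s.mt }) hj rfl rfl
      fun r h => hr r (by simp [h])
    refine Exec.mono (n := 6 * (encList encNat r.2).length +
      6 * (rs.flatMap fun r => encList encNat r.2).length) ?_ (by simp; omega)
    simpa using h1.kstar_cons h2

/-- Each row carries one bit of the mask from `m` back to `mt`. Hence `emptyP .m` forces exactly one
row per tuple of the team, and `mt` is available again for the next action of the opponent. The bit
of the last tuple lies on top of `mt`, which explains the reversal. -/
theorem rel_block {md : Mode} {s u : Store} (hj : s.j = []) (hm : s.m = [])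
    (h : Rel (blockP md) s u) :
    ∃ rs x, s.x = rs.flatMap (fun r => encList encNat r.2) ++ x ∧
      BlockOK md s.mt.reverse s.i rs ∧ u = { s with x := x } := by
  simp only [blockP, rel_seq, rel_empty, Store.get_mt, Store.get_m] at h
  obtain ⟨_, h₁, _, ⟨hmt, rfl⟩, _, h₂, hm', rfl⟩ := h
  obtain ⟨cs, l, hcs, rfl⟩ := rel_move (k := .mt) (k₁ := .m) (by decide) h₁
  dsimp only [Store.get_mt, Store.set_mt, Store.set_m, Store.get_m] at *
  subst hmt
  rw [List.map_id, List.append_nil] at hcs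
  subst hcs
  split_ifs at h₂ with hc
  · simp only [rel_seq] at h₂
    obtain ⟨_, h₃, _, h₄, h₅⟩ := h₂
    obtain ⟨rs, m₁, x₁, hm₁, hx₁, hr₁, rfl⟩ := rel_anyRows (by exact hj) h₃
    obtain ⟨ns, m₂, x₂, hm₂, hx₂, hr₂, rfl⟩ := rel_goodRow (by exact hj) h₄
    obtain ⟨rs', m₃, x₃, hm₃, hx₃, hr₃, rfl⟩ := rel_anyRows (by exact hj) h₅
    dsimp only at *
    subst hm' hm₃ hm₂ hx₃ hx₂
    have hmask : (rs ++ (true, ns) :: rs').map Prod.fst = s.mt.reverse := by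
      simpa [hm] using hm₁.symm
    refine ⟨rs ++ (true, ns) :: rs', x₃, by simp [hx₁], ⟨hmask, ?_, fun _ => ?_⟩, ?_⟩
    · intro r hr
      simp only [List.mem_append, List.mem_cons] at hr
      rcases hr with hr | rfl | hr
      · exact hr₁ r hr
      · exact hr₂.weaken
      · exact hr₃ r hr
    · exact ⟨(true, ns), by simp, rfl, hr₂⟩
    · ext1 <;> first | rfl | exact hm.symm | skip
      rw [← List.reverse_reverse s.mt, ← hmask]
      simp
  · obtain ⟨rs, m₁, x₁, hm₁, hx₁, hr₁, rfl⟩ := rel_anyRows (by exact hj) h₂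
    dsimp only at *
    subst hm'
    have hmask : rs.map Prod.fst = s.mt.reverse := by
      simpa [hm] using hm₁.symm
    refine ⟨rs, x₁, hx₁, ⟨hmask, hr₁, fun h => absurd h hc⟩, ?_⟩
    ext1 <;> first | rfl | exact hm.symm | skip
    rw [← List.reverse_reverse s.mt, ← hmask]
    simp

theorem exec_block {md : Mode} {s : Store} (hj : s.j = []) (hm : s.m = [])
    {rs : List (Bool × List ℕ)} {x : List Γ'}
    (hx : s.x = rs.flatMap (fun r => encList encNat r.2) ++ x)
    (h : BlockOK md s.mt.reverse s.i rs) :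
    Exec (8 * (rs.flatMap fun r => encList encNat r.2).length + 2) (blockP md) s
      { s with x := x } := by
  obtain ⟨hmask, hr, hgood⟩ := h
  have h1 := exec_move (k := .mt) (k₁ := .m) (a := id) (b := id) (by decide) s.mt (s := s) (l := [])
    (by simp)
  have h2 : Exec (6 * (rs.flatMap fun r => encList encNat r.2).length)
      (if md.check then (anyRowP md)∗ ⨾ goodRowP md ⨾ (anyRowP md)∗ else (anyRowP md)∗)
      { s with m := (s.mt.map id).reverse ++ s.m, mt := [] }
      { s with m := [], x := x, mt := (rs.map Prod.fst).reverse } := by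
    split_ifs with hc
    · obtain ⟨⟨b, ns⟩, hmem, hb, hg⟩ := hgood hc
      obtain rfl : b = true := hb
      obtain ⟨rs₁, rs₂, rfl⟩ := List.append_of_mem hmem
      have e1 := exec_anyRows (md := md)
        (s := { s with m := (s.mt.map id).reverse ++ s.m, mt := [] }) hj rs₁
        (m := true :: rs₂.map Prod.fst)
        (x := encList encNat ns ++ (rs₂.flatMap (fun r => encList encNat r.2) ++ x))
        (by simp [← hmask, hm]) (by simp [hx]) fun r h => hr r (by simp [h])
      have e2 := exec_goodRow (md := md) (s := { s with
        m := true :: rs₂.map Prod.fst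
        x := encList encNat ns ++ (rs₂.flatMap (fun r => encList encNat r.2) ++ x)
        mt := (rs₁.map Prod.fst).reverse ++ [] }) hj rfl rfl hg
      have e3 := exec_anyRows (md := md) (s := { s with
        m := rs₂.map Prod.fst
        x := rs₂.flatMap (fun r => encList encNat r.2) ++ x
        mt := true :: ((rs₁.map Prod.fst).reverse ++ []) }) hj rs₂ (m := []) (x := x)
        (by simp) rfl fun r h => hr r (by simp [h])
      refine Exec.mono (n := 6 * (rs₁.flatMap fun r => encList encNat r.2).length +
        (6 * (encList encNat ns).length + 6 * (rs₂.flatMap fun r => encList encNat r.2).length))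
        ?_ (by simp; omega)
      simpa using e1.seq (e2.seq e3)
    · simpa using exec_anyRows (md := md)
        (s := { s with m := (s.mt.map id).reverse ++ s.m, mt := [] }) hj rs (m := []) (x := x)
        (by simp [← hmask, hm]) hx hr
  have h3 := h1.seq ((Exec.empty (k := .mt) rfl).seq (h2.seq (Exec.empty (k := .m) rfl)))
  have hmt : (rs.map Prod.fst).reverse = s.mt := by rw [hmask, List.reverse_reverse]
  have h4 : Exec _ (blockP md) s { s with m := [], x := x, mt := (rs.map Prod.fst).reverse } := h3
  rw [show ({ s with m := [], x := x, mt := (rs.map Prod.fst).reverse } : Store) =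
    { s with x := x } by ext1 <;> first | rfl | exact hm.symm | exact hmt] at h4
  refine h4.mono ?_
  have l1 : rs.length ≤ (rs.flatMap fun r => encList encNat r.2).length := by
    clear h4 h3 h2 hr hgood hmask hx hmt
    induction rs with
    | nil => simp
    | cons r rs ih =>
      have := two_le_length_encList encNat r.2
      simp at ih ⊢
      omega
  have l2 : s.mt.length = rs.length := by rw [← hmt]; simp
  omega

theorem encList_map {α β : Type} (enc : β → List Γ') (f : α → β) (l : List α) :
    encList enc (l.map f) = .bra :: (l.flatMap (fun a => enc (f a)) ++ [.ket]) := by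
  rw [encList, List.flatMap_map]

/-- The opponent is the most significant player in the lexicographic order, so the rows for one of
his actions are consecutive and form a block. The stack `o` holds a token for each of his available
actions, so `emptyP .o` forces the right number of blocks. -/
theorem rel_rows {md : Mode} {s u : Store} (hj : s.j = []) (hm : s.m = [])
    (h : Rel (rowsP md) s u) :
    ∃ (bs : List (List (Bool × List ℕ))) (x : List Γ'),
      s.x = encList (encList encNat) (bs.flatten.map Prod.snd) ++ x ∧ bs.length = s.o.length ∧
      (∀ rs ∈ bs, BlockOK md s.mt.reverse s.i rs) ∧ u = { s with x := x, o := [], mt := [] } := by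
  have hloop : ∀ s u, Rel ((popP .o () ⨾ blockP md)∗) s u → s.j = [] → s.m = [] →
      ∃ (bs : List (List (Bool × List ℕ))) (x : List Γ') (o : List Unit),
      s.x = bs.flatten.flatMap (fun r => encList encNat r.2) ++ x ∧
      s.o.length = bs.length + o.length ∧ (∀ rs ∈ bs, BlockOK md s.mt.reverse s.i rs) ∧
      u = { s with x := x, o := o } := by
    intro s u h
    refine rel_kstar_induction (fun s _ _ => ⟨[], s.x, s.o, rfl, by simp, by simp, rfl⟩) ?_ h
    clear h s u hj hm
    intro s t u h ih hj hm
    simp only [rel_seq, rel_pop, Store.get_o, Store.set_o] at h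
    obtain ⟨_, ⟨o', ho, rfl⟩, h⟩ := h
    obtain ⟨rs, x', hx', hr, rfl⟩ := rel_block (by exact hj) (by exact hm) h
    obtain ⟨bs, x, o, hx, ho', hb, rfl⟩ := ih hj hm
    dsimp only at hx ho' hx'
    subst hx
    refine ⟨rs :: bs, x, o, by simp [hx'], by simp [ho, ho']; omega, ?_, rfl⟩
    intro r hr'
    rcases List.mem_cons.1 hr' with rfl | h
    · exact hr
    · exact hb r h
  simp only [rowsP, rel_seq, rel_pop, rel_empty, Store.get_x, Store.set_x, Store.get_o,
    Store.get_mt] at h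
  obtain ⟨_, ⟨x₁, hx₁, rfl⟩, _, h₁, _, ⟨ho, rfl⟩, _, ⟨x₂, hx₂, rfl⟩, _, h₂, hmt, rfl⟩ := h
  obtain ⟨bs, x, o, hx, ho', hb, rfl⟩ := hloop _ _ h₁ hj hm
  obtain ⟨cs, l, hcs, rfl⟩ := rel_pops (k := .mt) h₂
  dsimp only [Store.get_mt, Store.set_mt] at *
  subst hmt ho hx₂ hx
  exact ⟨bs, x₂, by rw [hx₁, encList_map]; simp, by simp [ho'], hb, rfl⟩

theorem exec_rows {md : Mode} {s : Store} (hj : s.j = []) (hm : s.m = [])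
    {bs : List (List (Bool × List ℕ))} {x : List Γ'}
    (hx : s.x = encList (encList encNat) (bs.flatten.map Prod.snd) ++ x)
    (ho : bs.length = s.o.length) (hb : ∀ rs ∈ bs, BlockOK md s.mt.reverse s.i rs) :
    Exec (8 * (encList (encList encNat) (bs.flatten.map Prod.snd)).length + 3 * s.o.length +
      s.mt.length + 4) (rowsP md) s { s with x := x, o := [], mt := [] } := by
  have hloop : ∀ (bs : List (List (Bool × List ℕ))) (s : Store) (x : List Γ'),
      s.j = [] → s.m = [] → s.x = bs.flatten.flatMap (fun r => encList encNat r.2) ++ x →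
      bs.length = s.o.length → (∀ rs ∈ bs, BlockOK md s.mt.reverse s.i rs) →
      Exec (8 * (bs.flatten.flatMap fun r => encList encNat r.2).length + 3 * bs.length)
        ((popP .o () ⨾ blockP md)∗) s { s with x := x, o := [] } := by
    clear hx ho hb hj hm
    intro bs
    induction bs with
    | nil =>
      intro s x hj hm hx ho hb
      obtain rfl : s.x = x := hx
      have : s.o = [] := List.length_eq_zero_iff.1 ho.symm
      rw [← this]
      exact Exec.kstar_nil _ _
    | cons rs bs ih =>
      intro s x hj hm hx ho hb
      obtain ⟨o, ho'⟩ : ∃ o, s.o = () :: o := by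
        cases h : s.o with
        | nil => simp [h] at ho
        | cons a o => exact ⟨o, rfl⟩
      simp only [List.flatten_cons, List.flatMap_append, List.append_assoc] at hx
      have h1 := exec_block (md := md) (s := { s with o := o }) hj hm hx (hb rs (by simp))
      have h2 := ih { s with o := o, x := _ } x hj hm rfl (by simpa [ho'] using ho)
        fun r hr => hb r (by simp [hr])
      have h3 := Exec.kstar_cons ((Exec.pop (k := .o) ho').seq h1) h2
      refine h3.mono ?_
      simp
      omega
  have h0 := Exec.pop (k := .x) (a := .bra) (s := s)
    (l := bs.flatten.flatMap (fun r => encList encNat r.2) ++ (.ket :: x))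
    (by rw [Store.get_x, hx, encList_map]; simp)
  have h1 := hloop bs { s with x := bs.flatten.flatMap (fun r => encList encNat r.2) ++ (.ket :: x) }
    (.ket :: x) hj hm rfl ho hb
  have h2 := exec_pops (k := .mt) (a := id) s.mt (s := { s with x := x, o := [] }) (l := [])
    (by simp)
  have h3 := h0.seq (h1.seq ((Exec.empty (k := .o) rfl).seq ((Exec.pop (k := .x) (l := x) rfl).seq
    (h2.seq (Exec.empty (k := .mt) rfl)))))
  refine h3.mono ?_
  rw [encList_map, List.length_cons, List.length_append, List.length_singleton, ho]
  omega

/-! ### Reading the available actions -/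

/-- A list of natural numbers in unary. -/
def unary (l : List ℕ) : List Bool := l.flatMap fun n => List.replicate n true ++ [false]

theorem unary_cons (n : ℕ) (l : List ℕ) :
    unary (n :: l) = List.replicate n true ++ false :: unary l := by
  simp [unary]

/-- The encoding of the availability of an action, which may be annotated. -/
def encDigit (d : Option Bool) : List Γ' := encBit d.isSome

theorem replicate_append_cons {α : Type} (n : ℕ) (a : α) (l : List α) :
    List.replicate n a ++ a :: l = List.replicate (n + 1) a ++ l := by
  rw [List.replicate_succ']
  simp

theorem Exec.of_eq {n n' : ℕ} {L : Prog} {s t t' : Store} (h : Exec n L s t) (ht : t = t')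
    (hn : n ≤ n') : Exec n' L s t' :=
  ht ▸ h.mono hn

/-- Writing the pushed tokens as a count, zero or one of them, lets the tokens of successive bits
add up to the number of available actions. -/
theorem rel_oppBit {b : Bool} {s u : Store} (h : Rel (oppBitP b) s u) :
    ∃ x sh, s.x = encBit b ++ x ∧ s.sh = true :: sh ∧
      u = { s with x := x, sh := sh, st := true :: s.st,
                   o := List.replicate ([b].count true) () ++ s.o } := by
  cases b <;>
  · simp only [oppBitP, rel_seq, rel_pop, rel_push, Store.get_x, Store.set_x, Store.get_sh,
      Store.set_sh, Store.get_st, Store.set_st, Store.get_o, Store.set_o, if_true,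
      if_false, rel_one, Bool.false_eq_true] at h
    obtain ⟨_, ⟨x, hx, rfl⟩, _, ⟨sh, hsh, rfl⟩, _, rfl, rfl⟩ := h
    exact ⟨x, sh, hx, hsh, rfl⟩

theorem exec_oppBit {b : Bool} {s : Store} {x : List Γ'} {sh : List Bool}
    (hx : s.x = encBit b ++ x) (hsh : s.sh = true :: sh) :
    Exec 4 (oppBitP b) s { s with x := x, sh := sh, st := true :: s.st,
                                  o := List.replicate ([b].count true) () ++ s.o } := by
  have h1 := (Exec.pop (k := .x) (s := s) (a := .bit b) hx)
  have h2 := (Exec.pop (k := .sh) (s := { s with x := x }) (a := true) hsh)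
  cases b
  · exact (h1.seq (h2.seq ((Exec.push .st true _).seq (Exec.one _)))).mono (by omega)
  · exact h1.seq (h2.seq ((Exec.push .st true _).seq (Exec.push .o () _)))

theorem rel_oppBits {s u : Store} (h : Rel ((⨆ b, oppBitP b)∗) s u) :
    ∃ (bs : List Bool) (x : List Γ') (sh : List Bool), s.x = bs.flatMap encBit ++ x ∧
      s.sh = List.replicate bs.length true ++ sh ∧
      u = { s with x := x, sh := sh, st := List.replicate bs.length true ++ s.st,
                   o := List.replicate (bs.count true) () ++ s.o } := by
  refine rel_kstar_induction (fun s => ⟨[], s.x, s.sh, rfl, rfl, rfl⟩) ?_ h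
  clear h s u
  rintro s t u h ⟨bs, x, sh, hx, hsh, rfl⟩
  rw [rel_iSup] at h
  obtain ⟨b, h⟩ := h
  obtain ⟨x', sh', hx', hsh', rfl⟩ := rel_oppBit h
  dsimp only at hx hsh
  subst hx hsh
  refine ⟨b :: bs, x, sh, by simp [hx'], by simp [hsh', List.replicate_succ], ?_⟩
  ext1 <;> try rfl
  · exact replicate_append_cons _ _ _
  · dsimp only
    rw [← List.append_assoc, ← List.replicate_add, Nat.add_comm, ← List.count_append]
    rfl

theorem exec_oppBits (bs : List Bool) {s : Store} {x : List Γ'} {sh : List Bool}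
    (hx : s.x = bs.flatMap encBit ++ x) (hsh : s.sh = List.replicate bs.length true ++ sh) :
    Exec (4 * bs.length) ((⨆ b, oppBitP b)∗) s
      { s with x := x, sh := sh, st := List.replicate bs.length true ++ s.st,
               o := List.replicate (bs.count true) () ++ s.o } := by
  induction bs generalizing s with
  | nil =>
    obtain rfl : s.x = x := hx
    obtain rfl : s.sh = sh := hsh
    exact Exec.kstar_nil _ _
  | cons b bs ih =>
    rw [List.flatMap_cons, List.append_assoc] at hx
    have h2 := Exec.kstar_cons (Exec.iSup b (exec_oppBit hx hsh)) (ih rfl rfl)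
    refine h2.of_eq ?_ (by rw [List.length_cons]; omega)
    ext1 <;> try rfl
    · exact replicate_append_cons _ _ _
    · dsimp only
      rw [← List.append_assoc, ← List.replicate_add, Nat.add_comm, ← List.count_append]
      rfl

/-- The bit `true` required between the two loops guarantees an available action. Each bit consumes
a mark of the guessed unary number on `sh`, and the final `false` there ensures that the number of
actions is met exactly. -/
theorem rel_opp {s u : Store} (h : Rel oppP s u) :
    ∃ (bs : List Bool) (x : List Γ') (sh : List Bool), s.x = encList encBit bs ++ x ∧
      s.sh = unary [bs.length] ++ sh ∧ true ∈ bs ∧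
      u = { s with x := x, sh := sh, st := (unary [bs.length]).reverse ++ s.st,
                   o := List.replicate (bs.count true) () ++ s.o } := by
  simp only [oppP, rel_seq, rel_pop, rel_push, Store.get_x, Store.set_x, Store.get_sh,
    Store.set_sh, Store.get_st, Store.set_st] at h
  obtain ⟨_, ⟨x₁, hx₁, rfl⟩, _, h₂, _, h₃, _, h₄, _, ⟨x₅, hx₅, rfl⟩, _, ⟨sh₆, hsh₆, rfl⟩, rfl⟩ := h
  obtain ⟨bs, x₂, sh₂, hx₂, hsh₂, rfl⟩ := rel_oppBits h₂
  obtain ⟨x₃, sh₃, hx₃, hsh₃, rfl⟩ := rel_oppBit h₃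
  obtain ⟨bs', x₄, sh₄, hx₄, hsh₄, rfl⟩ := rel_oppBits h₄
  dsimp only at *
  subst hx₅ hsh₆ hx₄ hsh₄ hx₃ hsh₃ hx₂
  refine ⟨bs ++ true :: bs', x₅, sh₆, ?_, ?_, by simp, ?_⟩
  · simp [hx₁, encList]
  · simp [hsh₂, unary, List.replicate_add, List.replicate_succ]
  · ext1 <;> try rfl
    · simp only [unary, List.flatMap_cons, List.flatMap_nil, List.append_nil, List.reverse_append,
        List.reverse_cons, List.reverse_nil, List.nil_append, List.reverse_replicate,
        List.length_append, List.length_cons, List.cons_append]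
      rw [replicate_append_cons, ← List.append_assoc, ← List.replicate_add]
      congr 3
      omega
    · simp only [← List.append_assoc, ← List.replicate_add]
      congr 2
      simp
      omega

theorem exec_opp (bs : List Bool) {s : Store} {x : List Γ'} {sh : List Bool}
    (hx : s.x = encList encBit bs ++ x) (hsh : s.sh = unary [bs.length] ++ sh) (hb : true ∈ bs) :
    Exec (4 * (encList encBit bs).length) oppP s
      { s with x := x, sh := sh, st := (unary [bs.length]).reverse ++ s.st,
               o := List.replicate (bs.count true) () ++ s.o } := by
  obtain ⟨bs, bs', rfl⟩ := List.append_of_mem hb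
  have h1 := Exec.pop (k := .x) (s := s) (a := .bra) (l := bs.flatMap encBit ++ (encBit true ++
    (bs'.flatMap encBit ++ .ket :: x))) (by simp [hx, encList])
  have h2 := exec_oppBits bs (s := s.set .x (bs.flatMap encBit ++ (encBit true ++
    (bs'.flatMap encBit ++ .ket :: x)))) (x := encBit true ++ (bs'.flatMap encBit ++ .ket :: x))
    (sh := true :: (List.replicate bs'.length true ++ false :: sh)) rfl
    (by simp [hsh, unary, List.replicate_add, List.replicate_succ])
  have h3 := exec_oppBit (b := true) (x := bs'.flatMap encBit ++ .ket :: x)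
    (sh := List.replicate bs'.length true ++ false :: sh) (s := { s with
      x := encBit true ++ (bs'.flatMap encBit ++ .ket :: x)
      sh := true :: (List.replicate bs'.length true ++ false :: sh)
      st := List.replicate bs.length true ++ s.st
      o := List.replicate (bs.count true) () ++ s.o }) rfl rfl
  have h4 := exec_oppBits bs' (x := .ket :: x) (sh := false :: sh) (s := { s with
      x := bs'.flatMap encBit ++ .ket :: x
      sh := List.replicate bs'.length true ++ false :: sh
      st := true :: (List.replicate bs.length true ++ s.st)
      o := List.replicate ([true].count true) () ++ (List.replicate (bs.count true) () ++ s.o) })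
      rfl rfl
  have h5 := h1.seq (h2.seq (h3.seq (h4.seq ((Exec.pop (k := .x) (l := x) rfl).seq
    ((Exec.pop (k := .sh) (l := sh) rfl).seq (Exec.push .st false _))))))
  have l1 : ∀ bs : List Bool, (bs.flatMap encBit).length = bs.length := fun bs => by
    simp [encBit]
  refine h5.of_eq ?_ ?_
  · ext1 <;> try rfl
    · simp only [unary, List.flatMap_cons, List.flatMap_nil, List.append_nil, List.reverse_append,
        List.reverse_cons, List.reverse_nil, List.nil_append, List.reverse_replicate,
        List.length_append, List.length_cons, List.cons_append,
        Store.get_st, Store.set_st, Store.set_x, Store.set_sh]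
      rw [replicate_append_cons, ← List.append_assoc, ← List.replicate_add]
      congr 3
      omega
    · simp only [← List.append_assoc, ← List.replicate_add, Store.set_st, Store.set_x, Store.set_sh]
      congr 2
      simp
      omega
  · simp only [encList, List.flatMap_append, List.flatMap_cons, List.length_append,
      List.length_cons, l1, encBit, List.length_nil]
    omega

theorem rel_digit {d : Option Bool} {s u : Store} (h : Rel (digitP d) s u) :
    ∃ x sh, s.x = encDigit d ++ x ∧ s.sh = true :: sh ∧
      u = { s with x := x, sh := sh, st := true :: s.st, dg := some d :: s.dg } := by
  simp only [digitP, rel_seq, rel_pop, rel_push, Store.get_x, Store.set_x, Store.get_sh,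
    Store.set_sh, Store.get_st, Store.set_st, Store.get_dg, Store.set_dg] at h
  obtain ⟨_, ⟨x, hx, rfl⟩, _, ⟨sh, hsh, rfl⟩, _, rfl, rfl⟩ := h
  exact ⟨x, sh, hx, hsh, rfl⟩

theorem exec_digit {d : Option Bool} {s : Store} {x : List Γ'} {sh : List Bool}
    (hx : s.x = encDigit d ++ x) (hsh : s.sh = true :: sh) :
    Exec 4 (digitP d) s
      { s with x := x, sh := sh, st := true :: s.st, dg := some d :: s.dg } := by
  have h1 := (Exec.pop (k := .x) (s := s) (a := .bit d.isSome) hx)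
  have h2 := (Exec.pop (k := .sh) (s := { s with x := x }) (a := true) hsh)
  exact h1.seq (h2.seq ((Exec.push .st true _).seq (Exec.push .dg (some d) _)))

theorem rel_digits {s u : Store} (h : Rel ((⨆ d, digitP d)∗) s u) :
    ∃ (ds : List (Option Bool)) (x : List Γ') (sh : List Bool), s.x = ds.flatMap encDigit ++ x ∧
      s.sh = List.replicate ds.length true ++ sh ∧
      u = { s with x := x, sh := sh, st := List.replicate ds.length true ++ s.st,
                   dg := (ds.map some).reverse ++ s.dg } := by
  refine rel_kstar_induction (fun s => ⟨[], s.x, s.sh, rfl, rfl, rfl⟩) ?_ h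
  clear h s u
  rintro s t u h ⟨ds, x, sh, hx, hsh, rfl⟩
  rw [rel_iSup] at h
  obtain ⟨d, h⟩ := h
  obtain ⟨x', sh', hx', hsh', rfl⟩ := rel_digit h
  dsimp only at hx hsh
  subst hx hsh
  refine ⟨d :: ds, x, sh, by simp [hx'], by simp [hsh', List.replicate_succ], ?_⟩
  rw [List.length_cons, ← replicate_append_cons]
  simp

theorem exec_digits (ds : List (Option Bool)) {s : Store} {x : List Γ'} {sh : List Bool}
    (hx : s.x = ds.flatMap encDigit ++ x) (hsh : s.sh = List.replicate ds.length true ++ sh) :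
    Exec (4 * ds.length) ((⨆ d, digitP d)∗) s
      { s with x := x, sh := sh, st := List.replicate ds.length true ++ s.st,
               dg := (ds.map some).reverse ++ s.dg } := by
  induction ds generalizing s with
  | nil =>
    obtain rfl : s.x = x := hx
    obtain rfl : s.sh = sh := hsh
    exact Exec.kstar_nil _ _
  | cons d ds ih =>
    rw [List.flatMap_cons, List.append_assoc] at hx
    have h2 := Exec.kstar_cons (Exec.iSup d (exec_digit hx hsh)) (ih rfl rfl)
    refine h2.of_eq ?_ (by rw [List.length_cons]; omega)
    ext1 <;> try rfl
    · exact replicate_append_cons _ _ _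
    · simp

/-- The annotated actions of the team, as they are pushed on a stack. -/
def digitWord (team : List (List (Option Bool))) : List (Option (Option Bool)) :=
  (team.flatMap fun ds => none :: ds.map some).reverse

theorem digitWord_cons (ds : List (Option Bool)) (team : List (List (Option Bool))) :
    digitWord (ds :: team) = digitWord team ++ ((ds.map some).reverse ++ [none]) := by
  simp [digitWord]

/-- A digit `none` stands for an unavailable action and `some b` for an available one whose
membership in the support is guessed as `b`. The symbol `none` pushed first separates the players on
`dg`. -/
theorem rel_player {s u : Store} (h : Rel playerP s u) :
    ∃ (ds : List (Option Bool)) (x : List Γ') (sh : List Bool), s.x = encList encDigit ds ++ x ∧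
      s.sh = unary [ds.length] ++ sh ∧ (∃ b, some b ∈ ds) ∧
      u = { s with x := x, sh := sh, st := (unary [ds.length]).reverse ++ s.st,
                   dg := digitWord [ds] ++ s.dg } := by
  simp only [playerP, rel_seq, rel_pop, rel_push, rel_iSup (L := fun b => digitP (some b)),
    Store.get_x, Store.set_x, Store.get_sh,
    Store.set_sh, Store.get_st, Store.set_st, Store.get_dg, Store.set_dg] at h
  obtain ⟨_, rfl, _, ⟨x₁, hx₁, rfl⟩, _, h₂, _, ⟨b, h₃⟩, _, h₄, _, ⟨x₅, hx₅, rfl⟩, _,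
    ⟨sh₆, hsh₆, rfl⟩, rfl⟩ := h
  obtain ⟨ds, x₂, sh₂, hx₂, hsh₂, rfl⟩ := rel_digits h₂
  obtain ⟨x₃, sh₃, hx₃, hsh₃, rfl⟩ := rel_digit h₃
  obtain ⟨ds', x₄, sh₄, hx₄, hsh₄, rfl⟩ := rel_digits h₄
  dsimp only at *
  subst hx₅ hsh₆ hx₄ hsh₄ hx₃ hsh₃ hx₂
  refine ⟨ds ++ some b :: ds', x₅, sh₆, ?_, ?_, ⟨b, by simp⟩, ?_⟩
  · simp [hx₁, encList]
  · simp [hsh₂, unary, List.replicate_add, List.replicate_succ]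
  · ext1 <;> try rfl
    · simp only [unary, List.flatMap_cons, List.flatMap_nil, List.append_nil, List.reverse_append,
        List.reverse_cons, List.reverse_nil, List.nil_append, List.reverse_replicate,
        List.length_append, List.length_cons, List.cons_append]
      rw [replicate_append_cons, ← List.append_assoc, ← List.replicate_add]
      congr 3
      omega
    · simp [digitWord]

theorem exec_player (ds : List (Option Bool)) {s : Store} {x : List Γ'} {sh : List Bool}
    (hx : s.x = encList encDigit ds ++ x) (hsh : s.sh = unary [ds.length] ++ sh)
    (hb : ∃ b, some b ∈ ds) :
    Exec (4 * (encList encDigit ds).length) playerP s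
      { s with x := x, sh := sh, st := (unary [ds.length]).reverse ++ s.st,
               dg := digitWord [ds] ++ s.dg } := by
  obtain ⟨b, hb⟩ := hb
  obtain ⟨ds, ds', rfl⟩ := List.append_of_mem hb
  have h1 := Exec.pop (k := .x) (s := s.set .dg (none :: s.dg)) (a := .bra)
    (l := ds.flatMap encDigit ++ (encDigit (some b) ++ (ds'.flatMap encDigit ++ .ket :: x)))
    (by simp [hx, encList])
  have h2 := exec_digits ds (s := { s with
      x := ds.flatMap encDigit ++ (encDigit (some b) ++ (ds'.flatMap encDigit ++ .ket :: x))
      dg := none :: s.dg }) (x := encDigit (some b) ++ (ds'.flatMap encDigit ++ .ket :: x))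
    (sh := true :: (List.replicate ds'.length true ++ false :: sh)) rfl
    (by simp [hsh, unary, List.replicate_add, List.replicate_succ])
  have h3 := exec_digit (d := some b) (x := ds'.flatMap encDigit ++ .ket :: x)
    (sh := List.replicate ds'.length true ++ false :: sh) (s := { s with
      x := encDigit (some b) ++ (ds'.flatMap encDigit ++ .ket :: x)
      sh := true :: (List.replicate ds'.length true ++ false :: sh)
      st := List.replicate ds.length true ++ s.st
      dg := (ds.map some).reverse ++ none :: s.dg }) rfl rfl
  have h4 := exec_digits ds' (x := .ket :: x) (sh := false :: sh) (s := { s with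
      x := ds'.flatMap encDigit ++ .ket :: x
      sh := List.replicate ds'.length true ++ false :: sh
      st := true :: (List.replicate ds.length true ++ s.st)
      dg := some (some b) :: ((ds.map some).reverse ++ none :: s.dg) }) rfl rfl
  have h5 := (Exec.push .dg none s).seq (h1.seq (h2.seq ((Exec.iSup (L := fun b => digitP (some b)) b h3).seq (h4.seq
    ((Exec.pop (k := .x) (l := x) rfl).seq
    ((Exec.pop (k := .sh) (l := sh) rfl).seq (Exec.push .st false _)))))))
  have l1 : ∀ ds : List (Option Bool), (ds.flatMap encDigit).length = ds.length := fun ds => by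
    simp [encDigit, encBit]
  refine h5.of_eq ?_ ?_
  · ext1 <;> try rfl
    · simp only [unary, List.flatMap_cons, List.flatMap_nil, List.append_nil, List.reverse_append,
        List.reverse_cons, List.reverse_nil, List.nil_append, List.reverse_replicate,
        List.length_append, List.length_cons, List.cons_append,
        Store.get_st, Store.set_st, Store.set_x, Store.set_sh]
      rw [replicate_append_cons, ← List.append_assoc, ← List.replicate_add]
      congr 3
      omega
    · simp [digitWord]
  · simp only [encList, List.flatMap_append, List.flatMap_cons, List.length_append,
      List.length_cons, l1, encDigit, encBit, List.length_nil]
    omega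

theorem unary_append (l l' : List ℕ) : unary (l ++ l') = unary l ++ unary l' :=
  List.flatMap_append

theorem unary_cons_eq_append (n : ℕ) (l : List ℕ) : unary (n :: l) = unary [n] ++ unary l :=
  unary_append [n] l

theorem digitWord_cons_eq_append (ds : List (Option Bool)) (team : List (List (Option Bool))) :
    digitWord (ds :: team) = digitWord team ++ digitWord [ds] := by
  simp [digitWord]

theorem rel_players {s u : Store} (h : Rel (playerP∗) s u) :
    ∃ (team : List (List (Option Bool))) (x : List Γ') (sh : List Bool),
      s.x = team.flatMap (encList encDigit) ++ x ∧ s.sh = unary (team.map List.length) ++ sh ∧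
      (∀ ds ∈ team, ∃ b, some b ∈ ds) ∧
      u = { s with x := x, sh := sh, st := (unary (team.map List.length)).reverse ++ s.st,
                   dg := digitWord team ++ s.dg } := by
  refine rel_kstar_induction (fun s => ⟨[], s.x, s.sh, rfl, rfl, by simp, rfl⟩) ?_ h
  clear h s u
  rintro s t u h ⟨team, x, sh, hx, hsh, hb, rfl⟩
  obtain ⟨ds, x', sh', hx', hsh', hb', rfl⟩ := rel_player h
  dsimp only at hx hsh
  subst hx hsh
  refine ⟨ds :: team, x, sh, by simp [hx'], ?_, ?_, ?_⟩
  · rw [hsh', List.map_cons, unary_cons_eq_append _ (team.map _), List.append_assoc]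
  · intro d hd
    rcases List.mem_cons.1 hd with rfl | h
    · exact hb'
    · exact hb d h
  · ext1 <;> try rfl
    · dsimp only
      rw [List.map_cons, unary_cons_eq_append ds.length (team.map _), List.reverse_append,
        List.append_assoc]
    · dsimp only
      rw [digitWord_cons_eq_append ds team, List.append_assoc]

theorem exec_players (team : List (List (Option Bool))) {s : Store} {x : List Γ'} {sh : List Bool}
    (hx : s.x = team.flatMap (encList encDigit) ++ x)
    (hsh : s.sh = unary (team.map List.length) ++ sh) (hb : ∀ ds ∈ team, ∃ b, some b ∈ ds) :
    Exec (4 * (team.flatMap (encList encDigit)).length) (playerP∗) s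
      { s with x := x, sh := sh, st := (unary (team.map List.length)).reverse ++ s.st,
               dg := digitWord team ++ s.dg } := by
  induction team generalizing s with
  | nil =>
    obtain rfl : s.x = x := hx
    obtain rfl : s.sh = sh := hsh
    exact Exec.kstar_nil _ _
  | cons ds team ih =>
    rw [List.flatMap_cons, List.append_assoc] at hx
    rw [List.map_cons, unary_cons_eq_append, List.append_assoc] at hsh
    have h1 := exec_player ds hx hsh (hb ds (by simp))
    have h2 := Exec.kstar_cons h1 (ih rfl rfl fun d hd => hb d (by simp [hd]))
    refine h2.of_eq ?_ (by rw [List.flatMap_cons, List.length_append]; omega)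
    ext1 <;> try rfl
    · dsimp only
      rw [List.map_cons, unary_cons_eq_append ds.length (team.map _), List.reverse_append,
        List.append_assoc]
    · dsimp only
      rw [digitWord_cons_eq_append ds team, List.append_assoc]

/-- The encoding of the available actions of all players. -/
def encAvail (opp : List Bool) (team : List (List (Option Bool))) : List Γ' :=
  .bra :: (encList encBit opp ++ team.flatMap (encList encDigit) ++ [.ket])

/-- The numbers of actions of the players. -/
def shape (opp : List Bool) (team : List (List (Option Bool))) : List Bool :=
  unary (opp.length :: team.map List.length)

/-- Every mark of the guessed numbers of actions can be charged to a symbol of the input, so this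
guess has at most linear length. -/
theorem length_shape_le (opp : List Bool) (team : List (List (Option Bool))) :
    (shape opp team).length ≤ (encAvail opp team).length := by
  have h : ∀ team : List (List (Option Bool)), (unary (team.map List.length)).length ≤
      (team.flatMap (encList encDigit)).length := fun team => by
    induction team with
    | nil => simp [unary]
    | cons ds team ih =>
      rw [List.map_cons, unary_cons_eq_append, List.flatMap_cons, List.length_append,
        List.length_append]
      have : (unary [ds.length]).length ≤ (encList encDigit ds).length := by
        simp [unary, encList, encDigit, encBit]
      omega
  have h1 := h team
  have h2 : (unary [opp.length]).length ≤ (encList encBit opp).length := by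
    simp [unary, encList, encBit]
  rw [shape, unary_cons_eq_append, encAvail]
  simp only [List.length_append, List.length_cons]
  omega

/-- The numbers of actions on `sh` are guessed once, compared with the input and then put back. As
every state is compared with the same guess, all states agree on the number of players and on their
numbers of actions. -/
theorem rel_avail {s u : Store} (hst : s.st = []) (h : Rel availP s u) :
    ∃ (opp : List Bool) (team : List (List (Option Bool))) (x : List Γ'),
      s.x = encAvail opp team ++ x ∧ s.sh = shape opp team ∧ true ∈ opp ∧
      (∀ ds ∈ team, ∃ b, some b ∈ ds) ∧
      u = { s with x := x, o := List.replicate (opp.count true) () ++ s.o,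
                   dg := digitWord team ++ s.dg } := by
  simp only [availP, rel_seq, rel_pop, rel_empty, Store.get_x, Store.set_x, Store.get_sh,
    Store.get_st] at h
  obtain ⟨_, ⟨x₁, hx₁, rfl⟩, _, h₂, _, h₃, _, ⟨x₄, hx₄, rfl⟩, _, ⟨hsh₄, rfl⟩, _, h₅, hst₅, rfl⟩ := h
  obtain ⟨opp, x₂, sh₂, hx₂, hsh₂, hb₂, rfl⟩ := rel_opp h₂
  obtain ⟨team, x₃, sh₃, hx₃, hsh₃, hb₃, rfl⟩ := rel_players h₃
  obtain ⟨cs, l, hcs, rfl⟩ := rel_move (k := .st) (k₁ := .sh) (by decide) h₅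
  dsimp only [Store.get_st, Store.set_st, Store.set_sh, Store.get_sh] at *
  subst hst₅ hsh₄ hx₄ hx₃ hsh₃ hx₂
  have hsh : s.sh = shape opp team := by
    rw [hsh₂, shape, unary_cons_eq_append _ (team.map _), List.append_nil]
  refine ⟨opp, team, x₄, by simp [hx₁, encAvail], hsh, hb₂, hb₃, ?_⟩
  have hcs' : cs = (shape opp team).reverse := by
    rw [shape, unary_cons_eq_append _ (team.map _), List.reverse_append]
    simpa [hst] using hcs.symm
  ext1 <;> try rfl
  · simp [hsh, hcs']
  · exact hst.symm

theorem exec_avail {s : Store} (hst : s.st = []) {opp : List Bool}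
    {team : List (List (Option Bool))} {x : List Γ'} (hx : s.x = encAvail opp team ++ x)
    (hsh : s.sh = shape opp team) (hopp : true ∈ opp) (hteam : ∀ ds ∈ team, ∃ b, some b ∈ ds) :
    Exec (6 * (encAvail opp team).length) availP s
      { s with x := x, o := List.replicate (opp.count true) () ++ s.o,
               dg := digitWord team ++ s.dg } := by
  have h1 := Exec.pop (k := .x) (s := s) (a := .bra) (l := encList encBit opp ++
    (team.flatMap (encList encDigit) ++ .ket :: x)) (by simp [hx, encAvail])
  have h2 := exec_opp opp (x := team.flatMap (encList encDigit) ++ .ket :: x)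
    (sh := unary (team.map List.length)) (s := s.set .x (encList encBit opp ++
    (team.flatMap (encList encDigit) ++ .ket :: x))) rfl
    (by rw [Store.set_x, hsh, shape, unary_cons_eq_append]) hopp
  have h3 := exec_players team (x := .ket :: x) (sh := []) (s := { s with
    x := team.flatMap (encList encDigit) ++ .ket :: x, sh := unary (team.map List.length)
    st := (unary [opp.length]).reverse ++ s.st, o := List.replicate (opp.count true) () ++ s.o })
    rfl (by simp) hteam
  have h4 := exec_move (k := .st) (k₁ := .sh) (a := id) (b := id) (by decide)
    (shape opp team).reverse (s := { s with x := x, sh := []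
                                            st := (unary (team.map List.length)).reverse ++
                                              ((unary [opp.length]).reverse ++ s.st)
                                            o := List.replicate (opp.count true) () ++ s.o
                                            dg := digitWord team ++ s.dg }) (l := [])
    (by
      rw [shape, unary_cons_eq_append _ (team.map _), List.reverse_append]
      simp [hst])
  have h5 := h1.seq (h2.seq (h3.seq ((Exec.pop (k := .x) (l := x) rfl).seq
    ((Exec.empty (k := .sh) rfl).seq (h4.seq (Exec.empty (k := .st) rfl))))))
  have l1 := length_shape_le opp team
  refine h5.of_eq ?_ ?_
  · ext1 <;> try rfl
    · simp [hsh]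
    · exact hst.symm
  · simp only [encAvail, List.length_append, List.length_cons, List.length_nil,
      List.length_reverse] at l1 ⊢
    omega

/-! ### Computing the supports -/

/-- For all tuples of available actions of the team, in lexicographic order, whether all actions
are in the supports. -/
def mask : List (List (Option Bool)) → List Bool
  | [] => [true]
  | ds :: team => ds.reduceOption.flatMap fun b => (mask team).map fun a => b && a

/-- The effect of one symbol on the part of the mask that is computed. -/
def maskStep (p : List Bool × List Bool) : Option (Option Bool) → List Bool × List Bool
  | none => (p.2, [])
  | some none => p
  | some (some b) => (p.1, p.1.map (fun a => b && a) ++ p.2)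

/-- The actions of a player come off the stack from last to first. The first component is the mask
of the later players; for each available action a copy of it, cut down by the bit of the action, is
put in front of what has been accumulated, so the blocks end up in increasing order. -/
theorem foldl_maskStep_digits (ds : List (Option Bool)) (cur acc : List Bool) :
    (ds.map some).reverse.foldl maskStep (cur, acc) =
      (cur, (ds.reduceOption.flatMap fun b => cur.map fun a => b && a) ++ acc) := by
  induction ds with
  | nil => rfl
  | cons d ds ih =>
    rw [List.map_cons, List.reverse_cons, List.foldl_append, ih]
    cases d with
    | none => rfl
    | some b => simp [maskStep, List.reduceOption_cons_of_some]

/-- The stack yields the last player first, in agreement with the recursion of `mask`, which needs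
the mask of the later players. The separator of a player turns the accumulated list into the current
mask. -/
theorem foldl_maskStep_digitWord (team : List (List (Option Bool))) :
    (digitWord team).foldl maskStep ([true], []) = (mask team, []) := by
  induction team with
  | nil => rfl
  | cons ds team ih =>
    rw [digitWord_cons, List.foldl_append, ih, List.foldl_append, foldl_maskStep_digits]
    simp [maskStep, mask]

/-- The current mask is stored reversed on `mt` and the accumulated one in order on `mp`; moving
symbols from the former to the latter then puts a block in front in the right order. The copy on `m`
serves to restore `mt`. -/
theorem rel_maskStep {d : Option (Option Bool)} {s u : Store} (hm : s.m = [])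
    (h : Rel (maskStepP d) s u) :
    u = { s with mt := (maskStep (s.mt.reverse, s.mp) d).1.reverse
                 mp := (maskStep (s.mt.reverse, s.mp) d).2 } := by
  rcases d with _ | _ | b
  · simp only [maskStepP, rel_seq, rel_empty] at h
    obtain ⟨_, h₁, _, ⟨hmt, rfl⟩, _, h₂, hmp, rfl⟩ := h
    obtain ⟨cs, l, hcs, rfl⟩ := rel_pops (k := .mt) h₁
    obtain ⟨cs', l', hcs', rfl⟩ := rel_move (k := .mp) (k₁ := .mt) (by decide) h₂
    dsimp only [Store.get_mt, Store.set_mt, Store.get_mp, Store.set_mp] at *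
    subst hmt hmp
    ext1 <;> try rfl
    simpa [maskStep] using hcs'.symm
  · simp only [maskStepP, rel_one] at h
    subst h
    ext1 <;> simp [maskStep]
  · simp only [maskStepP, rel_seq, rel_empty] at h
    obtain ⟨_, h₁, _, ⟨hmt, rfl⟩, _, h₂, hm', rfl⟩ := h
    obtain ⟨cs, l, hcs, rfl⟩ :=
      rel_move₂ (k := .mt) (k₁ := .m) (k₂ := .mp) (by decide) (by decide) (by decide) h₁
    obtain ⟨cs', l', hcs', rfl⟩ := rel_move (k := .m) (k₁ := .mt) (by decide) h₂
    dsimp only [Store.get_mt, Store.set_mt, Store.get_mp, Store.set_mp, Store.get_m,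
      Store.set_m] at *
    subst hmt hm'
    rw [List.map_id, List.append_nil] at hcs
    subst hcs
    rw [List.map_id, List.map_id, List.append_nil, hm, List.append_nil] at hcs'
    subst hcs'
    ext1 <;> try rfl
    · exact hm.symm
    · simp [maskStep]
    · simp [maskStep]

theorem exec_maskStep {d : Option (Option Bool)} {s : Store} (hm : s.m = []) :
    Exec (5 * s.mt.length + 2 * s.mp.length + 2) (maskStepP d) s
      { s with mt := (maskStep (s.mt.reverse, s.mp) d).1.reverse
               mp := (maskStep (s.mt.reverse, s.mp) d).2 } := by
  rcases d with _ | _ | b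
  · have h1 := exec_pops (k := .mt) (a := id) s.mt (s := s) (l := []) (by simp)
    have h2 := exec_move (k := .mp) (k₁ := .mt) (a := id) (b := id) (by decide) s.mp
      (s := { s with mt := [] }) (l := []) (by simp)
    have h3 := h1.seq ((Exec.empty (k := .mt) rfl).seq (h2.seq (Exec.empty (k := .mp) rfl)))
    refine h3.of_eq ?_ (by omega)
    ext1 <;> try rfl
    simp [maskStep]
  · refine (Exec.one s).of_eq ?_ (by omega)
    ext1 <;> simp [maskStep]
  · have h1 := exec_move₂ (k := .mt) (k₁ := .m) (k₂ := .mp) (a := id) (b₁ := id)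
      (b₂ := fun a => b && a) (by decide) (by decide) (by decide) s.mt (s := s) (l := []) (by simp)
    have h2 := exec_move (k := .m) (k₁ := .mt) (a := id) (b := id) (by decide) s.mt.reverse
      (s := { s with mt := [], m := (s.mt.map id).reverse ++ s.m
                     mp := (s.mt.map fun a => b && a).reverse ++ s.mp }) (l := []) (by simp [hm])
    have h3 := h1.seq ((Exec.empty (k := .mt) rfl).seq (h2.seq (Exec.empty (k := .m) rfl)))
    refine h3.of_eq ?_ (by rw [List.length_reverse]; omega)
    ext1 <;> try rfl
    · exact hm.symm
    · simp [maskStep]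
    · simp [maskStep]

theorem rel_mask {s u : Store} (hm : s.m = []) (hmt : s.mt = []) (hmp : s.mp = [])
    {team : List (List (Option Bool))} (hdg : s.dg = digitWord team) (h : Rel maskP s u) :
    u = { s with dg := [], mt := (mask team).reverse } := by
  have hloop : ∀ s u, Rel ((⨆ d, popP .dg d ⨾ maskStepP d)∗) s u → s.m = [] →
      ∃ w dg, s.dg = w ++ dg ∧
      u = { s with dg := dg, mt := (w.foldl maskStep (s.mt.reverse, s.mp)).1.reverse
                   mp := (w.foldl maskStep (s.mt.reverse, s.mp)).2 } := by
    intro s u h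
    refine rel_kstar_induction (fun s _ => ⟨[], s.dg, rfl, by simp⟩) ?_ h
    clear h hm hmt hmp hdg s u
    intro s t u h ih hm
    simp only [rel_iSup, rel_seq, rel_pop, Store.get_dg, Store.set_dg] at h
    obtain ⟨d, _, ⟨dg', hdg, rfl⟩, h⟩ := h
    obtain rfl := rel_maskStep (by exact hm) h
    obtain ⟨w, dg, hw, rfl⟩ := ih hm
    dsimp only at hw
    subst hw
    exact ⟨d :: w, dg, hdg, by simp⟩
  simp only [maskP, rel_seq, rel_push, rel_empty, Store.get_mt, Store.set_mt, Store.get_dg] at h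
  obtain ⟨_, rfl, _, h, hdg', rfl⟩ := h
  obtain ⟨w, dg, hw, rfl⟩ := hloop _ _ h hm
  dsimp only at hw hdg'
  subst hdg'
  obtain rfl : digitWord team = w := by rw [← hdg, hw, List.append_nil]
  ext1 <;> try rfl
  · simp [hmt, hmp, foldl_maskStep_digitWord]
  · simp [hmt, hmp, foldl_maskStep_digitWord]

/-- The head of `ds` is treated last, hence the induction appends a step at the end of the loop. The
partial masks only grow, so a bound on the final lengths bounds every step. -/
theorem exec_maskDigits (ds : List (Option Bool)) {s : Store} (hm : s.m = [])
    {dg : List (Option (Option Bool))} (hdg : s.dg = (ds.map some).reverse ++ dg) {B : ℕ}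
    (hmt : s.mt.length ≤ B)
    (hmp : (ds.reduceOption.flatMap fun b => s.mt.reverse.map fun a => b && a).length +
      s.mp.length ≤ B) :
    Exec ((7 * B + 3) * ds.length) ((⨆ d, popP .dg d ⨾ maskStepP d)∗) s
      { s with
        dg := dg
        mp := (ds.reduceOption.flatMap fun b => s.mt.reverse.map fun a => b && a) ++ s.mp } := by
  induction ds generalizing dg with
  | nil =>
    obtain rfl : s.dg = dg := hdg
    exact Exec.kstar_nil _ _
  | cons d ds ih =>
    rw [List.map_cons, List.reverse_cons, List.append_assoc] at hdg
    have hle : (ds.reduceOption.flatMap fun b => s.mt.reverse.map fun a => b && a).length +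
        s.mp.length ≤ B := by
      refine le_trans ?_ hmp
      cases d with
      | none => exact le_rfl
      | some b =>
        rw [List.reduceOption_cons_of_some, List.flatMap_cons, List.length_append]
        omega
    have h1 := ih hdg hle
    have h2 := exec_maskStep (d := some d) (s := { s with
      dg := dg
      mp := (ds.reduceOption.flatMap fun b => s.mt.reverse.map fun a => b && a) ++ s.mp }) hm
    have h3 := h1.kstar_snoc (Exec.iSup (L := fun d => popP .dg d ⨾ maskStepP d) (some d)
      ((Exec.pop (k := .dg) (l := dg) rfl).seq h2))
    refine h3.of_eq ?_ ?_
    · cases d with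
      | none => ext1 <;> simp [maskStep]
      | some b => ext1 <;> simp [maskStep, List.reduceOption_cons_of_some]
    · rw [List.length_cons, Nat.mul_succ]
      simp only [List.length_append]
      omega

/-- A player with an available action cannot shorten the mask, so every intermediate mask is at most
as long as the final one. This keeps the computation polynomial although masks are products over the
players. -/
theorem length_mask_le {ds : List (Option Bool)} (hds : ∃ b, some b ∈ ds)
    (team : List (List (Option Bool))) : (mask team).length ≤ (mask (ds :: team)).length := by
  obtain ⟨b, hb⟩ := hds
  obtain ⟨l, l', hl⟩ := List.append_of_mem (List.reduceOption_mem_iff.2 hb)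
  simp only [mask, hl, List.flatMap_append, List.flatMap_cons, List.length_append,
    List.length_map]
  omega

theorem exec_maskTeam (team : List (List (Option Bool))) (hteam : ∀ ds ∈ team, ∃ b, some b ∈ ds)
    {s : Store} (hm : s.m = []) (hmt : s.mt = [true]) (hmp : s.mp = [])
    {dg : List (Option (Option Bool))} (hdg : s.dg = digitWord team ++ dg) {B : ℕ}
    (hB : (mask team).length ≤ B) :
    Exec ((7 * B + 3) * (digitWord team).length) ((⨆ d, popP .dg d ⨾ maskStepP d)∗) s
      { s with dg := dg, mt := (mask team).reverse } := by
  induction team generalizing dg with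
  | nil =>
    obtain rfl : s.dg = dg := hdg
    refine (Exec.kstar_nil _ _).of_eq ?_ (by simp)
    ext1 <;> first | rfl | exact hmt
  | cons ds team ih =>
    rw [digitWord_cons, List.append_assoc, List.append_assoc] at hdg
    have hB' := (length_mask_le (hteam ds (by simp)) team).trans hB
    have h1 := ih (fun d hd => hteam d (by simp [hd])) hdg hB'
    have h2 := exec_maskDigits ds (s := { s with
      dg := (ds.map some).reverse ++ ([none] ++ dg), mt := (mask team).reverse }) hm rfl (B := B)
      (by simpa using hB') (by simpa [hmp, mask] using hB)
    have h3 := exec_maskStep (d := none) (s := { s with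
      dg := dg, mt := (mask team).reverse
      mp := (ds.reduceOption.flatMap fun b => (mask team).reverse.reverse.map fun a => b && a) ++
        s.mp }) hm
    have h4 : ∀ {n n' : ℕ} {L : Prog} {s t u : Store}, Exec n (L∗) s t → Exec n' (L∗) t u →
        Exec (n + n') (L∗) s u := by
      intro n n' L s t u h h'
      obtain ⟨l, hl, hn, h1⟩ := h.seq h'
      refine ⟨l, ?_, hn, h1⟩
      rw [seqP, kstar_mul_kstar] at hl
      exact hl
    have h5 := (h4 h1 h2).kstar_snoc (Exec.iSup (L := fun d => popP .dg d ⨾ maskStepP d) none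
      ((Exec.pop (k := .dg) (l := dg) rfl).seq h3))
    refine h5.of_eq ?_ ?_
    · ext1 <;> first | rfl | simp [maskStep, mask, hmp]
    · have e : ((ds.reduceOption.flatMap fun b => (mask team).reverse.reverse.map fun a =>
          b && a) ++ s.mp).length ≤ B := by simpa [hmp, mask] using hB
      have e' : ((mask team).reverse).length ≤ B := by simpa using hB'
      have e'' : (digitWord (ds :: team)).length =
          (digitWord team).length + ds.length + 1 := by simp [digitWord_cons]; omega
      rw [e'', Nat.mul_add, Nat.mul_add]
      dsimp only
      omega

theorem exec_mask {s : Store} (hm : s.m = []) (hmt : s.mt = []) (hmp : s.mp = [])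
    {team : List (List (Option Bool))} (hteam : ∀ ds ∈ team, ∃ b, some b ∈ ds)
    (hdg : s.dg = digitWord team) {B : ℕ} (hB : (mask team).length ≤ B) :
    Exec ((7 * B + 3) * (digitWord team).length + 2) maskP s
      { s with dg := [], mt := (mask team).reverse } := by
  have h1 := exec_maskTeam team hteam (s := { s with mt := true :: s.mt }) hm (by simp [hmt]) hmp
    (dg := []) (by simp [hdg]) hB
  exact ((Exec.push .mt true s).seq (h1.seq (Exec.empty (k := .dg) rfl))).mono (by omega)

/-! ### Moving on to the next state -/

/-- The records of the states, when the states with records `L` have been parsed and those with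
records `R` have not. -/
def track (L : List Core) : List Core → List Info
  | [] => L.map .pre
  | c :: R => L.map .pre ++ .cur c :: R.map .post

theorem length_track (L R : List Core) : (track L R).length = L.length + R.length := by
  cases R <;> simp [track]

/-- There is at most one symbol `cur`, so its position determines how the states are split into
parsed and unparsed ones. -/
theorem track_eq_append_cur {L R : List Core} {cs : List Core} {c : Core} {l : List Info}
    (h : track L R = cs.map .pre ++ .cur c :: l) :
    cs = L ∧ ∃ R', R = c :: R' ∧ l = R'.map .post := by
  have key : ∀ (L cs : List Core) (c c' : Core) (l l' : List Info),
      L.map Info.pre ++ .cur c' :: l' = cs.map .pre ++ .cur c :: l → cs = L ∧ c' = c ∧ l' = l := by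
    intro L
    induction L with
    | nil => intro cs c c' l l' h; cases cs <;> simp_all
    | cons a L ih =>
      intro cs c c' l l' h
      cases cs with
      | nil => simp at h
      | cons b cs =>
        simp only [List.map_cons, List.cons_append, List.cons.injEq, Info.pre.injEq] at h
        obtain ⟨rfl, h1, h2⟩ := ih _ _ _ _ _ h.2
        exact ⟨by rw [h.1], h1, h2⟩
  cases R with
  | nil =>
    have : Info.cur c ∈ track L [] := by rw [h]; simp
    simp [track] at this
  | cons c' R =>
    obtain ⟨h1, rfl, h2⟩ := key _ _ _ _ _ _ h
    exact ⟨h1, R, rfl, h2.symm⟩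

theorem track_eq_map_pre {L R cs : List Core} (h : track L R = cs.map .pre) : R = [] ∧ L = cs := by
  cases R with
  | nil => exact ⟨rfl, List.map_injective_iff.2 (fun _ _ => Info.pre.inj) h⟩
  | cons c R =>
    have : Info.cur c ∈ cs.map Info.pre := by rw [← h]; simp [track]
    simp at this

/-- Popping `.cur md.before` compares the mode guessed for the state with its stored record. The
alternative that selects no next state survives `emptyP .i` only if no state is left. -/
theorem rel_advance {md : Mode} {s u : Store} (hj : s.j = []) {L R : List Core}
    (hi : s.i = track L R) (h : Rel (advanceP md) s u) :
    ∃ R', R = md.before :: R' ∧ u = { s with i := track (L ++ [md.after]) R' } := by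
  simp only [advanceP, rel_seq, rel_pop, rel_push, rel_empty, rel_add, rel_one, rel_iSup,
    Store.get_i, Store.set_i, Store.get_j, Store.set_j] at h
  obtain ⟨_, h₁, _, ⟨i₁, hi₁, rfl⟩, _, rfl, _, h₂, _, ⟨hi₂, rfl⟩, _, h₃, hj₃, rfl⟩ := h
  obtain ⟨cs, l, hcs, rfl⟩ := rel_move (k := .i) (k₁ := .j) (by decide) h₁
  obtain ⟨cs', l', hcs', rfl⟩ := rel_move (k := .j) (k₁ := .i) (by decide) h₃
  dsimp only [Store.get_i, Store.set_i, Store.get_j, Store.set_j] at *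
  subst hi₁ hj₃
  obtain ⟨rfl, R', rfl, rfl⟩ := track_eq_append_cur (hi.symm.trans hcs)
  refine ⟨R', rfl, ?_⟩
  rw [List.map_id, List.append_nil] at hcs'
  subst hcs'
  rcases h₂ with rfl | ⟨_, ⟨c, _, ⟨i₂, hi₄, rfl⟩, rfl⟩, h₄⟩
  · dsimp only at hi₂
    obtain rfl : R' = [] := by simpa using hi₂
    ext1 <;> first | rfl | exact hj.symm | simp [track, hj]
  · obtain ⟨cs', l', hcs', rfl⟩ := rel_move (k := .i) (k₁ := .j) (by decide) h₄
    dsimp only [Store.get_i, Store.set_i, Store.get_j, Store.set_j] at *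
    subst hi₂
    rw [List.append_nil] at hcs'
    subst hcs'
    cases R' with
    | nil => simp at hi₄
    | cons c' R' =>
      simp only [List.map_cons, List.cons.injEq, Info.post.injEq] at hi₄
      obtain ⟨rfl, hi₄⟩ := hi₄
      ext1 <;> first | rfl | exact hj.symm | simp [track, hj, hi₄]

theorem exec_advance {md : Mode} {s : Store} (hj : s.j = []) {L R : List Core}
    (hi : s.i = track L (md.before :: R)) :
    Exec (4 * s.i.length + 4) (advanceP md) s { s with i := track (L ++ [md.after]) R } := by
  have h1 := exec_move (k := .i) (k₁ := .j) (a := Info.pre) (b := Info.pre) (by decide) L (s := s)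
    (l := .cur md.before :: R.map .post) hi
  have h2 := Exec.pop (k := .i) (a := .cur md.before) (s := { s with
    i := .cur md.before :: R.map .post, j := (L.map .pre).reverse ++ s.j }) (l := R.map .post) rfl
  have h3 := Exec.push .j (.pre md.after) { s with
    i := R.map .post, j := (L.map .pre).reverse ++ s.j }
  have hlen : s.i.length = L.length + (R.length + 1) := by rw [hi, length_track]; rfl
  cases R with
  | nil =>
    have h4 := Exec.inl (M := (⨆ c, popP .i (.post c) ⨾ pushP .j (.cur c)) ⨾
      moveP (k := .i) (k₁ := .j) Info.post Info.post) (Exec.one { s with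
      i := [], j := .pre md.after :: ((L.map .pre).reverse ++ s.j) })
    have h5 := exec_move (k := .j) (k₁ := .i) (a := id) (b := id) (by decide)
      (.pre md.after :: ((L.map .pre).reverse)) (s := { s with
      i := [], j := .pre md.after :: ((L.map .pre).reverse ++ s.j) }) (l := []) (by simp [hj])
    have h6 := h1.seq (h2.seq (h3.seq (h4.seq ((Exec.empty (k := .i) rfl).seq
      (h5.seq (Exec.empty (k := .j) rfl))))))
    refine h6.of_eq ?_ ?_
    · ext1 <;> first | rfl | exact hj.symm | simp [track]
    · simp only [List.length_cons, List.length_reverse, List.length_map, List.length_nil] at hlen ⊢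
      omega
  | cons c R =>
    have h7 := exec_move (k := .i) (k₁ := .j) (a := Info.post) (b := Info.post) (by decide) R
      (s := { s with i := R.map .post
                     j := .cur c :: (.pre md.after :: ((L.map .pre).reverse ++ s.j)) })
      (l := []) (by simp)
    have h8 := (Exec.pop (k := .i) (a := .post c) (s := { s with
      i := .post c :: R.map .post, j := .pre md.after :: ((L.map .pre).reverse ++ s.j) })
      (l := R.map .post) rfl).seq (Exec.push .j (.cur c) _)
    have h4 := Exec.inr (L := 1)
      ((Exec.iSup (L := fun c => popP .i (.post c) ⨾ pushP .j (.cur c)) c h8).seq h7)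
    have h5 := exec_move (k := .j) (k₁ := .i) (a := id) (b := id) (by decide)
      ((R.map .post).reverse ++ (.cur c :: .pre md.after :: ((L.map .pre).reverse))) (s := { s with
      i := [], j := (R.map .post).reverse ++
        (.cur c :: (.pre md.after :: ((L.map .pre).reverse ++ s.j))) }) (l := []) (by simp [hj])
    have h6 := h1.seq (h2.seq (h3.seq (h4.seq ((Exec.empty (k := .i) rfl).seq
      (h5.seq (Exec.empty (k := .j) rfl))))))
    refine h6.of_eq ?_ ?_
    · ext1 <;> first | rfl | exact hj.symm | simp [track]
    · simp only [List.length_cons, List.length_reverse, List.length_map, List.length_append]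
        at hlen ⊢
      omega

/-! ### Reading the description of a state -/

/-- What the verifier reads and guesses about a state. -/
structure Rec : Type where
  md : Mode
  opp : List Bool
  team : List (List (Option Bool))
  blocks : List (List (Bool × List ℕ))

namespace Rec

/-- The encoding of the description of a state. -/
def enc (r : Rec) : List Γ' :=
  .bra :: .bit r.md.tgt :: .bit r.md.ini ::
    (encAvail r.opp r.team ++
      (encList (encList encNat) (r.blocks.flatten.map Prod.snd) ++ [.ket]))

/-- The description passes the checks of the verifier. -/
structure OK (sh : List Bool) (is : List Info) (r : Rec) : Prop where
  add_win : (!r.md.add || r.md.win) = true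
  shape_eq : sh = shape r.opp r.team
  opp_mem : true ∈ r.opp
  team_mem : ∀ ds ∈ r.team, ∃ b, some b ∈ ds
  length_blocks : r.blocks.length = r.opp.count true
  blocks_ok : ∀ rs ∈ r.blocks, BlockOK r.md (mask r.team) is rs

end Rec

/-- A store in which all auxiliary stacks are empty. -/
abbrev Store.idle (x0 x : List Γ') (i : List Info) (sh : List Bool) : Store :=
  { x0 := x0, x := x, i := i, sh := sh }

theorem rel_state {md : Mode} {x0 x : List Γ'} {L R : List Core} {sh : List Bool} {u : Store}
    (h : Rel (stateP md) (.idle x0 x (track L R) sh) u) :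
    ∃ (r : Rec) (x' : List Γ') (R' : List Core), r.md = md ∧ x = r.enc ++ x' ∧
      r.OK sh (track L R) ∧ R = md.before :: R' ∧
      u = .idle x0 x' (track (L ++ [md.after]) R') sh := by
  simp only [stateP, rel_seq, rel_pop, rel_guard, Store.get_x, Store.set_x] at h
  obtain ⟨_, ⟨hadd, rfl⟩, _, ⟨x₁, hx₁, rfl⟩, _, ⟨x₂, hx₂, rfl⟩, _, ⟨x₃, hx₃, rfl⟩, _, h₄, _, h₅, _, h₆,
    _, ⟨x₇, hx₇, rfl⟩, h₈⟩ := h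
  obtain ⟨opp, team, x₄, hx₄, hsh, hopp, hteam, rfl⟩ := rel_avail rfl h₄
  obtain rfl := rel_mask (team := team) rfl rfl rfl (by simp) h₅
  obtain ⟨bs, x₅, hx₅, hlen, hb, rfl⟩ := rel_rows rfl rfl h₆
  obtain ⟨R', rfl, rfl⟩ := rel_advance rfl rfl h₈
  dsimp only at *
  subst hx₇ hx₅ hx₄ hx₃ hx₂ hx₁
  refine ⟨⟨md, opp, team, bs⟩, x₇, R', rfl, by simp [Rec.enc],
    ⟨hadd, hsh, hopp, hteam, by simpa using hlen, by simpa using hb⟩, rfl, rfl⟩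

theorem length_digitWord_le (opp : List Bool) (team : List (List (Option Bool))) :
    (digitWord team).length ≤ (encAvail opp team).length := by
  have h : ∀ team : List (List (Option Bool)), (digitWord team).length ≤
      (team.flatMap (encList encDigit)).length := fun team => by
    induction team with
    | nil => simp [digitWord]
    | cons ds team ih =>
      rw [digitWord_cons, List.flatMap_cons, List.length_append, List.length_append (as := encList _ _)]
      have : ((ds.map some).reverse ++ [none]).length ≤ (encList encDigit ds).length := by
        simp [encList, encDigit, encBit]
      omega
  have := h team
  simp only [encAvail, List.length_cons, List.length_append]
  omega

theorem length_le_length_encList {α : Type} (enc : α → List Γ') (henc : ∀ a, enc a ≠ [])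
    (l : List α) : l.length ≤ (encList enc l).length := by
  have : l.length ≤ (l.flatMap enc).length := by
    induction l with
    | nil => simp
    | cons a l ih =>
      have := List.length_pos_of_ne_nil (henc a)
      rw [List.flatMap_cons, List.length_append, List.length_cons]
      omega
  simp only [encList, List.length_cons, List.length_append]
  omega

/-- The opponent has an available action, so there is at least one block, and it contains one row
per entry of the mask. The mask is therefore no longer than the input. -/
theorem Rec.OK.length_mask_le {sh : List Bool} {is : List Info} {r : Rec} (h : r.OK sh is) :
    (mask r.team).length ≤
      (encList (encList encNat) (r.blocks.flatten.map Prod.snd)).length := by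
  have hpos : 0 < r.blocks.length := by
    rw [h.length_blocks]
    exact List.count_pos_iff.2 h.opp_mem
  have hmem : r.blocks[0] ∈ r.blocks := List.getElem_mem hpos
  have h1 := (h.blocks_ok _ hmem).1
  have h2 : (r.blocks[0]).length ≤ r.blocks.flatten.length := by
    rw [List.length_flatten]
    exact List.single_le_sum (by simp) _ (List.mem_map_of_mem hmem)
  have h3 := length_le_length_encList (encList encNat) (fun _ => by simp [encList])
    (r.blocks.flatten.map Prod.snd)
  rw [List.length_map] at h3
  rw [← h1, List.length_map]
  omega

/-- All parts are linear in `N` except the computation of the mask, which spends a linear number of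
operations on each of at most `N` symbols of `dg`. -/
theorem exec_state {r : Rec} {x0 x : List Γ'} {L R : List Core} {sh : List Bool}
    (h : r.OK sh (track L (r.md.before :: R))) {N : ℕ} (hN : r.enc.length ≤ N)
    (hi : L.length + (R.length + 1) ≤ N) :
    Exec (25 * (N + 1) ^ 2) (stateP r.md) (.idle x0 (r.enc ++ x) (track L (r.md.before :: R)) sh)
      (.idle x0 x (track (L ++ [r.md.after]) R) sh) := by
  have hmask := h.length_mask_le
  have hdig := length_digitWord_le r.opp r.team
  have hcount : r.opp.count true ≤ (encAvail r.opp r.team).length := by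
    refine List.count_le_length.trans ?_
    have := length_le_length_encList encBit (fun _ => by simp [encBit]) r.opp
    simp only [encAvail, List.length_cons, List.length_append]
    omega
  have h4 := exec_avail (opp := r.opp) (team := r.team)
    (x := encList (encList encNat) (r.blocks.flatten.map Prod.snd) ++ .ket :: x)
    (s := .idle x0 (encAvail r.opp r.team ++ (encList (encList encNat)
      (r.blocks.flatten.map Prod.snd) ++ .ket :: x)) (track L (r.md.before :: R)) sh)
    rfl rfl h.shape_eq h.opp_mem h.team_mem
  have h5 := exec_mask (team := r.team) (B := N) (s := { Store.idle x0
    (encList (encList encNat) (r.blocks.flatten.map Prod.snd) ++ .ket :: x)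
    (track L (r.md.before :: R)) sh with
    o := List.replicate (r.opp.count true) () ++ []
    dg := digitWord r.team ++ [] }) rfl rfl rfl h.team_mem (by simp) (by
      simp only [Rec.enc, List.length_cons, List.length_append] at hN
      omega)
  have h6 := exec_rows (md := r.md) (bs := r.blocks) (x := .ket :: x) (s := { Store.idle x0
    (encList (encList encNat) (r.blocks.flatten.map Prod.snd) ++ .ket :: x)
    (track L (r.md.before :: R)) sh with
    o := List.replicate (r.opp.count true) () ++ []
    mt := (mask r.team).reverse }) rfl rfl rfl (by simp [h.length_blocks])
    (by simpa using h.blocks_ok)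
  have h8 := exec_advance (md := r.md) (s := .idle x0 x (track L (r.md.before :: R)) sh) rfl rfl
  have h9 := (Exec.guard h.add_win _).seq ((Exec.pop (k := .x) (a := .bra)
    (s := .idle x0 (r.enc ++ x) (track L (r.md.before :: R)) sh)
    (l := .bit r.md.tgt :: .bit r.md.ini :: (encAvail r.opp r.team ++ (encList (encList encNat)
      (r.blocks.flatten.map Prod.snd) ++ .ket :: x)))
    (by simp [Rec.enc])).seq ((Exec.pop (k := .x) (l := _) rfl).seq
    ((Exec.pop (k := .x) (l := _) rfl).seq (h4.seq (h5.seq (h6.seq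
      ((Exec.pop (k := .x) (l := x) rfl).seq h8)))))))
  refine h9.mono ?_
  simp only [Rec.enc, List.length_cons, List.length_append, List.length_nil] at hN
  have e1 : (7 * N + 3) * (digitWord r.team).length ≤ (7 * N + 3) * N :=
    Nat.mul_le_mul_left _ (by omega)
  have e2 : (7 * N + 3) * N = 7 * (N * N) + 3 * N := by ring
  have e3 : 25 * (N + 1) ^ 2 = 25 * (N * N) + 50 * N + 25 := by ring
  simp only [length_track, List.length_cons, List.length_append, List.length_replicate,
    List.length_nil, List.length_reverse]
  rw [e3]
  rw [e2] at e1
  omega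

/-! ### Reading the whole input -/

/-- The descriptions of all states pass the checks of the verifier. -/
def RoundOK (sh : List Bool) (rs : List Rec) : Prop :=
  ∀ rs₁ r rs₂, rs = rs₁ ++ r :: rs₂ →
    r.OK sh (track (rs₁.map fun r => r.md.after) ((r :: rs₂).map fun r => r.md.before))

theorem rel_states {x0 : List Γ'} (x : List Γ') (L R : List Core) {sh : List Bool} {u : Store}
    (h : Rel ((⨆ md, stateP md)∗) (.idle x0 x (track L R) sh) u) :
    ∃ (rs : List Rec) (x' : List Γ') (R' : List Core), x = rs.flatMap Rec.enc ++ x' ∧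
      R = rs.map (fun r => r.md.before) ++ R' ∧
      (∀ rs₁ r rs₂, rs = rs₁ ++ r :: rs₂ → r.OK sh (track (L ++ rs₁.map fun r => r.md.after)
        ((r :: rs₂).map (fun r => r.md.before) ++ R'))) ∧
      u = .idle x0 x' (track (L ++ rs.map fun r => r.md.after) R') sh := by
  generalize hs : Store.idle x0 x (track L R) sh = s at h
  revert x L R
  refine rel_kstar_induction (fun s x L R hs => ⟨[], x, R, rfl, rfl, by simp, by simp [← hs]⟩) ?_ h
  clear h s u
  rintro s t u h ih x L R rfl
  rw [rel_iSup] at h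
  obtain ⟨md, h⟩ := h
  obtain ⟨r, x', R', rfl, rfl, hr, rfl, rfl⟩ := rel_state h
  obtain ⟨rs, x'', R'', rfl, rfl, hrs, rfl⟩ := ih _ _ _ rfl
  refine ⟨r :: rs, x'', R'', by simp, by simp, ?_, by simp⟩
  intro rs₁ r' rs₂ h
  cases rs₁ with
  | nil =>
    simp only [List.nil_append, List.cons.injEq] at h
    obtain ⟨rfl, rfl⟩ := h
    simpa using hr
  | cons r'' rs₁ =>
    simp only [List.cons_append, List.cons.injEq] at h
    obtain ⟨rfl, rfl⟩ := h
    simpa using hrs rs₁ r' rs₂ rfl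

theorem exec_states {x0 x : List Γ'} {sh : List Bool} (rs : List Rec) {L : List Core}
    (h : ∀ rs₁ r rs₂, rs = rs₁ ++ r :: rs₂ → r.OK sh (track (L ++ rs₁.map fun r => r.md.after)
      ((r :: rs₂).map fun r => r.md.before)))
    {N : ℕ} (hN : (rs.flatMap Rec.enc).length ≤ N) (hi : L.length + rs.length ≤ N) :
    Exec (25 * (N + 1) ^ 2 * rs.length) ((⨆ md, stateP md)∗)
      (.idle x0 (rs.flatMap Rec.enc ++ x) (track L (rs.map fun r => r.md.before)) sh)
      (.idle x0 x (track (L ++ rs.map fun r => r.md.after) []) sh) := by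
  induction rs generalizing L with
  | nil =>
    refine (Exec.kstar_nil _ _).of_eq ?_ (by omega)
    simp
  | cons r rs ih =>
    rw [List.flatMap_cons, List.length_append] at hN
    rw [List.length_cons] at hi
    have h1 := exec_state (r := r) (x0 := x0) (x := rs.flatMap Rec.enc ++ x)
      (by simpa using h [] r rs rfl) (N := N) (by omega) (by simpa using hi)
    have h2 := ih (L := L ++ [r.md.after]) (fun rs₁ r' rs₂ e => by
      simpa using h (r :: rs₁) r' rs₂ (by simp [e])) (by omega) (by simp; omega)
    have h3 := Exec.kstar_cons (Exec.iSup r.md h1) h2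
    rw [List.flatMap_cons, List.append_assoc]
    refine h3.of_eq (by simp) ?_
    rw [List.length_cons, Nat.mul_succ]
    omega

/-- The renaming accepts only records marked `pre`, so a round can begin only if the preceding one
has passed all states. Selecting the first state excludes an empty list of states. -/
theorem rel_reset {x0 x : List Γ'} {i : List Info} {sh : List Bool} {u : Store}
    (h : Rel resetP (.idle x0 x i sh) u) :
    ∃ cs : List Core, i = cs.map .pre ∧ cs ≠ [] ∧ u = .idle x0 x (track [] cs) sh := by
  simp only [resetP, rel_seq, rel_pop, rel_push, rel_empty, rel_iSup, Store.get_i, Store.set_i,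
    Store.get_j] at h
  obtain ⟨_, h₁, _, ⟨hi₁, rfl⟩, _, h₂, _, ⟨hj₂, rfl⟩, c, _, ⟨i₃, hi₃, rfl⟩, rfl⟩ := h
  obtain ⟨cs, l, hcs, rfl⟩ := rel_move (k := .i) (k₁ := .j) (by decide) h₁
  obtain ⟨cs', l', hcs', rfl⟩ := rel_move (k := .j) (k₁ := .i) (by decide) h₂
  dsimp only [Store.get_i, Store.set_i, Store.get_j, Store.set_j] at *
  subst hi₁ hj₂
  rw [List.map_id, List.append_nil, List.append_nil] at hcs'
  subst hcs'
  rw [List.map_id, List.reverse_reverse, List.append_nil] at hi₃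
  cases cs with
  | nil => simp at hi₃
  | cons c' cs =>
    simp only [List.map_cons, List.cons.injEq, Info.post.injEq] at hi₃
    obtain ⟨rfl, rfl⟩ := hi₃
    exact ⟨c' :: cs, by simpa using hcs, by simp, rfl⟩

theorem exec_reset {x0 x : List Γ'} {cs : List Core} {sh : List Bool} (hcs : cs ≠ []) :
    Exec (4 * cs.length + 4) resetP (.idle x0 x (cs.map .pre) sh)
      (.idle x0 x (track [] cs) sh) := by
  cases cs with
  | nil => exact absurd rfl hcs
  | cons c cs =>
    have h1 := exec_move (k := .i) (k₁ := .j) (a := Info.pre) (b := Info.post) (by decide) (c :: cs)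
      (s := .idle x0 x ((c :: cs).map .pre) sh) (l := []) (by simp)
    have h2 := exec_move (k := .j) (k₁ := .i) (a := id) (b := id) (by decide)
      ((c :: cs).map Info.post).reverse
      (s := { Store.idle x0 x [] sh with j := ((c :: cs).map Info.post).reverse ++ [] }) (l := [])
      (by simp)
    have h3 := Exec.iSup (L := fun c => popP .i (.post c) ⨾ pushP .i (.cur c)) c
      ((Exec.pop (k := .i) (a := .post c) (s := .idle x0 x
        ((((c :: cs).map Info.post).reverse.map id).reverse ++ []) sh) (l := cs.map .post)
        (by simp)).seq (Exec.push .i (.cur c) _))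
    refine (h1.seq ((Exec.empty (k := .i) rfl).seq (h2.seq ((Exec.empty (k := .j) rfl).seq
      h3)))).of_eq rfl ?_
    simp only [List.length_reverse, List.length_map, List.length_cons]
    omega

/-- A round may run out of input with unparsed records `R` left over. The symbol `cur` among them
then blocks every later `resetP` and `finalP`, so nothing has to be known in that case. The input
lies reversed on `x0`, and moving it to `x` puts it in reading order. -/
theorem rel_round {x0 : List Γ'} {i : List Info} {sh : List Bool} {u : Store}
    (h : Rel roundP (.idle x0 [] i sh) u) :
    ∃ (rs : List Rec) (R : List Core), i = (rs.map (fun r => r.md.before) ++ R).map .pre ∧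
      x0.reverse = encList Rec.enc rs ∧ (R = [] → RoundOK sh rs) ∧
      u = .idle x0 [] (track (rs.map fun r => r.md.after) R) sh := by
  simp only [roundP, rel_seq, rel_pop, rel_empty, Store.get_x, Store.set_x, Store.get_x0,
    Store.get_xt] at h
  obtain ⟨_, h₁, _, ⟨hx0, rfl⟩, _, h₂, _, ⟨hxt, rfl⟩, _, h₃, _, ⟨x₄, hx₄, rfl⟩, _, h₅, _,
    ⟨x₆, hx₆, rfl⟩, hx, rfl⟩ := h
  obtain ⟨cs, l, hcs, rfl⟩ :=
    rel_move₂ (k := .x0) (k₁ := .xt) (k₂ := .x) (by decide) (by decide) (by decide) h₁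
  obtain ⟨cs', l', hcs', rfl⟩ := rel_move (k := .xt) (k₁ := .x0) (by decide) h₂
  dsimp only [Store.get_x, Store.set_x, Store.get_x0, Store.set_x0, Store.get_xt,
    Store.set_xt] at *
  subst hx0 hxt hx
  rw [List.map_id, List.append_nil] at hcs
  subst hcs
  rw [List.map_id, List.append_nil, List.map_id, List.append_nil] at hcs'
  subst hcs'
  rw [List.map_id, List.map_id, List.append_nil, List.append_nil, List.reverse_reverse] at h₃
  obtain ⟨cs, rfl, hcs, rfl⟩ := rel_reset h₃
  dsimp only at hx₄
  obtain ⟨rs, x', R', rfl, rfl, hrs, rfl⟩ := rel_states _ _ _ h₅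
  dsimp only at hx₆
  subst hx₆
  refine ⟨rs, R', rfl, by rw [hx₄, encList], ?_, rfl⟩
  rintro rfl rs₁ r rs₂ e
  simpa using hrs rs₁ r rs₂ e

/-- There are at most `x0.length` states, each read in quadratic time. Nonemptiness is needed
because `resetP` must find a first state. -/
theorem exec_round {x0 : List Γ'} {sh : List Bool} {rs : List Rec} (hrs : rs ≠ [])
    (hx0 : x0.reverse = encList Rec.enc rs) (h : RoundOK sh rs) :
    Exec (35 * (x0.length + 1) ^ 3) roundP
      (.idle x0 [] ((rs.map fun r => r.md.before).map .pre) sh)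
      (.idle x0 [] ((rs.map fun r => r.md.after).map .pre) sh) := by
  have hlen : (encList Rec.enc rs).length = x0.length := by rw [← hx0, List.length_reverse]
  have h1 := exec_move₂ (k := .x0) (k₁ := .xt) (k₂ := .x) (a := id) (b₁ := id) (b₂ := id)
    (by decide) (by decide) (by decide) x0
    (s := .idle x0 [] ((rs.map fun r => r.md.before).map .pre) sh) (l := []) (by simp)
  have h2 := exec_move (k := .xt) (k₁ := .x0) (a := id) (b := id) (by decide) x0.reverse
    (s := { Store.idle [] ((x0.map id).reverse ++ []) ((rs.map fun r => r.md.before).map .pre) sh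
            with xt := (x0.map id).reverse ++ [] }) (l := []) (by simp)
  have h3 := exec_reset (x0 := (x0.reverse.map id).reverse ++ []) (x := (x0.map id).reverse ++ [])
    (cs := rs.map fun r => r.md.before) (sh := sh) (by simpa using hrs)
  have hl := length_le_length_encList Rec.enc (fun _ => by simp [Rec.enc]) rs
  have h4 := exec_states (x0 := (x0.reverse.map id).reverse ++ []) (x := [.ket]) (sh := sh) rs
    (L := []) (fun rs₁ r rs₂ e => by simpa using h rs₁ r rs₂ e) (N := x0.length)
    (by simp only [encList, List.length_cons, List.length_append] at hlen; omega)
    (by simpa using hl.trans hlen.le)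
  have h5 := h1.seq ((Exec.empty (k := .x0) rfl).seq (h2.seq ((Exec.empty (k := .xt) rfl).seq
    (h3.seq ((Exec.pop (k := .x) (l := rs.flatMap Rec.enc ++ [.ket])
      (by simp only [List.map_id, List.append_nil]; exact hx0)).seq
    (h4.seq ((Exec.pop (k := .x) (l := []) rfl).seq (Exec.empty (k := .x) rfl))))))))
  refine h5.of_eq (by simp [track]) ?_
  rw [hlen] at hl
  rw [List.length_map, List.length_reverse]
  generalize x0.length = N at *
  have e1 : 25 * (N + 1) ^ 2 * rs.length ≤ 25 * (N + 1) ^ 2 * N := Nat.mul_le_mul_left _ hl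
  have e2 : 25 * (N + 1) ^ 2 * N + 10 * N + 10 ≤ 35 * (N + 1) ^ 3 := by nlinarith [sq_nonneg N]
  omega

/-! ### The behaviour of the verifier -/

/-- The verifier can change the records `cs` to `cs'` by reading the input `x` several times. -/
inductive Rounds (x : List Γ') (sh : List Bool) : ℕ → List Core → List Core → Prop
  | refl (cs : List Core) : Rounds x sh 0 cs cs
  | step {n : ℕ} {rs : List Rec} {cs : List Core} (hx : x = encList Rec.enc rs)
      (hrs : RoundOK sh rs) (h : Rounds x sh n (rs.map fun r => r.md.after) cs) :
      Rounds x sh (n + 1) (rs.map fun r => r.md.before) cs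

/-- The records that the verifier may guess. -/
def Initial (cs : List Core) : Prop :=
  ∃ l l' : List Bool, cs = l.map (fun w => ⟨false, w, false⟩) ++ ⟨true, true, false⟩ ::
    l'.map fun w => ⟨false, w, false⟩

/-- The verifier can accept the input `x` by reading it `n + 1` times. -/
def Accepts (n : ℕ) (x : List Γ') : Prop :=
  ∃ (sh : List Bool) (rs : List Rec) (cs : List Core), Initial (rs.map fun r => r.md.before) ∧
    x = encList Rec.enc rs ∧ RoundOK sh rs ∧ Rounds x sh n (rs.map fun r => r.md.after) cs ∧
    ∀ c ∈ cs, (!c.win || c.done) = true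

/-- Completeness of a round propagates backwards: if the records are completely parsed at the end,
then every round was complete, since an incomplete one could not have been followed by another. -/
theorem rel_rounds {x0 : List Γ'} (L R : List Core) {sh : List Bool} {u : Store}
    (h : Rel (roundP∗) (.idle x0 [] (track L R) sh) u) :
    ∃ L' R', u = .idle x0 [] (track L' R') sh ∧
      (R' = [] → R = [] ∧ ∃ n, Rounds x0.reverse sh n L L') := by
  generalize hs : Store.idle x0 [] (track L R) sh = s at h
  revert L R
  refine rel_kstar_induction (fun s L R hs => ⟨L, R, hs.symm, fun h => ⟨h, 0, .refl _⟩⟩) ?_ h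
  clear h s u
  rintro s t u h ih L R rfl
  obtain ⟨rs, R₁, hi, hx, hrs, rfl⟩ := rel_round h
  obtain ⟨L', R', rfl, h'⟩ := ih _ _ rfl
  refine ⟨L', R', rfl, fun hR' => ?_⟩
  obtain ⟨rfl, n, hn⟩ := h' hR'
  obtain ⟨rfl, rfl⟩ := track_eq_map_pre hi
  rw [List.append_nil]
  exact ⟨rfl, n + 1, .step hx (hrs rfl) hn⟩

theorem rel_guess {s u : Store} (h : Rel guessP s u) :
    ∃ l : List Bool, u = { s with i := (l.map fun w => .pre ⟨false, w, false⟩) ++ s.i } := by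
  refine rel_kstar_induction (fun s => ⟨[], rfl⟩) ?_ h
  clear h s u
  rintro s t u h ⟨l, rfl⟩
  simp only [rel_iSup, rel_push, Store.get_i, Store.set_i] at h
  obtain ⟨w, rfl⟩ := h
  exact ⟨l ++ [w], by simp⟩

theorem exec_guess (l : List Bool) (s : Store) :
    Exec l.length guessP s { s with i := (l.map fun w => .pre ⟨false, w, false⟩) ++ s.i } := by
  induction l with
  | nil => exact Exec.kstar_nil _ _
  | cons w l ih =>
    have h := Exec.kstar_snoc ih (Exec.iSup (L := fun w => pushP .i (.pre ⟨false, w, false⟩)) w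
      (Exec.push .i (.pre ⟨false, w, false⟩) _))
    exact h

theorem rel_pushes {s u : Store} (h : Rel ((⨆ b, pushP .sh b)∗) s u) :
    ∃ l : List Bool, u = { s with sh := l ++ s.sh } := by
  refine rel_kstar_induction (fun s => ⟨[], rfl⟩) ?_ h
  clear h s u
  rintro s t u h ⟨l, rfl⟩
  simp only [rel_iSup, rel_push, Store.get_sh, Store.set_sh] at h
  obtain ⟨w, rfl⟩ := h
  exact ⟨l ++ [w], by simp⟩

theorem exec_pushes (l : List Bool) (s : Store) :
    Exec l.length ((⨆ b, pushP .sh b)∗) s { s with sh := l ++ s.sh } := by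
  induction l with
  | nil => exact Exec.kstar_nil _ _
  | cons w l ih =>
    have h := Exec.kstar_snoc ih (Exec.iSup (L := fun w => pushP .sh w) w (Exec.push .sh w _))
    exact h

theorem rel_final {s u : Store} (h : Rel finalP s u) :
    ∃ cs : List Core, s.i = cs.map .pre ∧ ∀ c ∈ cs, (!c.win || c.done) = true := by
  simp only [finalP, rel_seq, rel_empty, Store.get_i] at h
  obtain ⟨t, h, hi, rfl⟩ := h
  have key : ∃ cs : List Core, s.i = cs.map .pre ++ u.i ∧
      ∀ c ∈ cs, (!c.win || c.done) = true := by
    clear hi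
    refine rel_kstar_induction (fun s => ⟨[], rfl, by simp⟩) ?_ h
    clear h s u
    rintro s t u h ⟨cs, hi, hcs⟩
    simp only [rel_iSup, rel_seq, rel_guard, rel_pop, Store.get_i, Store.set_i] at h
    obtain ⟨c, _, ⟨hc, rfl⟩, i, hi', rfl⟩ := h
    dsimp only at hi
    subst hi
    refine ⟨c :: cs, by simp [hi'], fun c' hc' => ?_⟩
    rcases List.mem_cons.1 hc' with rfl | h
    · exact hc
    · exact hcs _ h
  obtain ⟨cs, h1, h2⟩ := key
  exact ⟨cs, by rw [h1, hi, List.append_nil], h2⟩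

theorem exec_final (cs : List Core) {s : Store} (hi : s.i = cs.map .pre)
    (hcs : ∀ c ∈ cs, (!c.win || c.done) = true) :
    Exec (cs.length + 1) finalP s { s with i := [] } := by
  have key : Exec cs.length ((⨆ c : Core, guardP (!c.win || c.done) ⨾ popP .i (.pre c))∗) s
      { s with i := [] } := by
    induction cs generalizing s with
    | nil =>
      have h : s.i = [] := hi
      rw [← h]
      exact Exec.kstar_nil _ _
    | cons c cs ih =>
      have h1 := (Exec.guard (hcs c (by simp)) s).seq (Exec.pop (k := .i) hi)
      exact (Exec.kstar_cons (Exec.iSup (L := fun c : Core =>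
        guardP (!c.win || c.done) ⨾ popP .i (.pre c)) c h1)
        (ih (s := { s with i := cs.map .pre }) rfl fun c hc => hcs c (by simp [hc]))).mono
        (by simp; omega)
  exact key.seq (Exec.empty (k := .i) rfl)

theorem accepts_of_rel {x0 : List Γ'} {u : Store} (h : Rel verifierP { x0 := x0 } u) :
    ∃ n, Accepts n x0.reverse := by
  simp only [verifierP, rel_seq, rel_push] at h
  obtain ⟨_, h₁, _, rfl, _, h₂, _, h₃, _, h₄, _, h₅, h₆⟩ := h
  obtain ⟨l, rfl⟩ := rel_guess h₁
  obtain ⟨l', rfl⟩ := rel_guess h₂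
  obtain ⟨sh, rfl⟩ := rel_pushes h₃
  dsimp only [Store.get_i, Store.set_i] at *
  obtain ⟨rs, R, hi, hx, hrs, rfl⟩ := rel_round (x0 := x0) h₄
  obtain ⟨L', R', rfl, hL'⟩ := rel_rounds _ _ h₅
  obtain ⟨cs, hcs, hfin⟩ := rel_final h₆
  obtain ⟨rfl, rfl⟩ := track_eq_map_pre hcs
  obtain ⟨rfl, n, hn⟩ := hL' rfl
  rw [List.append_nil] at hi
  -- The guesses are pushed, so those made second lie on top and describe the states before the
  -- initial one.
  refine ⟨n, sh ++ [], rs, L', ⟨l', l, List.map_injective_iff.2 (fun _ _ => Info.pre.inj) ?_⟩, hx,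
    hrs rfl, hn, hfin⟩
  refine Eq.trans (by rw [List.append_nil]) (hi.symm.trans ?_)
  simp [comp_def]

theorem exec_rounds {x0 : List Γ'} {sh : List Bool} {n : ℕ} {cs cs' : List Core} (hcs : cs ≠ [])
    (h : Rounds x0.reverse sh n cs cs') :
    Exec (35 * (x0.length + 1) ^ 3 * n) (roundP∗) (.idle x0 [] (cs.map .pre) sh)
      (.idle x0 [] (cs'.map .pre) sh) := by
  generalize hx : x0.reverse = x at h
  induction h with
  | refl cs => exact Exec.kstar_nil _ _
  | step hx' hrs _ ih =>
    refine (Exec.kstar_cons (exec_round (by simpa using hcs) (hx.trans hx') hrs)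
      (ih (by simpa using hcs))).mono ?_
    rw [Nat.mul_succ]
    omega

theorem Rounds.length_eq {x : List Γ'} {sh : List Bool} {n : ℕ} {cs cs' : List Core}
    (h : Rounds x sh n cs cs') : cs'.length = cs.length := by
  induction h with
  | refl => rfl
  | step _ _ _ ih => rw [ih, List.length_map, List.length_map]

theorem exec_of_accepts {x0 : List Γ'} {n : ℕ} (h : Accepts n x0.reverse) :
    ∃ u, Exec (35 * (x0.length + 1) ^ 3 * (n + 1) + 3 * x0.length + 1) verifierP { x0 := x0 } u := by
  obtain ⟨sh, rs, cs, ⟨l', l, hl⟩, hx, hrs, hn, hfin⟩ := h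
  have hne : rs ≠ [] := by
    rintro rfl
    simp at hl
  have h1 := exec_guess l { x0 := x0 }
  have h2 := Exec.push .i (.pre ⟨true, true, false⟩) {
    x0 := x0
    i := (l.map fun w => .pre ⟨false, w, false⟩) ++ [] }
  have h3 := exec_guess l' {
    x0 := x0
    i := .pre ⟨true, true, false⟩ :: ((l.map fun w => .pre ⟨false, w, false⟩) ++ []) }
  have h4 := exec_pushes sh { x0 := x0, i := (l'.map fun w => .pre ⟨false, w, false⟩) ++
    (.pre ⟨true, true, false⟩ :: ((l.map fun w => .pre ⟨false, w, false⟩) ++ [])) }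
  have h5 := exec_round (x0 := x0) hne hx hrs
  have h6 := exec_rounds (x0 := x0) (by simpa using hne) hn
  have h7 := exec_final cs (s := .idle x0 [] (cs.map .pre) sh) rfl hfin
  have h4' : Exec sh.length ((⨆ b, pushP .sh b)∗) { x0 := x0, i := (l'.map fun w =>
      .pre ⟨false, w, false⟩) ++ (.pre ⟨true, true, false⟩ ::
        ((l.map fun w => .pre ⟨false, w, false⟩) ++ [])) }
      (.idle x0 [] ((rs.map fun r => r.md.before).map .pre) sh) := by
    refine h4.of_eq ?_ le_rfl
    rw [hl]
    ext1 <;> simp [comp_def]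
  have h8 := h1.seq (h2.seq (h3.seq (h4'.seq (h5.seq (h6.seq h7)))))
  refine ⟨_, h8.mono ?_⟩
  have e1 := hn.length_eq
  rw [List.length_map] at e1
  -- The guesses and the final check are linear: every state uses at least one symbol besides the
  -- two outer brackets, and the guessed numbers of actions are bounded by the description of the
  -- first state.
  have e2 : rs.length + 2 ≤ x0.length ∧ sh.length ≤ x0.length := by
    have hlen : (encList Rec.enc rs).length = x0.length := by rw [← hx, List.length_reverse]
    have hl1 : rs.length ≤ (rs.flatMap Rec.enc).length := by
      have := length_le_length_encList (fun r => Rec.enc r) (fun _ => by simp [Rec.enc]) rs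
      clear h1 h2 h3 h4 h5 h6 h7 h8 h4' hne hrs hl hx hn e1 hlen
      induction rs with
      | nil => simp
      | cons r rs ih =>
        have := ih (length_le_length_encList (fun r => Rec.enc r) (fun _ => by simp [Rec.enc]) rs)
        rw [List.flatMap_cons, List.length_append, List.length_cons]
        have : 0 < r.enc.length := by simp [Rec.enc]
        omega
    simp only [encList, List.length_cons, List.length_append, List.length_nil] at hlen
    refine ⟨by omega, ?_⟩
    cases rs with
    | nil => exact absurd rfl hne
    | cons r rs =>
      have hok := hrs [] r rs rfl
      have := length_shape_le r.opp r.team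
      rw [hok.shape_eq]
      simp only [Rec.enc, List.flatMap_cons, List.length_append, List.length_cons] at hlen
      omega
  have e3 : l.length + l'.length + 1 = rs.length := by
    have := congrArg List.length hl
    simp at this
    omega
  rw [Nat.mul_succ]
  omega

/-- At most `x.length + 1` rounds of cubic length give a polynomial of degree four. Soundness needs
no bound on the number of rounds. -/
theorem inNP_of_accepts (L : Language Γ') (hsound : ∀ n x, Accepts n x → x ∈ L)
    (hcomplete : ∀ x ∈ L, ∃ n ≤ x.length, Accepts n x) : InNP L := by
  have hstore : ∀ x : List Γ', (update (fun _ => []) Stk.x0 (x.map id).reverse :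
      (k : Stk) → List (Sym k)) = Store.get { x0 := x.reverse } := by
    intro x
    funext k
    cases k <;> simp [update, Store.get]
  refine inNP_of_isRegular Stk.x0 Γ'.comma id verifierP_isRegular L
    (35 * (Polynomial.X + 1) ^ 4 + 3 * Polynomial.X + 1) ?_ ?_
  · intro x l hl h
    rw [hstore, Option.isSome_iff_exists] at h
    obtain ⟨g, hg⟩ := h
    obtain ⟨u, rfl⟩ := Store.get_surjective g
    obtain ⟨n, hn⟩ := accepts_of_rel ⟨l, hl, hg⟩
    rw [List.reverse_reverse] at hn
    exact hsound n x hn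
  · intro x hx
    obtain ⟨n, hn, h⟩ := hcomplete x hx
    rw [← List.reverse_reverse x] at h
    obtain ⟨u, l, hl, hlen, hrun⟩ := exec_of_accepts h
    refine ⟨l, hl, hlen.trans ?_, by rw [hstore, hrun]; rfl⟩
    simp only [List.length_reverse, Polynomial.eval_add, Polynomial.eval_mul, Polynomial.eval_pow,
      Polynomial.eval_X, Polynomial.eval_one, Polynomial.eval_ofNat]
    have : 35 * (x.length + 1) ^ 3 * (n + 1) ≤ 35 * (x.length + 1) ^ 3 * (x.length + 1) :=
      Nat.mul_le_mul_left _ (by omega)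
    rw [pow_succ _ 3, ← mul_assoc]
    omega

/-! ### Reachability within finitely many steps -/

namespace GameStructure

variable {P S : Type} {A : P → Type} (G : GameStructure P S A)
variable [Fintype P] [DecidableEq P] [Fintype S]

/-- The probability that the state reached from the history `h s` after `n` steps is in `T`. -/
def val (T : Set S) (σ : (p : P) → G.Strategy p) : ℕ → List S → S → ℝ≥0∞
  | 0, _, s => T.indicator 1 s
  | n + 1, h, s => ∑ t, G.step σ h s t * val T σ n (h ++ [s]) t

/-- The probability that `T` is eventually reached from the history `h s`, if `T` is absorbing. -/
def reach (T : Set S) (σ : (p : P) → G.Strategy p) (h : List S) (s : S) : ℝ≥0∞ :=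
  ⨆ n, G.val T σ n h s

theorem sum_step (σ : (p : P) → G.Strategy p) (h : List S) (s : S) :
    ∑ t, G.step σ h s t = 1 := by
  rw [← tsum_fintype (L := SummationFilter.unconditional _), PMF.tsum_coe]

theorem step_apply (σ : (p : P) → G.Strategy p) (h : List S) (s t : S) :
    G.step σ h s t = ∑ a : (p : P) → G.Av p s, (∏ p, σ p h s (a p)) * G.δ s a t := rfl

theorem step_ne_zero_iff (σ : (p : P) → G.Strategy p) (h : List S) (s t : S) :
    G.step σ h s t ≠ 0 ↔ ∃ a : (p : P) → G.Av p s, (∀ p, σ p h s (a p) ≠ 0) ∧ G.δ s a t ≠ 0 := by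
  simp [step_apply, Finset.prod_eq_zero_iff]

variable {T : Set S} (σ : (p : P) → G.Strategy p)

theorem val_le_one (n : ℕ) (h : List S) (s : S) : G.val T σ n h s ≤ 1 := by
  induction n generalizing h s with
  | zero => exact Set.indicator_le_self' (by simp) s
  | succ n ih =>
    calc G.val T σ (n + 1) h s ≤ ∑ t, G.step σ h s t * 1 :=
          Finset.sum_le_sum fun t _ => by gcongr; exact ih _ _
      _ = 1 := by simp [sum_step]

/-- The recursion consults strategies only at extensions of `h`. This permits changing the
opponent's behaviour at `h` without affecting the values afterwards. -/
theorem val_congr {σ σ' : (p : P) → G.Strategy p} {h : List S}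
    (hσ : ∀ p h' s, h.length ≤ h'.length → σ p h' s = σ' p h' s) (n : ℕ) (s : S) :
    G.val T σ n h s = G.val T σ' n h s := by
  induction n generalizing h s with
  | zero => rfl
  | succ n ih =>
    refine Finset.sum_congr rfl fun t _ => ?_
    rw [ih fun p h' s hl => hσ p h' s (by simp at hl; omega), step_apply, step_apply]
    simp only [hσ _ h _ le_rfl]

variable (hT : ∀ t ∈ T, ∀ a : (p : P) → G.Av p t, G.δ t a t = 1)

include hT in
theorem step_of_mem {s : S} (hs : s ∈ T) (h : List S) : G.step σ h s s = 1 := by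
  rw [step_apply, ← Finset.sum_congr rfl fun a _ => by rw [hT s hs a, mul_one],
    ← Fintype.piFinset_univ, ← Finset.prod_univ_sum]
  refine Finset.prod_eq_one fun p _ => ?_
  rw [← tsum_fintype (L := SummationFilter.unconditional _), PMF.tsum_coe]

include hT in
theorem val_of_mem {s : S} (hs : s ∈ T) (n : ℕ) (h : List S) : G.val T σ n h s = 1 := by
  induction n generalizing h with
  | zero => simp [val, hs]
  | succ n ih =>
    refine le_antisymm (G.val_le_one σ _ _ _) ?_
    rw [val]
    refine le_trans ?_ (Finset.single_le_sum (fun t _ => zero_le) (Finset.mem_univ s))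
    rw [G.step_of_mem σ hT hs, ih, mul_one]

include hT in
theorem val_mono (h : List S) (s : S) : Monotone fun n => G.val T σ n h s := by
  refine monotone_nat_of_le_succ fun n => ?_
  induction n generalizing h s with
  | zero =>
    by_cases hs : s ∈ T
    · rw [G.val_of_mem σ hT hs, G.val_of_mem σ hT hs]
    · simp [val, hs]
  | succ n ih => exact Finset.sum_le_sum fun t _ => by gcongr; exact ih _ _

theorem reach_le_one (h : List S) (s : S) : G.reach T σ h s ≤ 1 :=
  iSup_le fun _ => G.val_le_one σ _ _ _

include hT in
theorem reach_of_mem {s : S} (hs : s ∈ T) (h : List S) : G.reach T σ h s = 1 := by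
  simp [reach, G.val_of_mem σ hT hs]

include hT in
-- The values increase with the horizon because the target is absorbing, so the supremum may be
-- exchanged with the finite sum.
theorem reach_eq_sum (h : List S) (s : S) :
    G.reach T σ h s = ∑ t, G.step σ h s t * G.reach T σ (h ++ [s]) t := by
  simp only [reach, ENNReal.mul_iSup]
  rw [ENNReal.finsetSum_iSup_of_monotone fun t => (G.val_mono σ hT _ t).const_mul' _]
  refine le_antisymm (iSup_le fun n => ?_) (iSup_le fun n => ?_)
  · exact (G.val_mono σ hT h s n.le_succ).trans
      (le_iSup (fun n => ∑ t, G.step σ h s t * G.val T σ n (h ++ [s]) t) n)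
  · exact le_iSup (fun n => G.val T σ n h s) (n + 1)

include hT in
-- An average of numbers at most 1 equals 1 only if every number of positive weight equals 1.
theorem reach_eq_one_of_step_ne_zero {h : List S} {s t : S} (hs : G.reach T σ h s = 1)
    (ht : G.step σ h s t ≠ 0) : G.reach T σ (h ++ [s]) t = 1 := by
  classical
  have htop : ∀ t, G.step σ h s t ≠ ∞ := fun t => PMF.apply_ne_top _ _
  have h1 := G.sum_step σ h s
  have h2 := (G.reach_eq_sum σ hT h s).symm.trans hs
  rw [← Finset.add_sum_erase _ _ (Finset.mem_univ t)] at h1 h2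
  have h3 : ∑ t' ∈ Finset.univ.erase t, G.step σ h s t' * G.reach T σ (h ++ [s]) t' ≤
      ∑ t' ∈ Finset.univ.erase t, G.step σ h s t' :=
    Finset.sum_le_sum fun t' _ => mul_le_of_le_one_right zero_le (G.reach_le_one σ _ _)
  have h4 : G.step σ h s t + ∑ t' ∈ Finset.univ.erase t, G.step σ h s t' ≤
      G.step σ h s t * G.reach T σ (h ++ [s]) t +
        ∑ t' ∈ Finset.univ.erase t, G.step σ h s t' := by
    rw [h1, ← h2]
    gcongr
  rw [ENNReal.add_le_add_iff_right (ENNReal.sum_ne_top.2 fun t _ => htop t)] at h4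
  refine le_antisymm (G.reach_le_one σ _ _) ?_
  rw [← ENNReal.mul_le_mul_iff_right ht (htop t), mul_one]
  exact h4

/-! ### The play measure and the probability of reaching the target -/

variable [MeasurableSpace S] [MeasurableSingletonClass S]

open MeasureTheory ProbabilityTheory Preorder

/-- The play prefix `x` followed by the state `t`. -/
def extend {m : ℕ} (x : Finset.Iic m → S) (t : S) (i : Finset.Iic (m + 1)) : S :=
  if h : (i : ℕ) ≤ m then x ⟨i, Finset.mem_Iic.2 h⟩ else t

/-- The history of a play prefix, without its last state. -/
def hist {m : ℕ} (x : Finset.Iic m → S) : List S :=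
  List.ofFn fun i : Fin m => x ⟨i, Finset.mem_Iic.2 i.2.le⟩

/-- The last state of a play prefix. -/
def last {m : ℕ} (x : Finset.Iic m → S) : S := x ⟨m, Finset.mem_Iic.2 le_rfl⟩

theorem last_extend {m : ℕ} (x : Finset.Iic m → S) (t : S) : last (extend x t) = t := by
  simp [last, extend]

theorem hist_extend {m : ℕ} (x : Finset.Iic m → S) (t : S) :
    hist (extend x t) = hist x ++ [last x] := by
  rw [hist, List.ofFn_succ', List.concat_eq_append]
  congr 1
  · refine congrArg List.ofFn (funext fun i => ?_)
    simp [extend, i.2.le]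
  · simp [extend, last]

/-- Conditioning on the next state: the trajectory kernel from time `m` is the one from time `m + 1`
composed with a single transition, and the integral over the next state is a finite sum. -/
theorem traj_eq_sum {m : ℕ} (x : Finset.Iic m → S) {E : Set (ℕ → S)} (hE : MeasurableSet E) :
    Kernel.traj (X := fun _ => S) (G.stepKernel σ) m x E = ∑ t, G.step σ (hist x) (last x) t *
      Kernel.traj (X := fun _ => S) (G.stepKernel σ) (m + 1) (extend x t) E := by
  rw [← Kernel.traj_comp_partialTraj (X := fun _ => S) (κ := G.stepKernel σ) m.le_succ,
    Kernel.comp_apply' _ _ _ hE, Kernel.partialTraj_succ_self, Kernel.map_apply _ (by fun_prop),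
    lintegral_map (Kernel.measurable_coe _ hE) (by fun_prop), Kernel.prod_apply, Kernel.id_apply,
    Measure.dirac_prod, lintegral_map (f := fun y => Kernel.traj (X := fun _ => S) (G.stepKernel σ)
      (m + 1) (IicProdIoc (X := fun _ => S) m (m + 1) y) E) ((Kernel.measurable_coe _ hE).comp (by fun_prop))
      (by fun_prop), Kernel.map_apply _ (by fun_prop),
    lintegral_map (f := fun z => Kernel.traj (X := fun _ => S) (G.stepKernel σ)
      (m + 1) (IicProdIoc (X := fun _ => S) m (m + 1) (x, z)) E) ((Kernel.measurable_coe _ hE).comp (by fun_prop))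
      (by fun_prop), lintegral_fintype]
  refine Finset.sum_congr rfl fun t _ => ?_
  rw [mul_comm]
  congr 1
  · exact PMF.toMeasure_apply_singleton _ _ (MeasurableSet.singleton _)
  · congr 2
    funext i
    by_cases h : (i : ℕ) ≤ m
    · simp [IicProdIoc, extend, h]
    · obtain rfl : i = ⟨m + 1, Finset.mem_Iic.2 le_rfl⟩ :=
        Subtype.ext (le_antisymm (Finset.mem_Iic.1 i.2) (not_le.1 h))
      simp [IicProdIoc, extend, MeasurableEquiv.piSingleton]

theorem traj_apply_mem {m : ℕ} (x : Finset.Iic m → S) (hT' : MeasurableSet T) :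
    Kernel.traj (X := fun _ => S) (G.stepKernel σ) m x {π | π m ∈ T} = T.indicator 1 (last x) := by
  have h := Kernel.traj_map_frestrictLe_apply (X := fun _ => S) (κ := G.stepKernel σ) m m x
  rw [Kernel.partialTraj_self, Kernel.id_apply] at h
  have hm : MeasurableSet {y : Finset.Iic m → S | last y ∈ T} :=
    (measurable_pi_apply _) hT'
  have h2 := congrArg (fun μ => μ {y : Finset.Iic m → S | last y ∈ T}) h
  rw [Measure.map_apply (by fun_prop) hm, Measure.dirac_apply' _ hm] at h2
  exact h2

include hT in
-- If the last state is a target, both sides are 1 by absorption. Otherwise the present moment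
-- contributes a null set, and conditioning on the next state shifts the event by one, as in the
-- recursion of `val`. Absorption also reconciles reaching `T` within `n` steps with being in `T`
-- after exactly `n` steps.
theorem traj_eq_val {m : ℕ} (x : Finset.Iic m → S) (n : ℕ) :
    Kernel.traj (X := fun _ => S) (G.stepKernel σ) m x {π | ∃ j ≤ n, π (m + j) ∈ T} =
      G.val T σ n (hist x) (last x) := by
  have hT' : MeasurableSet T := (Set.toFinite T).measurableSet
  induction n generalizing m with
  | zero =>
    rw [val, ← G.traj_apply_mem σ x hT']
    congr 1
    ext π
    simp
  | succ n ih =>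
    by_cases hs : last x ∈ T
    · rw [G.val_of_mem σ hT hs]
      refine le_antisymm prob_le_one ?_
      refine le_trans ?_ (measure_mono (s := {π : ℕ → S | π m ∈ T})
        fun π (h : π m ∈ T) => ⟨0, by simp, h⟩)
      rw [G.traj_apply_mem σ x hT']
      simp [hs]
    · have hE : MeasurableSet {π : ℕ → S | ∃ j ≤ n, π (m + 1 + j) ∈ T} := by
        simp only [Set.ofPred_exists]
        refine MeasurableSet.iUnion fun j => ?_
        by_cases hj : j ≤ n
        · have h : Measurable fun π : ℕ → S => π (m + 1 + j) := measurable_pi_apply _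
          simp only [hj, true_and]
          exact h hT'
        · simp [hj]
      have h0 : Kernel.traj (X := fun _ => S) (G.stepKernel σ) m x {π | π m ∈ T} = 0 := by
        rw [G.traj_apply_mem σ x hT']
        simp [hs]
      have h1 : {π : ℕ → S | ∃ j ≤ n + 1, π (m + j) ∈ T} =
          {π | ∃ j ≤ n, π (m + 1 + j) ∈ T} ∪ {π | π m ∈ T} := by
        ext π
        constructor
        · rintro ⟨j, hj, h⟩
          cases j with
          | zero => exact Or.inr h
          | succ j => exact Or.inl ⟨j, by omega, by rwa [show m + 1 + j = m + (j + 1) by omega]⟩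
        · rintro (⟨j, hj, h⟩ | h)
          · exact ⟨j + 1, by omega, by rwa [show m + (j + 1) = m + 1 + j by omega]⟩
          · exact ⟨0, by omega, h⟩
      have h2 : Kernel.traj (X := fun _ => S) (G.stepKernel σ) m x
          {π | ∃ j ≤ n + 1, π (m + j) ∈ T} = Kernel.traj (X := fun _ => S) (G.stepKernel σ) m x
          {π | ∃ j ≤ n, π (m + 1 + j) ∈ T} := by
        rw [h1]
        exact measure_congr (union_ae_eq_left_of_ae_eq_empty (ae_eq_empty.2 h0))
      rw [h2, G.traj_eq_sum σ x hE, val]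
      refine Finset.sum_congr rfl fun t _ => ?_
      rw [ih, hist_extend, last_extend]

include hT in
-- Continuity from below along the increasing events of reaching the target within `n` steps. From
-- here on no measure on infinite plays is needed.
theorem playMeasure_eq_reach (s₀ : S) :
    G.playMeasure σ s₀ {π | ∃ i, π i ∈ T} = G.reach T σ [] s₀ := by
  have h : {π : ℕ → S | ∃ i, π i ∈ T} = ⋃ n, {π | ∃ j ≤ n, π (0 + j) ∈ T} := by
    ext π
    simp only [Set.mem_ofPred_eq, Set.mem_iUnion, zero_add]
    exact ⟨fun ⟨i, hi⟩ => ⟨i, i, le_rfl, hi⟩, fun ⟨_, i, _, hi⟩ => ⟨i, hi⟩⟩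
  have hmono : Monotone fun n => {π : ℕ → S | ∃ j ≤ n, π (0 + j) ∈ T} :=
    fun n n' hn π ⟨j, hj, hπ⟩ => ⟨j, hj.trans hn, hπ⟩
  rw [h, hmono.measure_iUnion]
  refine iSup_congr fun n => ?_
  exact G.traj_eq_val σ hT (fun _ => s₀) n

end GameStructure

/-! ### Ranked winning regions -/

namespace Game

variable {P S : Type} {A : P → Type} (G : Game P S A) (o : P)

/-- All actions other than that of the opponent `o` are in the supports `B`. -/
def InSupp {s : S} (B : (p : P) → G.Av p s → Bool) (a : (p : P) → G.Av p s) : Prop :=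
  ∀ p, p ≠ o → B p (a p) = true

/-- The supports `B` keep the play in `W`. -/
def Closed (W : Set S) {s : S} (B : (p : P) → G.Av p s → Bool) : Prop :=
  ∀ a, G.InSupp o B a → ∀ t, G.δ s a t ≠ 0 → t ∈ W

/-- The supports `B` lead to `D` with positive probability against every action of `o`. -/
def Hits (D : Set S) {s : S} (B : (p : P) → G.Av p s → Bool) : Prop :=
  ∀ b : G.Av o s, ∃ a, a o = b ∧ G.InSupp o B a ∧ ∃ t ∈ D, G.δ s a t ≠ 0

/-- At `s`, the team can stay in `W` and move to `D` with positive probability. -/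
def Addable (W D : Set S) (s : S) : Prop :=
  s ∈ W ∧ (s ∈ G.target ∨ ∃ B : (p : P) → G.Av p s → Bool, G.Closed o W B ∧ G.Hits o D B)

/-- The sets that can be obtained by adding addable states one after the other. -/
inductive Chain (W : Set S) : Set S → Prop
  | empty : Chain W ∅
  | insert {D : Set S} {s : S} (h : Chain W D) (hs : G.Addable o W D s) (hsD : s ∉ D) :
      Chain W (insert s D)

variable {G o}

theorem Hits.mono {D D' : Set S} (h : D ⊆ D') {s : S} {B : (p : P) → G.Av p s → Bool}
    (hB : G.Hits o D B) : G.Hits o D' B := fun b =>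
  (hB b).imp fun _ ha => ⟨ha.1, ha.2.1, ha.2.2.imp fun _ ht => ⟨h ht.1, ht.2⟩⟩

theorem Chain.subset {W D : Set S} (h : G.Chain o W D) : D ⊆ W := by
  induction h with
  | empty => exact Set.empty_subset _
  | insert _ hs _ ih => exact Set.insert_subset hs.1 ih

variable [Fintype P] [DecidableEq P] [Fintype S]

/-! ### Winning strategies yield ranked regions -/

section Necessity

variable (ho : G.team = {p | p ≠ o})

include ho in
theorem combine_opp (σ : G.Profile G.team) (τ : G.Profile G.teamᶜ) :
    G.combine σ τ o = τ ⟨o, by simp [ho]⟩ := by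
  rw [GameStructure.combine, dif_neg]

include ho in
theorem combine_team (σ : G.Profile G.team) (τ : G.Profile G.teamᶜ) {p : P} (hp : p ≠ o) :
    G.combine σ τ p = σ ⟨p, by simpa [ho] using hp⟩ := by
  rw [GameStructure.combine, dif_pos]

/-- After the history `h s`, the collective strategy `σ` is almost surely winning. -/
def WinsAt (σ : G.Profile G.team) (h : List S) (s : S) : Prop :=
  ∀ τ : G.Profile G.teamᶜ, G.reach G.target (G.combine σ τ) h s = 1

open Classical in
/-- The supports of a strategy after the history `h s`. -/
def supports (σ : (p : P) → G.Strategy p) (h : List S) (s : S) (p : P) (a : G.Av p s) : Bool :=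
  decide (σ p h s a ≠ 0)

/-- The supports of the strategies of the team do not depend on the opponent. -/
theorem inSupp_supports (σ : (p : P) → G.Strategy p) (h : List S) (s : S)
    (a : (p : P) → G.Av p s) :
    G.InSupp o (supports σ h s) a ↔ ∀ p, p ≠ o → σ p h s (a p) ≠ 0 := by
  simp [InSupp, supports]

/-- A strategy profile of the team, extended arbitrarily. -/
def arbitrary (σ : G.Profile G.team) : (p : P) → G.Strategy p :=
  G.combine σ fun p _ s => PMF.pure ⟨(G.Av_nonempty p s).choose, (G.Av_nonempty p s).choose_spec⟩

include ho in
-- If the opponent plays his component of `a` after `h s`, then `t` is reached with positive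
-- probability, so the value there must be 1. As his behaviour afterwards is arbitrary, the team
-- wins from there as well.
theorem WinsAt.step {σ : G.Profile G.team} {h : List S} {s : S} (hw : WinsAt σ h s)
    {a : (p : P) → G.Av p s} (ha : G.InSupp o (supports (arbitrary σ) h s) a) {t : S}
    (ht : G.δ s a t ≠ 0) : WinsAt σ (h ++ [s]) t := by
  classical
  intro τ
  -- Comparing lengths instead of histories is enough: the values after `h ++ [s]` involve only
  -- histories longer than `h`.
  let τ' : G.Profile G.teamᶜ := fun p h' s' =>
    if h'.length = h.length then
      if e : s' = s then PMF.pure (e ▸ a p) else τ p h' s' else τ p h' s'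
  have hp : ∀ p, p ≠ o → ∀ τ : G.Profile G.teamᶜ, G.combine σ τ p = arbitrary σ p := by
    intro p hp τ
    rw [arbitrary, combine_team ho _ _ hp, combine_team ho _ _ hp]
  have h1 := G.reach_eq_one_of_step_ne_zero (G.combine σ τ') G.absorbing (hw τ') (t := t) (by
    rw [GameStructure.step_ne_zero_iff]
    refine ⟨a, fun p => ?_, ht⟩
    by_cases hpo : p = o
    · subst hpo
      rw [combine_opp ho]
      simp [τ']
    · rw [hp p hpo]
      exact (inSupp_supports _ _ _ _).1 ha p hpo)
  rw [← h1]
  refine iSup_congr fun n => G.val_congr (fun p h' s' hl => ?_) n t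
  by_cases hpo : p = o
  · subst hpo
    rw [combine_opp ho, combine_opp ho]
    have : h'.length ≠ h.length := by simp at hl; omega
    simp [τ', this]
  · rw [hp p hpo, hp p hpo]

/-- The states at which some collective strategy wins after some history. -/
def winRegion (G : Game P S A) : Set S := {s | ∃ (σ : G.Profile G.team) (h : List S), WinsAt σ h s}

include ho in
-- Suppose that nothing can be added. At a winning history ending outside `D`, the supports of the
-- winning strategy are closed in the region, so the only obstacle is that they miss `D` against
-- some action of the opponent. Playing such an action forever keeps the play outside `D` and at
-- winning histories, where no state is a target, as targets of the region are always addable. The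
-- target is then never reached, which contradicts winning.
theorem exists_addable {D : Set S} (hD : D ⊆ G.winRegion) (hne : D ≠ G.winRegion) :
    ∃ s, s ∉ D ∧ G.Addable o G.winRegion D s := by
  classical
  by_contra! hno
  obtain ⟨s₁, ⟨σ, h₁, hw₁⟩, hs₁⟩ := Set.exists_of_ssubset (hD.ssubset_of_ne hne)
  -- The reply depends on the history because the supports of `σ` do. The other branches are
  -- fillers: `o` is the only player outside the team, and at the histories that matter an action
  -- avoiding `D` exists.
  let τ : G.Profile G.teamᶜ := fun p h s =>
    if hp : (p : P) = o then
      if hb : ∃ b : G.Av o s, ∀ a, a o = b → G.InSupp o (supports (arbitrary σ) h s) a →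
          ∀ t ∈ D, G.δ s a t = 0 then PMF.pure (hp ▸ hb.choose)
      else PMF.pure ⟨(G.Av_nonempty p s).choose, (G.Av_nonempty p s).choose_spec⟩
    else PMF.pure ⟨(G.Av_nonempty p s).choose, (G.Av_nonempty p s).choose_spec⟩
  have key : ∀ n h s, WinsAt σ h s → s ∉ D → G.val G.target (G.combine σ τ) n h s = 0 := by
    intro n
    induction n with
    | zero =>
      intro h s hw hs
      have : s ∉ G.target := fun ht => hno s hs ⟨⟨σ, h, hw⟩, Or.inl ht⟩
      simp [GameStructure.val, this]
    | succ n ih =>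
      intro h s hw hs
      have hcl : G.Closed o G.winRegion (supports (arbitrary σ) h s) :=
        fun a ha t ht => ⟨σ, _, hw.step ho ha ht⟩
      have hb : ∃ b : G.Av o s, ∀ a, a o = b → G.InSupp o (supports (arbitrary σ) h s) a →
          ∀ t ∈ D, G.δ s a t = 0 := by
        by_contra! hb
        exact hno s hs ⟨⟨σ, h, hw⟩, Or.inr ⟨_, hcl, hb⟩⟩
      refine Finset.sum_eq_zero fun t _ => mul_eq_zero.2 ?_
      by_contra! hne
      obtain ⟨a, ha, ht⟩ := (GameStructure.step_ne_zero_iff _ _ _ _ _).1 hne.1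
      have hsupp : G.InSupp o (supports (arbitrary σ) h s) a := by
        refine (inSupp_supports _ _ _ _).2 fun p hp => ?_
        have := ha p
        rw [combine_team ho _ _ hp] at this
        rwa [arbitrary, combine_team ho _ _ hp]
      have hao : a o = hb.choose := by
        have := ha o
        rw [combine_opp ho] at this
        dsimp only [τ] at this
        rw [dif_pos rfl, dif_pos hb, PMF.pure_apply] at this
        by_contra hne
        exact this (if_neg hne)
      refine hne.2 (ih _ _ (hw.step ho hsupp ht) fun htD => ht ?_)
      exact hb.choose_spec a hao hsupp t htD
  have h0 : G.reach G.target (G.combine σ τ) h₁ s₁ = 0 :=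
    (iSup_congr fun n => key n _ _ hw₁ hs₁).trans (by simp)
  rw [hw₁ τ] at h0
  exact one_ne_zero h0

include ho in
-- A maximal set obtainable inside the winning region is the whole region, since otherwise one more
-- state could be added.
theorem exists_chain_of_winsAt {σ : G.Profile G.team} {h : List S} {s : S} (hw : WinsAt σ h s) :
    ∃ W : Set S, s ∈ W ∧ G.Chain o W W := by
  refine ⟨G.winRegion, ⟨σ, h, hw⟩, ?_⟩
  obtain ⟨D, hD⟩ := Set.Finite.exists_maximal (Set.toFinite {D | G.Chain o G.winRegion D})
    ⟨∅, .empty⟩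
  by_cases hne : D = G.winRegion
  · rw [hne] at hD
    exact hD.1
  · obtain ⟨s, hsD, hs⟩ := exists_addable ho hD.1.subset hne
    exact absurd (hD.2 (Chain.insert hD.1 hs hsD) (Set.subset_insert _ _) (Set.mem_insert _ _)) hsD

end Necessity

end Game

/-! ### Ranked regions yield winning strategies -/

namespace Game

variable {P S : Type} {A : P → Type} {G : Game P S A} {o : P}
variable [Fintype P] [DecidableEq P] [Fintype S]

/-- The order of insertion becomes a rank. Targets need no rank of their own, as the conclusion says
nothing about them. -/
theorem Chain.exists_rank {W D : Set S} (h : G.Chain o W D) :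
    ∃ (rk : S → ℕ) (B : (s : S) → (p : P) → G.Av p s → Bool), ∀ s ∈ D, s ∉ G.target →
      G.Closed o W (B s) ∧ G.Hits o {t | t ∈ D ∧ rk t < rk s} (B s) := by
  classical
  induction h with
  | empty => exact ⟨fun _ => 0, fun _ _ _ => true, by simp⟩
  | @insert D s _ hs hsD ih =>
    obtain ⟨rk, B, hB⟩ := ih
    rcases hs.2 with ht | ⟨B₀, hcl, hhit⟩
    · refine ⟨rk, B, ?_⟩
      intro s' hs' ht'
      rcases Set.mem_insert_iff.1 hs' with rfl | hs'
      · exact absurd ht ht'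
      · refine ⟨(hB s' hs' ht').1, (hB s' hs' ht').2.mono ?_⟩
        exact fun t h => ⟨Set.mem_insert_of_mem _ h.1, h.2⟩
    -- One more than the sum of all ranks exceeds each of them, so all earlier states rank below
    -- `s`.
    · refine ⟨update rk s (∑ t, rk t + 1), update B s B₀, ?_⟩
      intro s' hs' ht'
      rcases Set.mem_insert_iff.1 hs' with rfl | hs'
      · rw [update_self, update_self]
        refine ⟨hcl, hhit.mono ?_⟩
        refine fun t h => ⟨Set.mem_insert_of_mem _ h, ?_⟩
        rw [update_of_ne (show t ≠ s' from fun e => hsD (e ▸ h))]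
        exact Nat.lt_succ_of_le (Finset.single_le_sum (fun _ _ => Nat.zero_le _)
          (Finset.mem_univ t))
      · have hne : s' ≠ s := fun e => hsD (e ▸ hs')
        rw [update_of_ne hne, update_of_ne hne]
        refine ⟨(hB s' hs' ht').1, (hB s' hs' ht').2.mono ?_⟩
        refine fun t h => ⟨Set.mem_insert_of_mem _ h.1, ?_⟩
        rw [update_of_ne (show t ≠ s from fun e => hsD (e ▸ h.1))]
        exact h.2

open Classical in
/-- The memoryless strategies that play uniformly on the supports `B`. -/
def uniformOn (B : (s : S) → (p : P) → G.Av p s → Bool) (p : P) : G.Strategy p := fun _ s =>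
  if h : (Finset.univ.filter fun a => B s p a = true).Nonempty then PMF.uniformOfFinset _ h
  else PMF.pure ⟨(G.Av_nonempty p s).choose, (G.Av_nonempty p s).choose_spec⟩

theorem uniformOn_ne_zero_iff {B : (s : S) → (p : P) → G.Av p s → Bool} {p : P} {s : S}
    {a₀ : G.Av p s} (ha₀ : B s p a₀ = true) (h : List S) (a : G.Av p s) :
    uniformOn B p h s a ≠ 0 ↔ B s p a = true := by
  classical
  have hne : (Finset.univ.filter fun a => B s p a = true).Nonempty := ⟨a₀, by simpa using ha₀⟩
  rw [uniformOn, dif_pos hne, ← PMF.mem_support_iff, PMF.mem_support_uniformOfFinset_iff]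
  simp

theorem exists_pos_le_of_ne_zero {ι : Type} [Finite ι] (f : ι → ℝ≥0∞) :
    ∃ ε : ℝ≥0∞, ε ≠ 0 ∧ ε ≤ 1 ∧ ∀ i, f i ≠ 0 → ε ≤ f i := by
  by_cases hne : {i | f i ≠ 0}.Nonempty
  · obtain ⟨i, hi, hmin⟩ := Set.exists_min_image {i | f i ≠ 0} f (Set.toFinite _) hne
    exact ⟨min (f i) 1, (lt_min (pos_iff_ne_zero.2 hi) one_pos).ne', min_le_right _ _,
      fun j hj => (min_le_left _ _).trans (hmin j hj)⟩
  · exact ⟨1, one_ne_zero, le_rfl, fun i hi => absurd ⟨i, hi⟩ hne⟩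

/-- If the supports of the team lead to `D` against every action of the opponent, then the
probability to move to `D` is bounded from below. -/
theorem le_sum_step_of_hits {σ : (p : P) → G.Strategy p} {h : List S} {s : S} {D : Set S}
    [DecidablePred (· ∈ D)] {ε : ℝ≥0∞}
    (hε : ∀ b : G.Av o s, ∃ a, a o = b ∧ ∃ t ∈ D,
      ε ≤ (∏ p ∈ Finset.univ.erase o, σ p h s (a p)) * G.δ s a t) :
    ε ≤ ∑ t with t ∈ D, G.step σ h s t := by
  classical
  choose a ha t htD hle using hε
  -- The opponent's draw is independent of the team's, so a bound valid against each of his pure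
  -- actions survives averaging over his distribution.
  calc ε = ∑ b, σ o h s b * ε := by
        rw [← Finset.sum_mul, ← tsum_fintype (L := SummationFilter.unconditional _),
          PMF.tsum_coe, one_mul]
    _ ≤ ∑ b, (∏ p, σ p h s (a b p)) * G.δ s (a b) (t b) := by
        refine Finset.sum_le_sum fun b _ => ?_
        rw [← Finset.mul_prod_erase _ _ (Finset.mem_univ o), ha, mul_assoc]
        gcongr
        exact hle b
    _ ≤ ∑ b, ∑ a' : (p : P) → G.Av p s with a' o = b,
          (∏ p, σ p h s (a' p)) * ∑ t with t ∈ D, G.δ s a' t := by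
        refine Finset.sum_le_sum fun b _ => ?_
        refine le_trans ?_ (Finset.single_le_sum (fun _ _ => zero_le) (a := a b)
          (by simpa using ha b))
        gcongr
        exact Finset.single_le_sum (f := fun t => G.δ s (a b) t) (fun _ _ => zero_le)
          (by simpa using htD b)
    _ = ∑ a' : (p : P) → G.Av p s, (∏ p, σ p h s (a' p)) * ∑ t with t ∈ D, G.δ s a' t :=
        Finset.sum_fiberwise _ _ _
    _ = ∑ t with t ∈ D, G.step σ h s t := by
        simp_rw [GameStructure.step_apply, Finset.mul_sum]
        exact Finset.sum_comm

/-- Let `m` be the infimum of the values over all histories and all states of `W`. By induction on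
the rank, a state of rank `k` has value at least `m + e ^ (k + 1) * (1 - m)`: with probability at
least `e` the rank drops, and otherwise the value is still at least `m`. The ranks are bounded, so
the infimum would exceed itself unless `m = 1`. Taking the infimum over histories too accommodates
opponents with memory. -/
theorem reach_eq_one_of_rank (σ : (p : P) → G.Strategy p) {W : Set S} (rk : S → ℕ) {ε : ℝ≥0∞}
    (hε0 : ε ≠ 0) (hε1 : ε ≤ 1)
    (hcl : ∀ h, ∀ s ∈ W, s ∉ G.target → ∀ t, G.step σ h s t ≠ 0 → t ∈ W)
    (hε : ∀ h, ∀ s ∈ W, s ∉ G.target → ∀ D : Set S, [DecidablePred (· ∈ D)] →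
      D = {t | t ∈ W ∧ rk t < rk s} → ε ≤ ∑ t with t ∈ D, G.step σ h s t)
    (h : List S) {s : S} (hs : s ∈ W) : G.reach G.target σ h s = 1 := by
  classical
  let V : List S → S → ℝ := fun h s => (G.reach G.target σ h s).toReal
  let q : List S → S → S → ℝ := fun h s t => (G.step σ h s t).toReal
  have hVtop : ∀ h s, G.reach G.target σ h s ≠ ∞ := fun h s =>
    ne_top_of_le_ne_top ENNReal.one_ne_top (G.reach_le_one σ h s)
  have hqtop : ∀ h s t, G.step σ h s t ≠ ∞ := fun h s t => PMF.apply_ne_top _ _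
  have hV0 : ∀ h s, 0 ≤ V h s := fun h s => ENNReal.toReal_nonneg
  have hV1 : ∀ h s, V h s ≤ 1 := fun h s =>
    ENNReal.toReal_le_of_le_ofReal zero_le_one (by simpa using G.reach_le_one σ h s)
  have hq0 : ∀ h s t, 0 ≤ q h s t := fun h s t => ENNReal.toReal_nonneg
  have hq1 : ∀ h s, ∑ t, q h s t = 1 := fun h s => by
    rw [← ENNReal.toReal_sum fun t _ => hqtop h s t, G.sum_step, ENNReal.toReal_one]
  have hVq : ∀ h s, V h s = ∑ t, q h s t * V (h ++ [s]) t := fun h s => by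
    simp only [V, q]
    rw [G.reach_eq_sum σ G.absorbing,
      ENNReal.toReal_sum fun t _ => ENNReal.mul_ne_top (hqtop h s t) (hVtop _ _)]
    simp
  let m : ℝ := ⨅ x : List S × W, V x.1 x.2
  have hbdd : BddBelow (Set.range fun x : List S × W => V x.1 x.2) :=
    ⟨0, by rintro _ ⟨x, rfl⟩; exact hV0 _ _⟩
  have hm : ∀ h, ∀ s ∈ W, m ≤ V h s := fun h s hs => ciInf_le hbdd (h, ⟨s, hs⟩)
  have hm1 : m ≤ 1 := (hm h s hs).trans (hV1 _ _)
  set e : ℝ := ε.toReal with he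
  have he0 : 0 < e := ENNReal.toReal_pos hε0 (ne_top_of_le_ne_top ENNReal.one_ne_top hε1)
  have he1 : e ≤ 1 := ENNReal.toReal_le_of_le_ofReal zero_le_one (by simpa using hε1)
  have key : ∀ k h, ∀ s ∈ W, rk s = k → m + e ^ (k + 1) * (1 - m) ≤ V h s := by
    intro k
    induction k using Nat.strong_induction_on with
    | _ k ih =>
      intro h s hs hk
      by_cases ht : s ∈ G.target
      · have : V h s = 1 := by simp [V, G.reach_of_mem σ G.absorbing ht]
        rw [this]
        nlinarith [pow_le_one₀ he0.le he1 (n := k + 1)]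
      · have hlow : e ≤ ∑ t with t ∈ {t | t ∈ W ∧ rk t < rk s}, q h s t := by
          have := hε h s hs ht _ rfl
          rw [he, ← ENNReal.toReal_sum fun t _ => hqtop h s t]
          exact ENNReal.toReal_mono (ENNReal.sum_ne_top.2 fun t _ => hqtop h s t) this
        have hek : 0 ≤ e ^ k * (1 - m) := mul_nonneg (pow_nonneg he0.le _) (by linarith)
        calc m + e ^ (k + 1) * (1 - m) = m + e * (e ^ k * (1 - m)) := by ring
          _ ≤ m + (∑ t with t ∈ {t | t ∈ W ∧ rk t < rk s}, q h s t) * (e ^ k * (1 - m)) := by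
              gcongr
          _ = ∑ t, q h s t * (m + if t ∈ {t | t ∈ W ∧ rk t < rk s} then e ^ k * (1 - m) else 0) := by
              simp_rw [mul_add, Finset.sum_add_distrib, ← Finset.sum_mul, hq1, one_mul, mul_ite,
                mul_zero, Finset.sum_mul, Finset.sum_filter]
          _ ≤ ∑ t, q h s t * V (h ++ [s]) t := by
              refine Finset.sum_le_sum fun t _ => ?_
              by_cases hst : G.step σ h s t = 0
              · simp [q, hst]
              · refine mul_le_mul_of_nonneg_left ?_ (hq0 _ _ _)
                have htW := hcl h s hs ht t hst
                split_ifs with hlt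
                · refine le_trans ?_ (ih (rk t) (hk ▸ hlt.2) _ t htW rfl)
                  have : e ^ k ≤ e ^ (rk t + 1) := pow_le_pow_of_le_one he0.le he1 (hk ▸ hlt.2)
                  have : 0 ≤ 1 - m := by linarith
                  gcongr
                · rw [add_zero]
                  exact hm _ t htW
          _ = V h s := (hVq h s).symm
  obtain ⟨K, hK⟩ : ∃ K, ∀ s, rk s ≤ K := ⟨∑ s, rk s, fun s =>
    Finset.single_le_sum (fun _ _ => Nat.zero_le _) (Finset.mem_univ s)⟩
  have hlast : m + e ^ (K + 1) * (1 - m) ≤ m := by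
    have : Nonempty (List S × W) := ⟨(h, ⟨s, hs⟩)⟩
    refine le_ciInf fun x => le_trans ?_ (key _ x.1 x.2 x.2.2 rfl)
    have : e ^ (K + 1) ≤ e ^ (rk x.2 + 1) :=
      pow_le_pow_of_le_one he0.le he1 (Nat.succ_le_succ (hK _))
    have : 0 ≤ 1 - m := by linarith
    gcongr
  have hm' : 1 ≤ m := by
    by_contra! hlt
    have := mul_pos (pow_pos he0 (K + 1)) (sub_pos.2 hlt)
    linarith
  have hV : V h s = 1 := le_antisymm (hV1 _ _) (hm'.trans (hm h s hs))
  exact (ENNReal.toReal_eq_one_iff _).1 hV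

/-- Uniform play on the supports keeps the play in `W` before the target is hit and makes the rank
drop with probability bounded below against every action of the opponent. -/
theorem Chain.winsAt (ho : G.team = {p | p ≠ o}) {W : Set S} (hW : G.Chain o W W) :
    ∃ σ : G.Profile G.team, ∀ (h : List S), ∀ s ∈ W, WinsAt σ h s := by
  classical
  obtain ⟨rk, B, hB⟩ := hW.exists_rank
  refine ⟨fun p => uniformOn B p, fun h s hs τ => ?_⟩
  have hteam : ∀ p, p ≠ o → G.combine (fun p => uniformOn B p) τ p = uniformOn B p :=
    fun p hp => combine_team ho _ _ hp
  -- The supports are nonempty because the hitting condition, applied to any available action of the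
  -- opponent, exhibits a tuple in them.
  have hsupp : ∀ s ∈ W, s ∉ G.target → ∀ p, p ≠ o → ∃ a, B s p a = true := by
    intro s hs ht p hp
    obtain ⟨a, -, ha, -⟩ := (hB s hs ht).2 ⟨_, (G.Av_nonempty o s).choose_spec⟩
    exact ⟨a p, ha p hp⟩
  -- The strategies ignore the history, so the empty one represents all histories and the minimum is
  -- over a finite set. Leaving out the opponent's factor makes the bound independent of his
  -- strategy.
  obtain ⟨ε, hε0, hε1, hε⟩ := exists_pos_le_of_ne_zero
    (fun i : (Σ s : S, ((p : P) → G.Av p s) × S) =>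
      (∏ p ∈ Finset.univ.erase o, uniformOn B p [] i.1 (i.2.1 p)) * G.δ i.1 i.2.1 i.2.2)
  refine reach_eq_one_of_rank _ rk hε0 hε1 ?_ ?_ h hs
  · intro h s hs ht t hst
    obtain ⟨a, ha, hat⟩ := (GameStructure.step_ne_zero_iff _ _ _ _ _).1 hst
    refine (hB s hs ht).1 a (fun p hp => ?_) t hat
    have := ha p
    rw [hteam p hp] at this
    obtain ⟨a₀, ha₀⟩ := hsupp s hs ht p hp
    exact (uniformOn_ne_zero_iff ha₀ h _).1 this
  · rintro h s hs ht D _ rfl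
    refine le_sum_step_of_hits (o := o) fun b => ?_
    obtain ⟨a, hab, ha, t, htD, hat⟩ := (hB s hs ht).2 b
    refine ⟨a, hab, t, htD, ?_⟩
    have h1 : ∏ p ∈ Finset.univ.erase o,
        G.combine (fun p => uniformOn B p) τ p h s (a p) =
        ∏ p ∈ Finset.univ.erase o, uniformOn B p [] s (a p) := by
      refine Finset.prod_congr rfl fun p hp => ?_
      rw [hteam p (Finset.ne_of_mem_erase hp)]
      rfl
    rw [h1]
    refine hε ⟨s, a, t⟩ (mul_ne_zero (Finset.prod_ne_zero_iff.2 fun p hp => ?_) hat)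
    exact (uniformOn_ne_zero_iff (ha p (Finset.ne_of_mem_erase hp)) [] _).2
      (ha p (Finset.ne_of_mem_erase hp))

theorem almostSure_iff_chain [MeasurableSpace S] [MeasurableSingletonClass S]
    (ho : G.team = {p | p ≠ o}) : G.AlmostSure ↔ ∃ W : Set S, G.init ∈ W ∧ G.Chain o W W := by
  have h : G.AlmostSure ↔ ∃ σ : G.Profile G.team, WinsAt σ [] G.init := by
    simp only [AlmostSure, WinsAt, G.playMeasure_eq_reach _ G.absorbing]
  rw [h]
  constructor
  · rintro ⟨σ, hσ⟩
    exact exists_chain_of_winsAt ho hσ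
  · rintro ⟨W, hinit, hW⟩
    obtain ⟨σ, hσ⟩ := hW.winsAt ho
    exact ⟨σ, hσ [] _ hinit⟩

end Game

/-! ### Unique decoding -/

/-- A code in which no code word can be mistaken for the beginning of another word. -/
def PrefixFree {α : Type} (enc : α → List Γ') : Prop :=
  ∀ a b u v, enc a ++ u = enc b ++ v → a = b ∧ u = v

theorem prefixFree_encBit : PrefixFree encBit := by
  intro a b u v h
  simpa [encBit] using h

theorem prefixFree_encNat : PrefixFree encNat := by
  have key : ∀ (l l' : List Bool) (u v : List Γ'), l.map Γ'.bit ++ (.comma :: u) =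
      l'.map Γ'.bit ++ (.comma :: v) → l = l' ∧ u = v := by
    intro l
    induction l with
    | nil => intro l' u v h; cases l' <;> simp_all
    | cons a l ih =>
      intro l' u v h
      cases l' with
      | nil => simp at h
      | cons b l' =>
        simp only [List.map_cons, List.cons_append, List.cons.injEq, Γ'.bit.injEq] at h
        obtain ⟨rfl, rfl⟩ := ih _ _ _ h.2
        exact ⟨by rw [h.1], rfl⟩
  intro a b u v h
  obtain ⟨h1, h2⟩ := key (encodeNat a) (encodeNat b) u v (by simpa [encNat] using h)
  exact ⟨by rw [← decode_encodeNat a, h1, decode_encodeNat], h2⟩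

/-- No code of an element begins with the closing bracket, so the end of the list can be recognised;
up to there elements are split off one by one. -/
theorem PrefixFree.encList {α : Type} {enc : α → List Γ'} (henc : PrefixFree enc)
    (hket : ∀ a, ∃ c w, enc a = c :: w ∧ c ≠ .ket) : PrefixFree (encList enc) := by
  have key : ∀ (l l' : List α) (u v : List Γ'), l.flatMap enc ++ (.ket :: u) =
      l'.flatMap enc ++ (.ket :: v) → l = l' ∧ u = v := by
    intro l
    induction l with
    | nil =>
      intro l' u v h
      cases l' with
      | nil => simpa using h
      | cons b l' =>
        obtain ⟨c, w, hc, hne⟩ := hket b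
        simp [hc, hne.symm] at h
    | cons a l ih =>
      intro l' u v h
      cases l' with
      | nil =>
        obtain ⟨c, w, hc, hne⟩ := hket a
        simp [hc, hne] at h
      | cons b l' =>
        simp only [List.flatMap_cons, List.append_assoc] at h
        obtain ⟨rfl, h'⟩ := henc _ _ _ _ h
        obtain ⟨rfl, rfl⟩ := ih _ _ _ h'
        exact ⟨rfl, rfl⟩
  intro a b u v h
  exact key a b u v (by simpa [TeamGames.encList] using h)

theorem exists_encList_eq_cons {α : Type} (enc : α → List Γ') (l : List α) :
    ∃ c w, encList enc l = c :: w ∧ c ≠ .ket := ⟨_, _, rfl, by simp⟩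

/-- The description of a state in an input. -/
@[ext]
structure Plain : Type where
  tgt : Bool
  ini : Bool
  av : List (List Bool)
  rows : List (List ℕ)

/-- The encoding of the description of a state. -/
def Plain.enc (p : Plain) : List Γ' :=
  .bra :: .bit p.tgt :: .bit p.ini ::
    (encList (encList encBit) p.av ++ (encList (encList encNat) p.rows ++ [.ket]))

theorem prefixFree_plainEnc : PrefixFree Plain.enc := by
  have h1 : PrefixFree (encList (encList encBit)) :=
    (prefixFree_encBit.encList fun a => ⟨_, _, rfl, by simp⟩).encList (exists_encList_eq_cons _)
  have h2 : PrefixFree (encList (encList encNat)) := by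
    refine (prefixFree_encNat.encList fun a => ?_).encList (exists_encList_eq_cons _)
    rw [encNat]
    cases encodeNat a with
    | nil => exact ⟨_, _, rfl, by simp⟩
    | cons b l => exact ⟨_, _, rfl, by simp⟩
  rintro ⟨t, i, av, rows⟩ ⟨t', i', av', rows'⟩ u v h
  simp only [Plain.enc, List.cons_append, List.append_assoc, List.cons.injEq, Γ'.bit.injEq,
    true_and] at h
  obtain ⟨rfl, rfl, h⟩ := h
  obtain ⟨rfl, h'⟩ := h1 _ _ _ _ h
  obtain ⟨rfl, h''⟩ := h2 _ _ _ _ h'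
  exact ⟨rfl, by simpa using h''⟩

/-- Consequently all readings of an input agree on everything that is written in it and can differ
only in the guesses. -/
theorem encList_plainEnc_injective : Injective (encList Plain.enc) := fun a b h =>
  (prefixFree_plainEnc.encList (fun p => ⟨_, _, rfl, by simp⟩) a b [] [] (by rw [h])).1

/-- The part of a description that is encoded. -/
def Rec.plain (r : Rec) : Plain where
  tgt := r.md.tgt
  ini := r.md.ini
  av := r.opp :: r.team.map fun ds => ds.map Option.isSome
  rows := r.blocks.flatten.map Prod.snd

theorem Rec.enc_eq (r : Rec) : r.enc = r.plain.enc := by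
  simp [Rec.enc, Plain.enc, Rec.plain, encAvail, encList, List.flatMap_map]
  rfl

theorem encList_recEnc (rs : List Rec) :
    encList Rec.enc rs = encList Plain.enc (rs.map Rec.plain) := by
  rw [encList_map, encList]
  simp only [← Rec.enc_eq]

/-! ### Lists of tuples -/

theorem mem_tuples {k : ℕ} {α : Fin k → Type} {L : (i : Fin k) → List (α i)}
    {a : (i : Fin k) → α i} : a ∈ tuples L ↔ ∀ i, a i ∈ L i := by
  induction k with
  | zero => simp [tuples, funext_iff]
  | succ k ih =>
    simp only [tuples, List.mem_flatMap, List.mem_map]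
    constructor
    · rintro ⟨x, hx, b, hb, rfl⟩ i
      refine Fin.cases hx (fun i => ?_) i
      exact ih.1 hb i
    · intro h
      exact ⟨a 0, h 0, Fin.tail a, ih.2 fun i => h i.succ, Fin.cons_self_tail a⟩

theorem nodup_tuples {k : ℕ} {α : Fin k → Type} {L : (i : Fin k) → List (α i)}
    (hL : ∀ i, (L i).Nodup) : (tuples L).Nodup := by
  induction k with
  | zero => simp [tuples]
  | succ k ih =>
    rw [tuples, List.nodup_flatMap]
    refine ⟨fun x _ => (ih fun i => hL i.succ).map (Fin.cons_right_injective x), ?_⟩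
    refine (hL 0).imp fun {x y} hxy => ?_
    simp only [onFun, List.disjoint_left, List.mem_map, not_exists, not_and]
    rintro _ ⟨b, _, rfl⟩ c _ h
    exact hxy (by simpa using (congrFun h 0).symm)

theorem length_tuples {k : ℕ} {α : Fin k → Type} (L : (i : Fin k) → List (α i)) :
    (tuples L).length = ((List.finRange k).map fun i => (L i).length).prod := by
  induction k with
  | zero => simp [tuples]
  | succ k ih =>
    rw [tuples, List.length_flatMap, List.finRange_succ]
    simp [ih, comp_def]

/-- The mask follows the same lexicographic order as `tuples`, so its bits line up with the rows of
weights in a block. -/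
theorem mask_map_finRange {k : ℕ} {α : Fin k → Type} (L : (i : Fin k) → List (α i))
    (p : (i : Fin k) → α i → Bool) (team : Fin k → List (Option Bool))
    (h : ∀ i, (team i).reduceOption = (L i).map (p i)) :
    mask ((List.finRange k).map team) =
      (tuples L).map fun a => decide (∀ i, p i (a i) = true) := by
  induction k with
  | zero => simp [mask, tuples]
  | succ k ih =>
    rw [List.finRange_succ, List.map_cons, List.map_map, mask, h,
      show (team ∘ Fin.succ) = fun i => team i.succ from rfl,
      ih (fun i => L i.succ) (fun i => p i.succ) (fun i => team i.succ) fun i => h i.succ,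
      tuples, List.flatMap_map, List.map_flatMap]
    refine List.flatMap_congr fun x _ => ?_
    simp only [List.map_map]
    refine List.map_congr_left fun b _ => ?_
    simp [Fin.forall_fin_succ]

theorem length_mask (team : List (List (Option Bool))) :
    (mask team).length = (team.map fun ds => (ds.map Option.isSome).count true).prod := by
  have h : ∀ ds : List (Option Bool),
      ds.reduceOption.length = (ds.map Option.isSome).count true := fun ds => by
    induction ds with
    | nil => rfl
    | cons d ds ih => cases d <;> simp [ih, List.reduceOption_cons_of_some]
  induction team with
  | nil => rfl
  | cons ds team ih => simp [mask, List.length_flatMap, ih, h]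

/-! ### Descriptions of the states of an instance -/

theorem length_filterMap_dite {α : Type} {p : α → Prop} [DecidablePred p] (l : List α) :
    (l.filterMap fun a => if h : p a then some (⟨a, h⟩ : {a // p a}) else none).length =
      (l.map fun a => decide (p a)).count true := by
  induction l with
  | nil => rfl
  | cons a l ih => by_cases h : p a <;> simp [h, ih]

theorem reduceOption_map_dite {α β : Type} {p : α → Prop} [DecidablePred p]
    (f : {a // p a} → β) (l : List α) :
    (l.map fun a => if h : p a then some (f ⟨a, h⟩) else none).reduceOption =
      (l.filterMap fun a => if h : p a then some (⟨a, h⟩ : {a // p a}) else none).map f := by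
  induction l with
  | nil => rfl
  | cons a l ih =>
    by_cases h : p a
    · simp [h, ih, List.reduceOption_cons_of_some]
    · simp [h, ih, List.reduceOption_cons_of_none]

theorem eq_map_prodMk {α β γ : Type} {l : List (β × γ)} {T : List α} {f : α → β} {g : α → γ}
    (hf : l.map Prod.fst = T.map f) (hg : l.map Prod.snd = T.map g) :
    l = T.map fun a => (f a, g a) := by
  induction l generalizing T with
  | nil => cases T <;> simp_all
  | cons x l ih =>
    cases T with
    | nil => simp at hf
    | cons a T =>
      simp only [List.map_cons, List.cons.injEq] at hf hg ⊢
      exact ⟨Prod.ext hf.1 hg.1, ih hf.2 hg.2⟩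

theorem eq_map_getD {α : Type} {l : List α} {n : ℕ} (h : l.length = n) (d : α) :
    l = (List.finRange n).map fun i : Fin n => l.getD i d := by
  refine List.ext_getElem (by simp [h]) fun i h₁ h₂ => ?_
  simp [h₁]

/-- At the positions where `p` holds the digit is `some b`, so the default `false` is never used
there. -/
theorem eq_map_dite {n : ℕ} {p : Fin n → Prop} [DecidablePred p] {ds : List (Option Bool)}
    (h : ds.map Option.isSome = (List.finRange n).map fun a => decide (p a)) :
    ds = (List.finRange n).map fun a : Fin n =>
      if p a then some ((ds.getD a none).getD false) else none := by
  have hds := eq_map_getD (l := ds) (n := n) (by simpa using congrArg List.length h) none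
  rw [hds, List.map_map, List.map_inj_left] at h
  refine hds.trans (List.map_congr_left fun a ha => ?_)
  have ha := h a ha
  rw [comp_apply] at ha
  split_ifs with hp
  · rw [decide_eq_true hp, Option.isSome_iff_exists] at ha
    obtain ⟨b, hb⟩ := ha
    rw [hb, Option.getD_some]
  · rw [decide_eq_false hp, Option.isSome_eq_false_iff, Option.isNone_iff_eq_none] at ha
    exact ha

/-- The elements of a finite set of indices, in increasing order. -/
def charList {n : ℕ} (A : Finset (Fin n)) : List A :=
  (List.finRange n).filterMap fun a => if h : a ∈ A then some ⟨a, h⟩ else none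

theorem mem_charList {n : ℕ} {A : Finset (Fin n)} (a : A) : a ∈ charList A := by
  simp only [charList, List.mem_filterMap, List.mem_finRange, true_and]
  exact ⟨a, by simp⟩

theorem nodup_charList {n : ℕ} (A : Finset (Fin n)) : (charList A).Nodup := by
  refine List.Nodup.filterMap ?_ (List.nodup_finRange _)
  intro a a' b h h'
  simp only [Option.mem_def, Option.dite_none_right_eq_some, Option.some.injEq] at h h'
  obtain ⟨_, rfl⟩ := h
  obtain ⟨_, h'⟩ := h'
  exact (congrArg Subtype.val h').symm

theorem length_charList {n : ℕ} (A : Finset (Fin n)) :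
    (charList A).length = ((List.finRange n).map fun a => decide (a ∈ A)).count true :=
  length_filterMap_dite (p := fun a => a ∈ A) _

namespace Instance

variable (I : Instance)

theorem mem_avList {p : Fin (I.numTeam + 1)} {s : Fin I.numStates} (a : I.Av p s) :
    a ∈ I.avList p s :=
  mem_charList a

/-- The description of a state. -/
def plain (s : Fin I.numStates) : Plain where
  tgt := decide (s ∈ I.target)
  ini := decide (s = I.init)
  av := (List.finRange (I.numTeam + 1)).map fun p =>
    (List.finRange (I.numActions p)).map fun a => decide (a ∈ I.Av p s)
  rows := (tuples fun p => I.avList p s).map fun a => (List.finRange I.numStates).map (I.weight s a)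

theorem encState_eq (s : Fin I.numStates) : I.encState s = (I.plain s).enc := by
  simp [encState, Plain.enc, plain, encList, List.flatMap_map, encBit]

theorem encode_eq : I.encode = encList Plain.enc ((List.finRange I.numStates).map I.plain) := by
  rw [encode, show I.encState = fun s => (I.plain s).enc from funext I.encState_eq, encList_map,
    encList]

/-- The numbers of actions, in unary. -/
def shape : List Bool := unary ((List.finRange (I.numTeam + 1)).map I.numActions)

/-- The description of a state, with guesses and supports. -/
def record (s : Fin I.numStates) (md : Mode) (B : (p : Fin I.numTeam) → I.Av p.succ s → Bool) :
    Rec where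
  md := md
  opp := (List.finRange (I.numActions 0)).map fun a => decide (a ∈ I.Av 0 s)
  team := (List.finRange I.numTeam).map fun p => (List.finRange (I.numActions p.succ)).map
    fun a : Fin (I.numActions p.succ) => if h : a ∈ I.Av p.succ s then some (B p ⟨a, h⟩) else none
  blocks := (I.avList 0 s).map fun b => (tuples fun p : Fin I.numTeam => I.avList p.succ s).map
    fun a => (decide (∀ p, B p (a p) = true),
      (List.finRange I.numStates).map (I.weight s (Fin.cons b a)))

theorem mask_record_team (s : Fin I.numStates) (md : Mode)
    (B : (p : Fin I.numTeam) → I.Av p.succ s → Bool) :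
    mask (I.record s md B).team = (tuples fun p : Fin I.numTeam => I.avList p.succ s).map
      fun a => decide (∀ p, B p (a p) = true) :=
  mask_map_finRange _ B _ fun p =>
    reduceOption_map_dite (p := fun a => a ∈ I.Av p.succ s) (B p) _

theorem plain_record (s : Fin I.numStates) (md : Mode)
    (B : (p : Fin I.numTeam) → I.Av p.succ s → Bool) (htgt : md.tgt = decide (s ∈ I.target))
    (hini : md.ini = decide (s = I.init)) : (I.record s md B).plain = I.plain s := by
  ext1
  · exact htgt
  · exact hini
  · simp only [Rec.plain, record, plain, List.finRange_succ, List.map_cons, List.map_map,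
      List.cons.injEq, true_and]
    refine List.map_congr_left fun p _ => ?_
    simp only [comp_apply, List.map_map]
    refine List.map_congr_left fun a _ => ?_
    by_cases h : a ∈ I.Av p.succ s <;> simp [h]
  · simp only [Rec.plain, record, plain, tuples, List.map_flatten, List.map_map, List.map_flatMap]
    rw [List.flatMap_def]
    congr 1
    refine List.map_congr_left fun b _ => ?_
    simp only [comp_apply, List.map_map]
    rfl

/-- The guessed bits are read off the digits of the team, and the availability of actions is visible
in the input. The flags attached to the rows are then forced to be the mask. -/
theorem eq_record {s : Fin I.numStates} {r : Rec} {sh : List Bool} {is : List Info}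
    (hr : r.OK sh is) (hp : r.plain = I.plain s) :
    ∃ B : (p : Fin I.numTeam) → I.Av p.succ s → Bool, r = I.record s r.md B := by
  have hav := congrArg Plain.av hp
  have hrows := congrArg Plain.rows hp
  simp only [Rec.plain, plain, List.finRange_succ, List.map_cons, List.cons.injEq,
    List.map_map] at hav hrows
  obtain ⟨hopp, hteam⟩ := hav
  let B : (p : Fin I.numTeam) → I.Av p.succ s → Bool := fun p a =>
    ((r.team.getD p []).getD a.1 none).getD false
  have hlen : r.team.length = I.numTeam := by simpa using congrArg List.length hteam
  have hteam' : r.team = (I.record s r.md B).team := by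
    have h1 := eq_map_getD hlen []
    rw [h1, List.map_map, List.map_inj_left] at hteam
    exact h1.trans (List.map_congr_left fun p hp => eq_map_dite (hteam p hp))
  refine ⟨B, ?_⟩
  have hmask : mask r.team = _ := hteam' ▸ I.mask_record_team s r.md B
  have hcount : r.blocks.length = (I.avList 0 s).length := by
    rw [hr.length_blocks, hopp]
    exact (length_charList (I.Av 0 s)).symm
  have hsnd : r.blocks.map (fun rs => rs.map Prod.snd) = (I.avList 0 s).map fun b =>
      (tuples fun p : Fin I.numTeam => I.avList p.succ s).map fun a =>
        (List.finRange I.numStates).map (I.weight s (Fin.cons b a)) := by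
    -- The input shows only the concatenation of the blocks. As each block has the length of the
    -- mask, the division into blocks is determined.
    rw [List.eq_iff_flatten_eq]
    constructor
    · rw [← List.map_flatten, hrows, tuples, List.map_flatMap, List.flatMap_def]
      simp only [List.map_map]
      rfl
    · refine List.ext_getElem (by simpa using hcount) fun i h₁ h₂ => ?_
      have h₁' : i < r.blocks.length := by simpa using h₁
      have := congrArg List.length (hr.blocks_ok _ (List.getElem_mem h₁')).1
      rw [hmask] at this
      simpa using this
  have hblocks : r.blocks = (I.record s r.md B).blocks := by
    refine List.ext_getElem (by simpa [record] using hcount) fun i h₁ h₂ => ?_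
    have h3 := (hr.blocks_ok _ (List.getElem_mem h₁)).1
    rw [hmask] at h3
    have h₁' : i < (I.avList 0 s).length := hcount ▸ h₁
    have h4 := congrArg (fun l => l[i]?) hsnd
    simp only [List.getElem?_map, List.getElem?_eq_getElem h₁, List.getElem?_eq_getElem h₁',
      Option.map_some, Option.some.injEq] at h4
    simp only [record, List.getElem_map]
    exact eq_map_prodMk h3 h4
  obtain ⟨md, opp, team, blocks⟩ := r
  simp only at hopp hteam' hblocks
  rw [Rec.mk.injEq]
  exact ⟨rfl, hopp, hteam', hblocks⟩

theorem rowOK_map_finRange {n : ℕ} {c w : Info → Bool} {info : Fin n → Info} {g : Fin n → ℕ} :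
    RowOK c w ((List.finRange n).map info) ((List.finRange n).map g) ↔
      (∀ t, g t ≠ 0 → c (info t) = true) ∧ ∃ t, g t ≠ 0 ∧ w (info t) = true := by
  have hz : ((List.finRange n).map g).zip ((List.finRange n).map info) =
      (List.finRange n).map fun t => (g t, info t) := by
    rw [List.zip_map']
  simp only [RowOK, hz, List.length_map, true_and, List.mem_map, List.mem_finRange]
  constructor
  · rintro ⟨h1, _, ⟨t, rfl⟩, ht⟩
    exact ⟨fun t => h1 _ ⟨t, rfl⟩, t, ht⟩
  · rintro ⟨h1, t, ht⟩
    refine ⟨?_, _, ⟨t, rfl⟩, ht⟩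
    rintro _ ⟨t, rfl⟩
    exact h1 t

/-- For the record of a genuine state the conditions on availability and on the number of blocks
hold automatically. What remains are the permitted transitions and, for a non-target state that is
to be ranked, a transition to a ranked state for every action of the opponent. -/
theorem record_ok_iff {s : Fin I.numStates} {md : Mode}
    {B : (p : Fin I.numTeam) → I.Av p.succ s → Bool} {sh : List Bool}
    {info : Fin I.numStates → Info} :
    (I.record s md B).OK sh ((List.finRange I.numStates).map info) ↔
      (!md.add || md.win) = true ∧ sh = I.shape ∧ ∀ b : I.Av 0 s,
        (∀ a : (p : Fin I.numTeam) → I.Av p.succ s, ∀ t, I.weight s (Fin.cons b a) t ≠ 0 →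
          md.permits (decide (∀ p, B p (a p) = true)) (info t) = true) ∧
        (md.check = true → ∃ a : (p : Fin I.numTeam) → I.Av p.succ s,
          (∀ p, B p (a p) = true) ∧ ∃ t, I.weight s (Fin.cons b a) t ≠ 0 ∧
            (info t).core.done = true) := by
  have hshape : TeamGames.shape (I.record s md B).opp (I.record s md B).team = I.shape := by
    simp [TeamGames.shape, shape, record, List.finRange_succ, comp_def]
  have hmem : ∀ a : (p : Fin I.numTeam) → I.Av p.succ s,
      a ∈ tuples fun p : Fin I.numTeam => I.avList p.succ s :=
    fun a => mem_tuples.2 fun _ => I.mem_avList _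
  constructor
  · rintro ⟨h1, h2, -, -, -, h6⟩
    refine ⟨h1, h2.trans hshape, fun b => ?_⟩
    obtain ⟨-, h7, h8⟩ := h6 _ (List.mem_map_of_mem (I.mem_avList b))
    constructor
    · intro a
      exact (rowOK_map_finRange.1 (h7 _ (List.mem_map_of_mem (hmem a)))).1
    · intro hc
      obtain ⟨_, hr, htrue, hrow⟩ := h8 hc
      obtain ⟨a, -, rfl⟩ := List.mem_map.1 hr
      exact ⟨a, of_decide_eq_true htrue, (rowOK_map_finRange.1 hrow).2⟩
  · rintro ⟨h1, h2, h3⟩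
    refine ⟨h1, h2.trans hshape.symm, ?_, ?_, ?_, ?_⟩
    · obtain ⟨a, ha⟩ := I.Av_nonempty 0 s
      exact List.mem_map.2 ⟨a, List.mem_finRange _, decide_eq_true ha⟩
    · intro ds hds
      obtain ⟨p, -, rfl⟩ := List.mem_map.1 hds
      obtain ⟨a, ha⟩ := I.Av_nonempty p.succ s
      exact ⟨B p ⟨a, ha⟩, List.mem_map.2 ⟨a, List.mem_finRange _, dif_pos ha⟩⟩
    · simp only [record, List.length_map]
      exact length_charList (I.Av 0 s)
    · intro rs hrs
      obtain ⟨b, -, rfl⟩ := List.mem_map.1 hrs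
      refine ⟨?_, ?_, ?_⟩
      · rw [mask_record_team, List.map_map]
        rfl
      · intro r hr
        obtain ⟨a, -, rfl⟩ := List.mem_map.1 hr
        refine rowOK_map_finRange.2 ⟨(h3 b).1 a, ?_⟩
        obtain ⟨t, ht⟩ := I.weight_ne_zero s (Fin.cons b a)
        exact ⟨t, ht, rfl⟩
      · intro hc
        obtain ⟨a, ha, ht⟩ := (h3 b).2 hc
        refine ⟨_, List.mem_map_of_mem (hmem a), decide_eq_true ha, rowOK_map_finRange.2 ⟨?_, ht⟩⟩
        have := (h3 b).1 a
        rwa [decide_eq_true ha] at this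

end Instance

/-! ### Positions -/

/-- The record of the state `t` when the state `s` is parsed. -/
def infoAt {n : ℕ} (md : Fin n → Mode) (s t : Fin n) : Info :=
  if t < s then .pre (md t).after else if t = s then .cur (md t).before else .post (md t).before

/-- While `s` is parsed, the states before it already carry their updated records; a state may
therefore rely on states ranked earlier in the same round. -/
theorem track_eq_map_infoAt {n : ℕ} {f : Fin n → Rec} {rs₁ rs₂ : List Rec} {r : Rec}
    (h : (List.finRange n).map f = rs₁ ++ r :: rs₂) :
    ∃ s : Fin n, r = f s ∧ (s : ℕ) = rs₁.length ∧
      track (rs₁.map fun r => r.md.after) ((r :: rs₂).map fun r => r.md.before) =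
        (List.finRange n).map (infoAt (fun s => (f s).md) s) := by
  have hn : n = rs₁.length + (rs₂.length + 1) := by simpa using congrArg List.length h
  have hget : ∀ i (hi : i < n), (rs₁ ++ r :: rs₂)[i]? = some (f ⟨i, hi⟩) := fun i hi => by
    rw [← h]
    simp [hi]
  let s : Fin n := ⟨rs₁.length, by omega⟩
  refine ⟨s, ?_, rfl, ?_⟩
  · have := hget rs₁.length (by omega)
    simpa using this
  · refine List.ext_getElem (by simp [length_track, hn]) fun i h₁ h₂ => ?_
    have hi : i < n := by simpa using h₂
    have hgi := hget i hi
    simp only [List.getElem_map, List.getElem_finRange, Fin.cast_mk, infoAt, s, Fin.mk_lt_mk,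
      Fin.mk.injEq]
    rcases lt_trichotomy i rs₁.length with hlt | heq | hgt
    · rw [if_pos hlt]
      rw [List.getElem?_append_left hlt, List.getElem?_eq_getElem hlt, Option.some.injEq] at hgi
      simp [track, hlt, hgi]
    · subst heq
      rw [if_neg (lt_irrefl _), if_pos rfl]
      simp at hgi
      simp [track, ← hgi]
    · rw [if_neg (by omega), if_neg (by omega)]
      obtain ⟨k, rfl⟩ : ∃ k, i = rs₁.length + (k + 1) := ⟨i - rs₁.length - 1, by omega⟩
      have hk : k < rs₂.length := by omega
      rw [List.getElem?_append_right (by omega)] at hgi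
      simp [hk] at hgi
      simp [track, ← hgi]

theorem roundOK_map_finRange {n : ℕ} {f : Fin n → Rec} {sh : List Bool} :
    RoundOK sh ((List.finRange n).map f) ↔
      ∀ s, (f s).OK sh ((List.finRange n).map (infoAt (fun s => (f s).md) s)) := by
  constructor
  · intro h s
    obtain ⟨l₁, l₂, hl⟩ := List.append_of_mem (List.mem_finRange s)
    have hl' : (List.finRange n).map f = l₁.map f ++ f s :: l₂.map f := by
      rw [hl, List.map_append, List.map_cons]
    have hs : (s : ℕ) = l₁.length := by
      have h1 : (List.finRange n)[l₁.length]? = some s := by rw [hl]; simp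
      rw [List.getElem?_eq_some_iff] at h1
      obtain ⟨_, h1⟩ := h1
      rw [← h1]
      simp
    obtain ⟨s', -, hs', htrack⟩ := track_eq_map_infoAt hl'
    obtain rfl : s' = s := Fin.ext (by rw [hs, hs', List.length_map])
    rw [← htrack]
    exact h _ _ _ hl'
  · intro h rs₁ r rs₂ e
    obtain ⟨s, rfl, -, hs⟩ := track_eq_map_infoAt e
    rw [hs]
    exact h s

/-! ### Reconstructing an instance -/

instance : Inhabited Plain := ⟨⟨false, false, [], []⟩⟩

/-- The descriptions `ps` of states fit together. -/
structure ValidInput (ps : List Plain) (shp : List ℕ) (i₀ : ℕ) : Prop where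
  init_lt : i₀ < ps.length
  ini : ∀ i (h : i < ps.length), ps[i].ini = decide (i = i₀)
  shape : ∀ p ∈ ps, p.av.map List.length = shp
  avail : ∀ p ∈ ps, ∀ l ∈ p.av, true ∈ l
  length_rows : ∀ p ∈ ps, p.rows.length = (p.av.map (List.count true)).prod
  length_row : ∀ p ∈ ps, ∀ row ∈ p.rows, row.length = ps.length
  row_ne_zero : ∀ p ∈ ps, ∀ row ∈ p.rows, ∃ n ∈ row, n ≠ 0
  absorbing : ∀ i (h : i < ps.length), ps[i].tgt = true → ∀ row ∈ ps[i].rows, ∀ j,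
    row.getD j 0 ≠ 0 → j = i

/-- The set of available actions that is described. -/
def inputAv (ps : List Plain) (shp : List ℕ) (p s : ℕ) : Finset (Fin (shp.getD p 0)) :=
  {a | ((((ps.getD s default).av.getD p []).getD a false) = true)}

/-- The tuples of available actions that are described. -/
def inputTuples (ps : List Plain) (shp : List ℕ) {m : ℕ} (s : ℕ) :
    List ((p : Fin m) → inputAv ps shp p s) :=
  tuples fun p => charList (inputAv ps shp p s)

namespace ValidInput

variable {ps : List Plain} {shp : List ℕ} {i₀ : ℕ} (h : ValidInput ps shp i₀)

theorem getD_mem (s : Fin ps.length) : ps.getD s default ∈ ps := by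
  rw [List.getD_eq_getElem _ _ s.2]
  exact List.getElem_mem _

include h

theorem length_av (s : Fin ps.length) : (ps.getD s default).av.length = shp.length := by
  rw [← h.shape _ (getD_mem s), List.length_map]

theorem length_getD_av (s : Fin ps.length) {p : ℕ} (hp : p < shp.length) :
    ((ps.getD s default).av.getD p []).length = shp.getD p 0 := by
  have h1 : p < (ps.getD s default).av.length := h.length_av s ▸ hp
  rw [List.getD_eq_getElem _ _ h1, List.getD_eq_getElem _ _ hp]
  have := h.shape _ (getD_mem s)
  simp only [← this, List.getElem_map]

theorem map_mem_inputAv (s : Fin ps.length) {p : ℕ} (hp : p < shp.length) :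
    ((List.finRange (shp.getD p 0)).map fun a => decide (a ∈ inputAv ps shp p s)) =
      (ps.getD s default).av.getD p [] := by
  refine Eq.trans ?_ (eq_map_getD (h.length_getD_av s hp) false).symm
  refine List.map_congr_left fun a _ => ?_
  simp [inputAv]

theorem inputAv_nonempty (s : Fin ps.length) {p : ℕ} (hp : p < shp.length) :
    (inputAv ps shp p s).Nonempty := by
  have h1 : p < (ps.getD s default).av.length := h.length_av s ▸ hp
  have h2 : true ∈ (ps.getD s default).av.getD p [] := by
    refine h.avail _ (getD_mem s) _ ?_
    rw [List.getD_eq_getElem _ _ h1]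
    exact List.getElem_mem _
  rw [← h.map_mem_inputAv s hp, List.mem_map] at h2
  obtain ⟨a, -, ha⟩ := h2
  exact ⟨a, of_decide_eq_true ha⟩

/-- There are exactly as many rows as tuples, so looking up the row of a tuple by its position never
leaves the list. -/
theorem length_inputTuples (s : Fin ps.length) :
    (inputTuples ps shp (m := shp.length) s).length = (ps.getD s default).rows.length := by
  rw [inputTuples, length_tuples, h.length_rows _ (getD_mem s)]
  congr 1
  have h1 := eq_map_getD (h.length_av s) []
  conv_rhs => rw [h1]
  rw [List.map_map]
  refine List.map_congr_left fun p _ => ?_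
  rw [length_charList, h.map_mem_inputAv s p.2]
  rfl

end ValidInput

theorem mem_inputTuples {ps : List Plain} {shp : List ℕ} {m : ℕ} {s : ℕ}
    (a : (p : Fin m) → inputAv ps shp p s) : a ∈ inputTuples ps shp s :=
  mem_tuples.2 fun _ => mem_charList _

theorem nodup_inputTuples (ps : List Plain) (shp : List ℕ) {m : ℕ} (s : ℕ) :
    (inputTuples ps shp (m := m) s).Nodup :=
  nodup_tuples fun _ => nodup_charList _

/-- The weights that are described. -/
def inputRow (ps : List Plain) (shp : List ℕ) {m : ℕ} (s : ℕ)
    (a : (p : Fin m) → inputAv ps shp p s) : List ℕ :=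
  (ps.getD s default).rows.getD ((inputTuples ps shp s).idxOf a) []

theorem ValidInput.inputRow_mem {ps : List Plain} {shp : List ℕ} {i₀ : ℕ}
    (h : ValidInput ps shp i₀) (s : Fin ps.length)
    (a : (p : Fin shp.length) → inputAv ps shp p s) :
    inputRow ps shp s a ∈ (ps.getD s default).rows := by
  have hlt : (inputTuples ps shp s).idxOf a < (ps.getD s default).rows.length := by
    rw [← h.length_inputTuples s]
    exact List.idxOf_lt_length_of_mem (mem_inputTuples a)
  rw [inputRow, List.getD_eq_getElem (l := (ps.getD s default).rows) _ hlt]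
  exact List.getElem_mem _

/-- The tuples are listed without repetition, so the position of the `i`-th tuple is `i` and its row
is the `i`-th row of the input. -/
theorem ValidInput.map_inputRow {ps : List Plain} {shp : List ℕ} {i₀ : ℕ}
    (h : ValidInput ps shp i₀) (s : Fin ps.length) :
    (inputTuples ps shp (m := shp.length) s).map (fun a => (List.finRange ps.length).map
      fun t : Fin ps.length => (inputRow ps shp s a).getD t 0) = (ps.getD s default).rows := by
  refine List.ext_getElem (by simpa using h.length_inputTuples s) fun i h₁ h₂ => ?_
  rw [List.getElem_map, ← eq_map_getD (h.length_row _ (getD_mem s) _ (h.inputRow_mem s _)) 0,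
    inputRow, (nodup_inputTuples ps shp s).idxOf_getElem, List.getD_eq_getElem _ _ h₂]

/-- The described data are themselves taken as the instance. The list of numbers of actions is
nonempty because its head belongs to the opponent. -/
theorem ValidInput.exists_instance {ps : List Plain} {k : ℕ} {shp : List ℕ} {i₀ : ℕ}
    (h : ValidInput ps (k :: shp) i₀) :
    ∃ I : Instance, (List.finRange I.numStates).map I.plain = ps := by
  let I : Instance := {
    numStates := ps.length
    numTeam := shp.length
    numActions := fun p => (k :: shp).getD p 0
    Av := fun p s => inputAv ps (k :: shp) p s
    Av_nonempty := fun p s => h.inputAv_nonempty s p.2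
    weight := fun s a t => (inputRow ps (k :: shp) s a).getD t 0
    weight_ne_zero := fun s a => by
      have hmem := h.inputRow_mem s a
      obtain ⟨n, hn, hn0⟩ := h.row_ne_zero _ (getD_mem s) _ hmem
      have hlen := h.length_row _ (getD_mem s) _ hmem
      obtain ⟨j, hj, rfl⟩ := List.mem_iff_getElem.1 hn
      exact ⟨⟨j, hlen ▸ hj⟩, by rwa [List.getD_eq_getElem _ _ hj]⟩
    target := {s : Fin ps.length | (ps.getD s default).tgt = true}
    init := ⟨i₀, h.init_lt⟩
    absorbing := fun s hs a t hne => by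
      by_contra hw
      have hmem := h.inputRow_mem s a
      have hs' : (ps.getD s default).tgt = true := by simpa using hs
      rw [List.getD_eq_getElem _ _ s.2] at hs' hmem
      exact hne (Fin.ext (h.absorbing s s.2 hs' _ hmem t hw)) }
  refine ⟨I, ?_⟩
  refine Eq.trans ?_ (eq_map_getD (l := ps) rfl default).symm
  refine List.map_congr_left fun s _ => ?_
  ext1
  · simp [Instance.plain, I]
  · have := h.ini s s.2
    simp only [Instance.plain, I, Fin.ext_iff]
    rw [List.getD_eq_getElem _ _ s.2, this]
  · refine Eq.trans ?_ (eq_map_getD (h.length_av s) []).symm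
    exact List.map_congr_left fun p _ => h.map_mem_inputAv s p.2
  · exact h.map_inputRow s

/-! ### The first reading of the input -/

theorem unary_injective : Injective unary := by
  have key : ∀ (n m : ℕ) (u v : List Bool), List.replicate n true ++ false :: u =
      List.replicate m true ++ false :: v → n = m ∧ u = v := by
    intro n
    induction n with
    | zero => intro m u v h; cases m <;> simp_all [List.replicate_succ]
    | succ n ih =>
      intro m u v h
      cases m with
      | zero => simp [List.replicate_succ] at h
      | succ m =>
        simp only [List.replicate_succ, List.cons_append, List.cons.injEq, true_and] at h
        obtain ⟨rfl, rfl⟩ := ih _ _ _ h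
        exact ⟨rfl, rfl⟩
  intro l
  induction l with
  | nil => intro l' h; cases l' <;> simp_all [unary]
  | cons n l ih =>
    intro l' h
    cases l' with
    | nil => simp [unary] at h
    | cons m l' =>
      rw [unary_cons, unary_cons] at h
      obtain ⟨rfl, h'⟩ := key _ _ _ _ h
      rw [ih h']

theorem Rec.map_length_av (r : Rec) :
    r.plain.av.map List.length = r.opp.length :: r.team.map List.length := by
  simp [Rec.plain, comp_def]

theorem Rec.OK.length_rows {r : Rec} {sh : List Bool} {is : List Info} (hr : r.OK sh is) :
    r.plain.rows.length = (r.plain.av.map (List.count true)).prod := by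
  have h1 : ∀ rs ∈ r.blocks, rs.length = (mask r.team).length := fun rs hrs => by
    rw [← (hr.blocks_ok rs hrs).1, List.length_map]
  have h2 : r.blocks.map List.length =
      List.replicate r.blocks.length (mask r.team).length := by
    rw [List.eq_replicate_iff]
    simpa using h1
  simp only [Rec.plain, List.length_map, List.length_flatten, h2, List.sum_replicate, smul_eq_mul,
    List.map_cons, List.prod_cons, hr.length_blocks, length_mask, List.map_map]
  rfl

theorem Rec.OK.rowOK {r : Rec} {sh : List Bool} {is : List Info} (hr : r.OK sh is)
    {row : List ℕ} (hrow : row ∈ r.plain.rows) :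
    ∃ b, RowOK (r.md.permits b) (fun _ => true) is row := by
  obtain ⟨e, he, rfl⟩ := List.mem_map.1 hrow
  obtain ⟨rs, hrs, he⟩ := List.mem_flatten.1 he
  exact ⟨e.1, (hr.blocks_ok rs hrs).2.1 e he⟩

/-- One complete round already certifies that the input is well formed. The guessed records contain
exactly one initial state, the common guess of the numbers of actions aligns the states, each row
has one weight per state and a nonzero one among them, and at a target only the transition to the
state itself is permitted, so targets are absorbing. -/
theorem exists_instance_of_roundOK {sh : List Bool} {rs : List Rec} (hrs : RoundOK sh rs)
    (hini : Initial (rs.map fun r => r.md.before)) :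
    ∃ I : Instance, (List.finRange I.numStates).map I.plain = rs.map Rec.plain := by
  obtain ⟨l, l', hl⟩ := hini
  have hlen : rs.length = l.length + (l'.length + 1) := by simpa using congrArg List.length hl
  let f : Fin rs.length → Rec := fun i => rs[i]
  have hf : rs = (List.finRange rs.length).map f := by
    refine List.ext_getElem (by simp) fun i h₁ h₂ => ?_
    simp [f]
  have hok : ∀ s, (f s).OK sh ((List.finRange rs.length).map (infoAt (fun s => (f s).md) s)) :=
    roundOK_map_finRange.1 (hf ▸ hrs)
  have hmem : ∀ p ∈ rs.map Rec.plain, ∃ s, p = (f s).plain := by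
    intro p hp
    obtain ⟨r, hr, rfl⟩ := List.mem_map.1 hp
    obtain ⟨i, hi, rfl⟩ := List.mem_iff_getElem.1 hr
    exact ⟨⟨i, hi⟩, rfl⟩
  refine ValidInput.exists_instance (k := (f ⟨0, by omega⟩).opp.length)
    (shp := (f ⟨0, by omega⟩).team.map List.length) (i₀ := l.length) ⟨by simp [hlen], ?_, ?_, ?_, ?_,
    ?_, ?_, ?_⟩
  · intro i hi
    have hi' : i < rs.length := by simpa using hi
    have h1 : (rs.map fun r => r.md.before)[i]? = some (rs[i]).md.before := by simp [hi']
    have h2 : ((rs.map Rec.plain)[i]).ini = (rs[i]).md.before.ini := by simp [Rec.plain, Mode.before]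
    rw [h2]
    rw [hl] at h1
    rcases lt_trichotomy i l.length with hlt | heq | hgt
    · rw [List.getElem?_append_left (by simpa using hlt)] at h1
      simp only [List.getElem?_map, List.getElem?_eq_getElem hlt, Option.map_some,
        Option.some.injEq] at h1
      rw [← h1, decide_eq_false (by omega)]
    · subst heq
      rw [List.getElem?_append_right (by simp)] at h1
      simp only [List.length_map, Nat.sub_self, List.getElem?_cons_zero, Option.some.injEq] at h1
      rw [← h1, decide_eq_true rfl]
    · obtain ⟨j, rfl⟩ : ∃ j, i = l.length + (j + 1) := ⟨i - l.length - 1, by omega⟩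
      have hj : j < l'.length := by omega
      rw [List.getElem?_append_right (by simp)] at h1
      simp [hj] at h1
      rw [← h1, decide_eq_false (by omega)]
  · intro p hp
    obtain ⟨s, rfl⟩ := hmem p hp
    rw [Rec.map_length_av]
    exact unary_injective ((hok s).shape_eq.symm.trans (hok ⟨0, by omega⟩).shape_eq)
  · intro p hp
    obtain ⟨s, rfl⟩ := hmem p hp
    intro w hw
    rcases List.mem_cons.1 hw with rfl | hw
    · exact (hok s).opp_mem
    · obtain ⟨ds, hds, rfl⟩ := List.mem_map.1 hw
      obtain ⟨b, hb⟩ := (hok s).team_mem ds hds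
      exact List.mem_map.2 ⟨some b, hb, rfl⟩
  · intro p hp
    obtain ⟨s, rfl⟩ := hmem p hp
    exact (hok s).length_rows
  · intro p hp row hrow
    obtain ⟨s, rfl⟩ := hmem p hp
    obtain ⟨b, hb⟩ := (hok s).rowOK hrow
    simpa using hb.1
  · intro p hp row hrow
    obtain ⟨s, rfl⟩ := hmem p hp
    obtain ⟨b, hb⟩ := (hok s).rowOK hrow
    obtain ⟨e, he, hne, -⟩ := hb.2.2
    exact ⟨e.1, (List.of_mem_zip (a := e.1) (b := e.2) he).1, hne⟩
  · intro i hi htgt row hrow j hj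
    have hi' : i < rs.length := by simpa using hi
    rw [List.getElem_map] at htgt hrow
    obtain ⟨b, hb⟩ := (hok ⟨i, hi'⟩).rowOK hrow
    have hjlen : j < row.length := by
      by_contra hge
      exact hj (List.getD_eq_default _ _ (not_lt.1 hge))
    have hjn : j < rs.length := by
      have := hb.1
      simp at this
      omega
    rw [List.getD_eq_getElem _ _ hjlen] at hj
    -- At a target a nonzero weight is permitted only at the record marked `cur`, and the only such
    -- position is that of the state itself.
    have h1 := hb.2.1 (row[j], infoAt (fun s => (f s).md) ⟨i, hi'⟩ ⟨j, hjn⟩) (by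
      rw [List.mem_iff_getElem]
      refine ⟨j, by simpa using ⟨hjlen, hjn⟩, ?_⟩
      simp) hj
    have h2 : (f ⟨i, hi'⟩).md.tgt = true := htgt
    rw [Mode.permits, if_pos h2, infoAt] at h1
    by_contra hne
    split_ifs at h1 with h3 h4
    · simp [Info.isCur] at h1
    · exact hne (by simpa using h4)
    · simp [Info.isCur] at h1

/-! ### Correctness of the verifier -/

theorem core_win_infoAt {n : ℕ} (md : Fin n → Mode) (s t : Fin n) :
    (infoAt md s t).core.win = (md t).win := by
  unfold infoAt
  split_ifs <;> rfl

theorem core_done_infoAt {n : ℕ} (md : Fin n → Mode) (s t : Fin n) :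
    (infoAt md s t).core.done = if t < s then (md t).after.done else (md t).before.done := by
  unfold infoAt
  split_ifs <;> rfl

theorem isCur_infoAt {n : ℕ} (md : Fin n → Mode) (s t : Fin n) :
    (infoAt md s t).isCur = true ↔ t = s := by
  unfold infoAt
  split_ifs with h h'
  · simp [Info.isCur, h.ne]
  · simp [Info.isCur, h']
  · simp [Info.isCur, h']

namespace Instance

variable {I : Instance}

theorem toGame_δ_ne_zero {s : Fin I.numStates} {a : (p : Fin (I.numTeam + 1)) → I.Av p s}
    {t : Fin I.numStates} : I.toGame.δ s a t ≠ 0 ↔ I.weight s a t ≠ 0 := by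
  simp only [toGame, PMF.ofFintype_apply, ne_eq, ENNReal.div_eq_zero_iff,
    ENNReal.natCast_ne_top, or_false, Nat.cast_eq_zero]

/-- Supports for the team, extended to the opponent. -/
def extendSupp {s : Fin I.numStates} (B : (p : Fin I.numTeam) → I.Av p.succ s → Bool) :
    (p : Fin (I.numTeam + 1)) → I.Av p s → Bool :=
  Fin.cons (α := fun p => I.Av p s → Bool) (fun _ => true) B

theorem inSupp_cons {s : Fin I.numStates} {B : (p : Fin (I.numTeam + 1)) → I.Av p s → Bool}
    {b : I.Av 0 s} {a : (p : Fin I.numTeam) → I.Av p.succ s} :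
    I.toGame.InSupp 0 B (Fin.cons (α := fun p => I.Av p s) b a : (p : Fin (I.numTeam + 1)) → I.Av p s) ↔
      ∀ p : Fin I.numTeam, B p.succ (a p) = true := by
  constructor
  · intro h p
    exact h p.succ (Fin.succ_ne_zero p)
  · intro h p hp
    induction p using Fin.cases with
    | zero => exact absurd rfl hp
    | succ p => exact h p

theorem closed_iff {s : Fin I.numStates} {B : (p : Fin (I.numTeam + 1)) → I.Av p s → Bool}
    {W : Set (Fin I.numStates)} : I.toGame.Closed 0 W B ↔
      ∀ (b : I.Av 0 s) (a : (p : Fin I.numTeam) → I.Av p.succ s),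
        (∀ p : Fin I.numTeam, B p.succ (a p) = true) →
          ∀ t, I.weight s (Fin.cons b a) t ≠ 0 → t ∈ W := by
  constructor
  · intro h b a ha t ht
    exact h _ (inSupp_cons.2 ha) t (toGame_δ_ne_zero.2 ht)
  · intro h a ha t ht
    have hc : (Fin.cons (α := fun p => I.Av p s) (a 0) (fun p : Fin I.numTeam => a p.succ) :
        (p : Fin (I.numTeam + 1)) → I.Av p s) = a := Fin.cons_self_tail a
    refine h (a 0) (fun p => a p.succ) (fun p => ha _ (Fin.succ_ne_zero p)) t ?_
    rw [hc]
    exact toGame_δ_ne_zero.1 ht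

theorem hits_iff {s : Fin I.numStates} {B : (p : Fin (I.numTeam + 1)) → I.Av p s → Bool}
    {D : Set (Fin I.numStates)} : I.toGame.Hits 0 D B ↔
      ∀ b : I.Av 0 s, ∃ a : (p : Fin I.numTeam) → I.Av p.succ s,
        (∀ p : Fin I.numTeam, B p.succ (a p) = true) ∧
          ∃ t, I.weight s (Fin.cons b a) t ≠ 0 ∧ t ∈ D := by
  constructor
  · intro h b
    obtain ⟨a, hb, ha, t, ht, hδ⟩ := h b
    have hc : (Fin.cons (α := fun p => I.Av p s) b (fun p : Fin I.numTeam => a p.succ) :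
        (p : Fin (I.numTeam + 1)) → I.Av p s) = a := by
      rw [← hb]
      exact Fin.cons_self_tail a
    refine ⟨fun p => a p.succ, fun p => ha _ (Fin.succ_ne_zero p), t, ?_, ht⟩
    rw [hc]
    exact toGame_δ_ne_zero.1 hδ
  · intro h b
    obtain ⟨a, ha, t, hw, ht⟩ := h b
    exact ⟨_, rfl, inSupp_cons.2 ha, t, ht, toGame_δ_ne_zero.2 hw⟩

/-! ### Soundness -/

/-- For a non-target state that is being ranked, rows in the supports permit only transitions into
the guessed region, which is closedness. The required good row for each action of the opponent is
the hitting condition, relative to the states ranked before `s` is parsed. -/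
theorem addable_of_record_ok {md : Fin I.numStates → Mode} {s : Fin I.numStates}
    {B : (p : Fin I.numTeam) → I.Av p.succ s → Bool} {sh : List Bool}
    (htgt : (md s).tgt = decide (s ∈ I.target)) (hadd : (md s).add = true)
    (h : (I.record s (md s) B).OK sh ((List.finRange I.numStates).map (infoAt md s))) :
    I.toGame.Addable 0 {t | (md t).win = true} {t | (infoAt md s t).core.done = true} s := by
  obtain ⟨hwin, -, hB⟩ := I.record_ok_iff.1 h
  refine ⟨by simpa [hadd] using hwin, ?_⟩
  by_cases hs : s ∈ I.target
  · exact Or.inl hs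
  · rw [decide_eq_false hs] at htgt
    refine Or.inr ⟨extendSupp B, closed_iff.2 fun b a ha t ht => ?_, hits_iff.2 fun b => ?_⟩
    · have h1 := (hB b).1 a t ht
      have ha' : decide (∀ p, B p (a p) = true) = true := decide_eq_true ha
      rw [Mode.permits, htgt, hadd, ha', core_win_infoAt] at h1
      simpa using h1
    · exact (hB b).2 (by simp [Mode.check, hadd, htgt])

/-- The states are treated in the order of the input, the set of ranked states being the updated one
below `k` and the old one from `k` on. A state that is newly ranked extends the chain; one that was
ranked already leaves the set unchanged. -/
theorem chain_of_records_ok {md : Fin I.numStates → Mode}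
    {B : (s : Fin I.numStates) → (p : Fin I.numTeam) → I.Av p.succ s → Bool} {sh : List Bool}
    (htgt : ∀ s, (md s).tgt = decide (s ∈ I.target))
    (h : ∀ s, (I.record s (md s) (B s)).OK sh ((List.finRange I.numStates).map (infoAt md s)))
    (hc : I.toGame.Chain 0 {s | (md s).win = true} {s | (md s).before.done = true}) :
    I.toGame.Chain 0 {s | (md s).win = true} {s | (md s).after.done = true} := by
  have key : ∀ k ≤ I.numStates, I.toGame.Chain 0 {s | (md s).win = true}
      {s | (if (s : ℕ) < k then (md s).after.done else (md s).before.done) = true} := by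
    intro k
    induction k with
    | zero => intro _; simpa using hc
    | succ k ih =>
      intro hk
      let s : Fin I.numStates := ⟨k, hk⟩
      have hD : {t | (infoAt md s t).core.done = true} = {t : Fin I.numStates |
          (if (t : ℕ) < k then (md t).after.done else (md t).before.done) = true} := by
        ext t
        rw [Set.mem_ofPred_eq, core_done_infoAt]
        rfl
      have hlt : ∀ t : Fin I.numStates, t ≠ s → ((t : ℕ) ≤ k ↔ (t : ℕ) < k) := by
        intro t hts
        have : (t : ℕ) ≠ k := fun e => hts (Fin.ext e)
        omega
      by_cases hs : (md s).add = true ∧ (md s).done = false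
      · have hadd := addable_of_record_ok (htgt s) hs.1 (h s)
        rw [hD] at hadd
        convert (ih (by omega)).insert hadd (by simp [s, Mode.before, hs.2]) using 1
        ext t
        by_cases hts : t = s
        · subst hts
          simp [s, Mode.after, hs.1]
        · simp [hts, hlt t hts]
      · convert ih (by omega) using 1
        ext t
        by_cases hts : t = s
        · subst hts
          have : (md s).after.done = (md s).before.done := by
            simp only [Mode.after, Mode.before]
            cases h1 : (md s).add <;> cases h2 : (md s).done <;> simp_all
          simp [this]
        · simp [hlt t hts]
  have := key _ le_rfl
  simpa using this

/-- By unique decoding, whatever a round reads is the given instance, annotated with modes and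
supports. -/
theorem exists_eq_map_record {rs : List Rec} {sh : List Bool} (hx : I.encode = encList Rec.enc rs)
    (hrs : RoundOK sh rs) : ∃ (md : Fin I.numStates → Mode)
      (B : (s : Fin I.numStates) → (p : Fin I.numTeam) → I.Av p.succ s → Bool),
      rs = (List.finRange I.numStates).map (fun s => I.record s (md s) (B s)) ∧
      (∀ s, (md s).tgt = decide (s ∈ I.target)) ∧ (∀ s, (md s).ini = decide (s = I.init)) ∧
      ∀ s, (I.record s (md s) (B s)).OK sh ((List.finRange I.numStates).map (infoAt md s)) := by
  rw [encode_eq, encList_recEnc] at hx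
  have hp := encList_plainEnc_injective hx
  have hlen : I.numStates = rs.length := by simpa using congrArg List.length hp
  let f : Fin I.numStates → Rec := fun i => rs[(i : ℕ)]'(hlen ▸ i.2)
  have hf : rs = (List.finRange I.numStates).map f := by
    refine List.ext_getElem (by simp [hlen]) fun i h₁ h₂ => ?_
    simp [f]
  have hok := roundOK_map_finRange.1 (hf ▸ hrs)
  have hpl : ∀ s, I.plain s = (f s).plain := by
    rw [hf, List.map_map, List.map_inj_left] at hp
    exact fun s => hp s (List.mem_finRange s)
  choose B hB using fun s => I.eq_record (hok s) (hpl s).symm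
  refine ⟨fun s => (f s).md, B, hf.trans (List.map_congr_left fun s _ => hB s), fun s => ?_,
    fun s => ?_, fun s => ?_⟩
  · exact (congrArg Plain.tgt (hpl s)).symm
  · exact (congrArg Plain.ini (hpl s)).symm
  · rw [← hB s]
    exact hok s

/-- The ranked states can be ranked one after the other inside the guessed region. -/
def IsRanked (I : Instance) (W : Set (Fin I.numStates)) (cs : List Core) : Prop :=
  ∃ c : Fin I.numStates → Core, cs = (List.finRange I.numStates).map c ∧
    W = {s | (c s).win = true} ∧ I.toGame.Chain 0 W {s | (c s).done = true}

/-- A round never changes the flags of the guessed region, so successive rounds build a chain inside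
one and the same region. -/
theorem isRanked_after {rs : List Rec} {sh : List Bool} (hx : I.encode = encList Rec.enc rs)
    (hrs : RoundOK sh rs) {W : Set (Fin I.numStates)}
    (h : I.IsRanked W (rs.map fun r => r.md.before)) :
    I.IsRanked W (rs.map fun r => r.md.after) := by
  obtain ⟨md, B, rfl, htgt, -, hok⟩ := exists_eq_map_record hx hrs
  obtain ⟨c, hc, rfl, hch⟩ := h
  rw [List.map_map, List.map_inj_left] at hc
  have hc' : c = fun s => (md s).before := funext fun s => (hc s (List.mem_finRange s)).symm
  subst hc'
  exact ⟨fun s => (md s).after, by rw [List.map_map]; rfl, rfl, chain_of_records_ok htgt hok hch⟩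

theorem isRanked_of_rounds {sh : List Bool} {n : ℕ} {cs cs' : List Core}
    (h : Rounds I.encode sh n cs cs') {W : Set (Fin I.numStates)} (hcs : I.IsRanked W cs) :
    I.IsRanked W cs' := by
  induction h with
  | refl cs => exact hcs
  | step hx hrs _ ih => exact ih (isRanked_after hx hrs hcs)

end Instance

/-- At the start nothing is ranked, and the only record flagged as initial also belongs to the
region. The rounds extend the empty chain, and the final check says that it exhausts the region. -/
theorem mem_almostSureProblem_of_accepts {n : ℕ} {x : List Γ'} (h : Accepts n x) :
    x ∈ almostSureProblem := by
  obtain ⟨sh, rs, cs, hini, rfl, hrs, hrounds, hcs⟩ := h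
  obtain ⟨I, hI⟩ := exists_instance_of_roundOK hrs hini
  have hx : I.encode = encList Rec.enc rs := by rw [I.encode_eq, hI, encList_recEnc]
  refine ⟨I, hx, ?_⟩
  rw [Game.almostSure_iff_chain (o := 0) rfl]
  rw [← hx] at hrounds
  obtain ⟨md, B, hrs', -, hmi, -⟩ := Instance.exists_eq_map_record hx hrs
  have hinit : ∀ c ∈ rs.map (fun r => r.md.before), c.done = false ∧ (c.ini = true → c.win = true) := by
    obtain ⟨l, l', hl⟩ := hini
    rw [hl]
    intro c hc
    simp only [List.mem_append, List.mem_map, List.mem_cons] at hc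
    rcases hc with ⟨w, -, rfl⟩ | rfl | ⟨w, -, rfl⟩ <;> simp
  have hmem : ∀ s, (md s).before ∈ rs.map (fun r => r.md.before) := fun s => by
    rw [hrs', List.map_map]
    exact List.mem_map.2 ⟨s, List.mem_finRange s, rfl⟩
  have hranked : I.IsRanked {s | (md s).win = true} (rs.map fun r => r.md.before) := by
    refine ⟨fun s => (md s).before, by rw [hrs', List.map_map]; rfl, rfl, ?_⟩
    convert Game.Chain.empty
    rw [Set.eq_empty_iff_forall_notMem]
    intro s hs
    simp [(hinit _ (hmem s)).1] at hs
  obtain ⟨c, rfl, hW, hch⟩ :=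
    Instance.isRanked_of_rounds hrounds (Instance.isRanked_after hx hrs hranked)
  refine ⟨{s | (md s).win = true}, ?_, ?_⟩
  · exact (hinit _ (hmem I.init)).2 ((hmi I.init).trans (decide_eq_true rfl))
  · convert hch using 1
    refine Set.Subset.antisymm (fun s hs => ?_) hch.subset
    rw [hW] at hs
    have := hcs (c s) (List.mem_map.2 ⟨s, List.mem_finRange s, rfl⟩)
    rw [Set.mem_ofPred_eq] at hs
    simpa [hs] using this

/-! ### Completeness -/

theorem Rounds.snoc {x : List Γ'} {sh : List Bool} {n : ℕ} {cs cs' : List Core} {rs : List Rec}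
    (h : Rounds x sh n cs cs') (hcs : cs' = rs.map fun r => r.md.before)
    (hx : x = encList Rec.enc rs) (hrs : RoundOK sh rs) :
    Rounds x sh (n + 1) cs (rs.map fun r => r.md.after) := by
  induction h with
  | refl cs => exact hcs ▸ .step hx hrs (.refl _)
  | step hx' hrs' _ ih => exact .step hx' hrs' (ih hcs)

namespace Instance

variable {I : Instance}

open Classical in
/-- The guesses for a round that adds the states of `D'` to the set `D` of ranked states. -/
def modeAt (I : Instance) (W D D' : Set (Fin I.numStates)) (t : Fin I.numStates) : Mode :=
  ⟨decide (t ∈ I.target), decide (t = I.init), decide (t ∈ W), decide (t ∈ D), decide (t ∈ D')⟩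

open Classical in
/-- The records when `D` is the set of ranked states. -/
def coreAt (I : Instance) (W D : Set (Fin I.numStates)) (t : Fin I.numStates) : Core :=
  ⟨decide (t = I.init), decide (t ∈ W), decide (t ∈ D)⟩

/-- States outside `D'` are merely read, and targets in `D'` need no supports. For the other states
of `D'` the supports that witness addability pass the checks. -/
theorem exists_round {W D D' : Set (Fin I.numStates)} (hadd : ∀ s ∈ D', I.toGame.Addable 0 W D s) :
    ∃ rs, I.encode = encList Rec.enc rs ∧ RoundOK I.shape rs ∧
      (rs.map fun r => r.md.before) = (List.finRange I.numStates).map (I.coreAt W D) ∧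
      (rs.map fun r => r.md.after) = (List.finRange I.numStates).map (I.coreAt W (D ∪ D')) := by
  classical
  have hB : ∀ s, ∃ B : (p : Fin (I.numTeam + 1)) → I.Av p s → Bool,
      s ∈ D' → s ∉ I.target → I.toGame.Closed 0 W B ∧ I.toGame.Hits 0 D B := by
    intro s
    by_cases hs : s ∈ D' ∧ s ∉ I.target
    · obtain ⟨B, hB⟩ := (hadd s hs.1).2.resolve_left hs.2
      exact ⟨B, fun _ _ => hB⟩
    · exact ⟨fun _ _ => true, fun h h' => absurd ⟨h, h'⟩ hs⟩
  choose B hB using hB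
  let md := I.modeAt W D D'
  refine ⟨(List.finRange I.numStates).map fun s => I.record s (md s) fun p => B s p.succ,
    ?_, roundOK_map_finRange.2 fun s => I.record_ok_iff.2 ⟨?_, rfl, fun b => ⟨?_, ?_⟩⟩, ?_, ?_⟩
  · rw [encode_eq, encList_recEnc, List.map_map]
    congr 1
    exact List.map_congr_left fun s _ => (I.plain_record s _ _ rfl rfl).symm
  · by_cases hs : s ∈ D'
    · simp [md, modeAt, (hadd s hs).1]
    · simp [md, modeAt, hs]
  · intro a t ht
    change (md s).permits _ (infoAt md s t) = true
    rw [Mode.permits]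
    by_cases hs : s ∈ I.target
    · have : (md s).tgt = true := decide_eq_true hs
      rw [if_pos this, isCur_infoAt]
      by_contra hne
      exact ht (I.absorbing s hs _ t hne)
    · have : ¬ (md s).tgt = true := by simpa [md, modeAt] using hs
      rw [if_neg this, core_win_infoAt]
      by_cases hs' : s ∈ D'
      · by_cases ha : ∀ p : Fin I.numTeam, B s p.succ (a p) = true
        · have : t ∈ W := closed_iff.1 (hB s hs' hs).1 b a ha t ht
          simp [md, modeAt, this]
        · simp [ha]
      · simp [md, modeAt, hs']
  · intro hc
    have hs : s ∈ D' ∧ s ∉ I.target := by simpa [md, modeAt, Mode.check, record] using hc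
    obtain ⟨a, ha, t, ht, htD⟩ := hits_iff.1 (hB s hs.1 hs.2).2 b
    refine ⟨a, ha, t, ht, ?_⟩
    change (infoAt md s t).core.done = true
    rw [core_done_infoAt]
    -- Records updated earlier in the round only enlarge the set of ranked states, so a state of `D`
    -- is marked as ranked on either side of `s`.
    split_ifs <;> simp [md, modeAt, Mode.before, Mode.after, htD]
  · rw [List.map_map]
    rfl
  · rw [List.map_map]
    refine List.map_congr_left fun s _ => ?_
    simp [record, md, modeAt, coreAt, Mode.after]

/-- One round per element of the chain, each ranking a single state. -/
theorem exists_rounds {W D : Set (Fin I.numStates)} (h : I.toGame.Chain 0 W D) :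
    Rounds I.encode I.shape D.ncard ((List.finRange I.numStates).map (I.coreAt W ∅))
      ((List.finRange I.numStates).map (I.coreAt W D)) := by
  induction h with
  | empty =>
    rw [Set.ncard_empty]
    exact .refl _
  | @insert D s _ hs hsD ih =>
    obtain ⟨rs, hx, hrs, hb, ha⟩ := exists_round (D' := {s}) fun t ht =>
      (Set.mem_singleton_iff.1 ht) ▸ hs
    rw [Set.ncard_insert_of_notMem hsD]
    rw [Set.union_singleton] at ha
    exact ha ▸ ih.snoc hb.symm hx hrs

theorem initial_map_coreAt {W : Set (Fin I.numStates)} (hW : I.init ∈ W) :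
    Initial ((List.finRange I.numStates).map (I.coreAt W ∅)) := by
  classical
  obtain ⟨l, l', hl⟩ := List.append_of_mem (List.mem_finRange I.init)
  have hnd := List.nodup_finRange I.numStates
  rw [hl, List.nodup_middle, List.nodup_cons, List.mem_append, not_or] at hnd
  have hne : ∀ t, t ≠ I.init → I.coreAt W ∅ t = ⟨false, decide (t ∈ W), false⟩ := by
    intro t ht
    simp [coreAt, ht]
  refine ⟨l.map fun t => decide (t ∈ W), l'.map fun t => decide (t ∈ W), ?_⟩
  rw [hl, List.map_append, List.map_cons, List.map_map, List.map_map]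
  congr 1
  · exact List.map_congr_left fun t ht => hne t fun e => hnd.1.1 (e ▸ ht)
  · congr 1
    · simp [coreAt, hW]
    · exact List.map_congr_left fun t ht => hne t fun e => hnd.1.2 (e ▸ ht)

theorem numStates_le_length_encode (I : Instance) : I.numStates ≤ I.encode.length := by
  have := length_le_length_encList I.encState (fun s => by simp [encState])
    (List.finRange I.numStates)
  simpa [encode] using this

end Instance

theorem exists_accepts {x : List Γ'} (hx : x ∈ almostSureProblem) :
    ∃ n ≤ x.length, Accepts n x := by
  classical
  obtain ⟨I, rfl, hI⟩ := hx
  rw [Game.almostSure_iff_chain (o := 0) rfl] at hI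
  obtain ⟨W, hW, hch⟩ := hI
  -- The obligatory first round ranks nothing; it is followed by one round for each state of `W`,
  -- and there are at most as many states as symbols in the input.
  obtain ⟨rs, hx, hrs, hb, ha⟩ := Instance.exists_round (I := I) (W := W) (D := ∅) (D' := ∅)
    fun s hs => absurd hs (Set.notMem_empty s)
  rw [Set.union_empty] at ha
  refine ⟨W.ncard, le_trans ?_ I.numStates_le_length_encode, I.shape, rs, _,
    hb ▸ Instance.initial_map_coreAt hW, hx, hrs, ha ▸ Instance.exists_rounds hch, ?_⟩
  · simpa using Set.ncard_le_ncard (Set.subset_univ W)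
  · intro c hc
    obtain ⟨s, -, rfl⟩ := List.mem_map.1 hc
    simp [Instance.coreAt]

end TeamGames

end

theorem mainTheorem5 : TeamGames.InNP TeamGames.almostSureProblem :=
  TeamGames.inNP_of_accepts _ (fun _ _ => TeamGames.mem_almostSureProblem_of_accepts)
    fun _ => TeamGames.exists_accepts
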